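/- Let $1\le k\le n$ be integers and $K=k(n-k+1)$. A $(K,k)$ Dyck path $D$ is a lattice path with north and east steps from $(0,0)$ to $(k,K)$ that stays weakly above the diagonal; let $r_i$ be the number of its north steps on the line $x=i-1$, i.e. just left of column $i$ ($1\le i\le k$). Boxes of the $K\times k$ grid are denoted by the coordinates of their lower left corner, and a diagonal is a set of boxes that pairwise differ by integer multiples of $(1,K/k)$. An ordered pair $(a,a')$ of boxes is attacking if $a,a'$ are on the same diagonal with $a$ to the left of $a'$, or $a$ is one diagonal below $a'$ and to the right of $a'$. For a labelling $P$ of a set of boxes by positive integers, strictly increasing up each column, $\mathrm{tdinv}(P)$ is the number of attacking pairs $(a,a')$ of labelled boxes with $P(a)<P(a')$, and $x^P=\prod_a x_{P(a)}$. Let $\mathrm{maxtdinv}(D)$ be the largest $\mathrm{tdinv}$ of such a labelling of all boxes immediately to the right of the north steps of $D$. Let $\mathrm{pathdinv}(D)$ be the number of boxes above $D$ such that $\frac{\mathrm{arm}}{\mathrm{leg}+1}\le \frac kK<\frac{\mathrm{arm}+1}{\mathrm{leg}}$ (the right side being $\infty$ if $\mathrm{leg}=0$), where $\mathrm{arm}$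 and $\mathrm{leg}$ are the numbers of boxes above $D$ to the right of the box in its row, respectively below the box in its column. Let $\underline b=(b_1,\dots,b_k)$ be a sequence of nonnegative integers with $b_i\le r_i$ and $\sum_i b_i=(k-1)(n-k)$. The big boxes are the top $b_i$ boxes of column $i$ immediately to the right of a north step of $D$, for each $i$; the other boxes immediately to the right of a north step are small. Let $d(\underline s,\underline b)$ be the number of attacking pairs $(c,c')$ with $c$ small and $c'$ big, let $$f_{D,\underline b}=\sum_P q^{\mathrm{tdinv}(P)}x^P,$$ the sum over all labellings $P$ of the big boxes by positive integers, strictly increasing up each column, and let $$c_{D,\underline b}=\mathrm{maxtdinv}(D)-\mathrm{pathdinv}(D)-d(\underline s,\underline b).$$ Let $\langle\cdot,\cdot\rangle$ be the Hall inner product, $\langle s_\lambda,s_\mu\rangle=\delta_{\lambda\mu}$, and $\omega$ the involution $s_\lambda\mapsto s_{\lambda'}$, on symmetric functions over $\mathbb Q(q)$. Then $f_{D,\underline b}$ is a symmetric function. If $\underline b$ is admissible, that is, $b_i\le n-k$ for all $i$, then $$\langle \omega f_{D,\underline b},s_{(n-k)^{k-1}}\rangle=\langle f_{D,\underline b},s_{(k-1)^{n-k}}\rangle=q^{c_{D,\underline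 b}}.$$ If $\underline b$ is not admissible, then $\langle f_{D,\underline b},s_{(k-1)^{n-k}}\rangle=0$. -/

import Mathlib

/-! ### Symmetric functions

Symmetric functions over `R` are formal power series in the variables `x_0, x_1, x_2, …`. -/

/-- `f` is a symmetric function: a formal power series of bounded degree, invariant under all
permutations of the variables. -/
def IsSymmetricFunction {R : Type*} [CommRing R] (f : MvPowerSeries ℕ R) : Prop :=
  (∃ N : ℕ, ∀ d : ℕ →₀ ℕ, MvPowerSeries.coeff d f ≠ 0 → d.degree ≤ N) ∧
  ∀ (σ : Equiv.Perm ℕ) (d : ℕ →₀ ℕ),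
    MvPowerSeries.coeff (d.mapDomain σ) f = MvPowerSeries.coeff d f

/-- The complete homogeneous symmetric function `h_m`, the sum of all monomials of degree `m`;
it is `0` for `m < 0`. -/
noncomputable def completeHomog (R : Type*) [CommRing R] (m : ℤ) : MvPowerSeries ℕ R :=
  fun d => if (d.degree : ℤ) = m then 1 else 0

/-- The Schur function `s_λ`, by the Jacobi-Trudi formula `det (h_{λ_i - i + j})`. -/
noncomputable def schurFunction (R : Type*) [CommRing R] (lam : YoungDiagram) :
    MvPowerSeries ℕ R :=
  Matrix.det (Matrix.of fun i j : Fin (lam.colLen 0) =>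
    completeHomog R ((lam.rowLen i : ℤ) - (i : ℤ) + (j : ℤ)))

open Classical in
/-- The coefficients `c` of the expansion `f = ∑ c_λ s_λ` of `f` into Schur functions. The Schur
functions form a basis of the module of symmetric functions, so the expansion exists and is unique
for every symmetric function `f` (and it does not exist for any other power series, where the
value is `0`). -/
noncomputable def schurCoeffs {R : Type*} [CommRing R] (f : MvPowerSeries ℕ R) :
    YoungDiagram →₀ R :=
  if h : ∃ c : YoungDiagram →₀ R, f = c.sum fun lam a => a • schurFunction R lam
  then h.choose else 0

/-- The Hall inner product, the bilinear form with `⟨s_λ, s_μ⟩ = δ_{λμ}`. -/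
noncomputable def hallInner {R : Type*} [CommRing R] (f g : MvPowerSeries ℕ R) : R :=
  (schurCoeffs f).sum fun lam a => a * schurCoeffs g lam

/-- The involution `ω` on symmetric functions, the linear map with `ω s_λ = s_{λ'}`, where `λ'` is
the conjugate partition. -/
noncomputable def omegaInvolution {R : Type*} [CommRing R] (f : MvPowerSeries ℕ R) :
    MvPowerSeries ℕ R :=
  (schurCoeffs f).sum fun lam a => a • schurFunction R lam.transpose

/-- The rectangular partition `(c^r)`, with `r` rows of length `c`. -/
def rectDiagram (r c : ℕ) : YoungDiagram where
  cells := Finset.range r ×ˢ Finset.range c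
  isLowerSet := by
    intro a b hab ha
    simp only [Finset.coe_product, Finset.coe_range, Set.mem_prod, Set.mem_Iio] at ha ⊢
    exact ⟨lt_of_le_of_lt hab.1 ha.1, lt_of_le_of_lt hab.2 ha.2⟩

/-! ### Rational Dyck paths

A box of the grid of height `K` and width `k` is given by its column `i : Fin k` and its row
`y < K`, the coordinates of its lower left corner. -/

/-- A `(K, k)` Dyck path: a lattice path with north and east steps from `(0, 0)` to `(k, K)` that
stays weakly above the diagonal. It is given by the numbers `run i` of north steps on the vertical
lines `x = i`, for `i < k`. (There are none on `x = k`.) The path is weakly above the diagonal when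
the end `(i + 1, run 0 + ⋯ + run i)` of each east step is. -/
structure RatDyckPath (K k : ℕ) where
  run : Fin k → ℕ
  sum_run : ∑ i, run i = K
  above_diag : ∀ i : Fin k, K * ((i : ℕ) + 1) ≤ k * ∑ j ∈ Finset.Iic i, run j

/-- The index of the diagonal of a box, for the slope `K / k` (used only when `k ∣ K`): two boxes
are on the same diagonal when they differ by a multiple of `(1, K / k)`. -/
def boxDiag (K : ℕ) {k : ℕ} (a : Fin k × ℕ) : ℤ :=
  (a.2 : ℤ) - ((K / k : ℕ) : ℤ) * ((a.1 : ℕ) : ℤ)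

/-- `(a, b)` is an attacking pair: `a` and `b` are on the same diagonal with `a` to the left of
`b`, or `a` is one diagonal below `b` and to the right of `b`. -/
def Attacking (K : ℕ) {k : ℕ} (a b : Fin k × ℕ) : Prop :=
  (boxDiag K a = boxDiag K b ∧ a.1 < b.1) ∨ (boxDiag K a + 1 = boxDiag K b ∧ b.1 < a.1)

instance (K : ℕ) {k : ℕ} (a b : Fin k × ℕ) : Decidable (Attacking K a b) := by
  unfold Attacking; infer_instance

/-- A labelling of a set `S` of boxes is column-strict when it strictly increases up each column.
The label `i : ℕ` stands for the variable `x_i`, so labels start at `0`. -/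
def ColumnStrict {k : ℕ} {S : Finset (Fin k × ℕ)} (P : S → ℕ) : Prop :=
  ∀ a b : S, a.1.1 = b.1.1 → a.1.2 < b.1.2 → P a < P b

/-- `tdinv` of a labelling: the number of attacking pairs `(a, b)` of labelled boxes such that the
label of `a` is smaller than the label of `b`. -/
def tdinv (K : ℕ) {k : ℕ} {S : Finset (Fin k × ℕ)} (P : S → ℕ) : ℕ :=
  (Finset.univ.filter fun p : S × S => Attacking K p.1.1 p.2.1 ∧ P p.1 < P p.2).card

/-- The exponent of the monomial `x^P = ∏ x_{P a}` of a labelling `P`. -/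
noncomputable def content {k : ℕ} {S : Finset (Fin k × ℕ)} (P : S → ℕ) : ℕ →₀ ℕ :=
  ∑ a, Finsupp.single (P a) 1

open Classical in
/-- The generating function `∑_P q^{tdinv P} x^P` of the column-strict labellings `P` of `S`, given
by its coefficients: the coefficient of `x^d` is the sum of `q^{tdinv P}` over the column-strict
labellings with content `d`. (All labels of such a `P` are in the support of `d`.) -/
noncomputable def lltFunction {R : Type*} [CommRing R] (q : R) (K : ℕ) {k : ℕ}
    (S : Finset (Fin k × ℕ)) : MvPowerSeries ℕ R :=
  fun d => ∑ P ∈ (Fintype.piFinset fun _ : S => d.support).filter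
    (fun P => ColumnStrict P ∧ content P = d), q ^ tdinv K P

namespace RatDyckPath

variable {K k : ℕ} (D : RatDyckPath K k)

/-- The height at which the vertical run of column `i` starts. -/
def bot (i : Fin k) : ℕ := ∑ j ∈ Finset.Iio i, D.run j

/-- The height at which the vertical run of column `i` ends; the east step of the path in column
`i` is at this height. -/
def top (i : Fin k) : ℕ := ∑ j ∈ Finset.Iic i, D.run j

/-- The boxes immediately to the right of a north step of the path. -/
def boxes : Finset (Fin k × ℕ) :=
  (Finset.univ ×ˢ Finset.range K).filter fun c => D.bot c.1 ≤ c.2 ∧ c.2 < D.top c.1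

/-- The boxes of the grid above the path. -/
def aboveBoxes : Finset (Fin k × ℕ) :=
  (Finset.univ ×ˢ Finset.range K).filter fun c => D.top c.1 ≤ c.2

/-- The number of boxes above the path to the right of `c` in its row. -/
def arm (c : Fin k × ℕ) : ℕ := (D.aboveBoxes.filter fun e => e.2 = c.2 ∧ c.1 < e.1).card

/-- The number of boxes above the path below `c` in its column. -/
def leg (c : Fin k × ℕ) : ℕ := (D.aboveBoxes.filter fun e => e.1 = c.1 ∧ e.2 < c.2).card

/-- `pathdinv`: the number of boxes above the path with
`arm / (leg + 1) ≤ k / K < (arm + 1) / leg`, where the right-hand side is infinite for `leg = 0`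
(the inequalities are written with the denominators cleared). -/
def pathdinv : ℕ :=
  (D.aboveBoxes.filter fun c =>
    D.arm c * K ≤ k * (D.leg c + 1) ∧ k * D.leg c < (D.arm c + 1) * K).card

/-- `maxtdinv`: the largest `tdinv` of a parking function of shape `D`, that is, of a column-strict
labelling of all boxes to the right of the north steps of `D`. -/
noncomputable def maxtdinv : ℕ :=
  sSup {t | ∃ P : D.boxes → ℕ, ColumnStrict P ∧ tdinv K P = t}

/-- The big boxes: in each column `i`, the top `b i` boxes to the right of a north step. -/
def bigBoxes (b : Fin k → ℕ) : Finset (Fin k × ℕ) :=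
  D.boxes.filter fun c => D.top c.1 ≤ c.2 + b c.1

/-- The small boxes: the remaining boxes to the right of a north step. -/
def smallBoxes (b : Fin k → ℕ) : Finset (Fin k × ℕ) := D.boxes \ D.bigBoxes b

/-- `d(s, b)`: the number of attacking pairs `(c, c')` with `c` a small and `c'` a big box. -/
def smallBigPairs (b : Fin k → ℕ) : ℕ :=
  ((D.smallBoxes b ×ˢ D.bigBoxes b).filter fun p => Attacking K p.1 p.2).card

/-- The exponent `c_{D,b} = maxtdinv(D) - pathdinv(D) - d(s, b)`, an integer. -/
noncomputable def cExponent (b : Fin k → ℕ) : ℤ :=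
  (D.maxtdinv : ℤ) - (D.pathdinv : ℤ) - (D.smallBigPairs b : ℤ)

/-- The LLT-type symmetric function `f_{D,b}`, the generating function of the column-strict
labellings of the big boxes. -/
noncomputable def fBig {R : Type*} [CommRing R] (q : R) (b : Fin k → ℕ) : MvPowerSeries ℕ R :=
  lltFunction q K (D.bigBoxes b)

end RatDyckPath

/-! Write N = n - k, so that K = k(N + 1). Give a box the position k · (diagonal) + (column). Going
up one box adds k, the column is the residue modulo k, and (a, a') is attacking exactly when 0 < pos
a' - pos a < k (`attacking_iff`). Put one bead at the bottom of each column of big boxes. In a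
column-strict labelling, the boxes with the smallest label are the bottom boxes of a set U of
columns, and removing them moves the beads of U by k. Up to the factor q^`boundary`, which depends
only on the shape, q^tdinv is the product over all moves of q^(number of beads to the right). Hence
the coefficients of f are matrix entries of products of operators E_r, "move r of the k beads",
between the bottoms and the tops of the columns (`sum_labellings`, `coeff_lltFunction`).

Symmetry of f means that E_r and E_s commute (`transferSum_swap`). Once the beads moved twice and
those moved once are fixed, only the distribution of the latter over the two steps varies. Its
generating function by ascents is symmetric in the sizes of the two parts (`subsetSum_symm`).

For the Schur coefficient, Jacobi-Trudi gives a_δ s_μ = a_{μ+δ}, so the coefficient of s_λ is an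
alternating sum of monomial coefficients (`schurFunctional_eq_sum`). For N rows of length k - 1 this
is the determinant of the operators E_{k-(1+i-j)}. In terms of the beads that miss a step it is a
q-analogue of det(e_{1+i-j}) = h_N, so one expects a single term for each distribution of N misses
over the k beads; here bead j misses N - b_j steps. The proof expands along the first row, which
leads to matrices with a displaced first column (`alternatingSum_succ`). The value is a power of q
times an alternating sum of elementary symmetric polynomials in weight ratios ρ_j. For the
undisplaced matrix this sum is 1 - ∏(1 - ρ_j), and it equals 1 because the rightmost bead with a
miss left has ρ_j = 1 (`alternatingSum_eq`). If some b_j > N, that bead cannot arrive in N steps and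
the coefficient vanishes.

There remains the exponent N·C(k,2) - energy - boundary. The positions in one column form an
arithmetic progression with difference k, so counts of attacks telescope to comparisons of
endpoints, and the start of a vertical run is determined by the end of the preceding one
(`startPos_succ`). Both energy + boundary - d(s, b) and N·C(k,2) - (maxtdinv - pathdinv) reduce to
`endCount`, which involves only the ends of the runs (`energy_add_boundary_sub`,
`maxtdinv_sub_pathdinv_eq`). -/

/-! ### Alternants and Schur functions -/

namespace SymmetricFunction

open MvPowerSeries Finset

section Homog

variable {R : Type*} [CommRing R] {ι : Type*} [DecidableEq ι]

/-- The complete homogeneous symmetric function of degree `m` in the variables indexed by `S`. -/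
noncomputable def homogOn (R : Type*) [CommRing R] (S : Finset ι) (m : ℤ) : MvPowerSeries ι R :=
  fun d => if (d.degree : ℤ) = m ∧ d.support ⊆ S then 1 else 0

lemma coeff_homogOn (S : Finset ι) (m : ℤ) (d : ι →₀ ℕ) :
    coeff d (homogOn R S m) = if (d.degree : ℤ) = m ∧ d.support ⊆ S then 1 else 0 := rfl

lemma coeff_completeHomog (m : ℤ) (d : ℕ →₀ ℕ) :
    coeff d (completeHomog R m) = if (d.degree : ℤ) = m then 1 else 0 := rfl

lemma degree_embDomain {α β : Type*} (e : α ↪ β) (d : α →₀ ℕ) :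
    (d.embDomain e).degree = d.degree := by
  rw [Finsupp.degree_apply, Finsupp.degree_apply, Finsupp.support_embDomain, Finset.sum_map]
  simp

/-- Here `killCompl` sets the variables x_i with i ≥ M to zero; this is the passage to finitely many
variables. -/
lemma killCompl_completeHomog {M : ℕ} (m : ℤ) :
    killCompl (R := R) (Fin.valEmbedding : Fin M ↪ ℕ) (completeHomog R m)
      = homogOn R (univ : Finset (Fin M)) m := by
  ext d
  rw [coeff_killCompl, coeff_completeHomog, coeff_homogOn, degree_embDomain]
  simp

/-- The monomials divisible by x_i are x_i times the monomials of one degree less. In generating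
functions, multiplying H_S(t) by 1 - x_i t removes the variable x_i. -/
lemma homogOn_erase {S : Finset ι} {i : ι} (hi : i ∈ S) (m : ℤ) :
    homogOn R S m - X i * homogOn R S (m - 1) = homogOn R (S.erase i) m := by
  ext d
  rw [map_sub, X_def, coeff_monomial_mul, coeff_homogOn, coeff_homogOn, coeff_homogOn]
  by_cases h : d i = 0
  · rw [if_neg (show ¬ Finsupp.single i 1 ≤ d by simp [Finsupp.single_le_iff, h]), sub_zero]
    have : d.support ⊆ S ↔ d.support ⊆ S.erase i := by
      rw [Finset.subset_erase]; simp [h]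
    simp only [this]
  · have hle : Finsupp.single i 1 ≤ d := by
      rw [Finsupp.single_le_iff]; omega
    obtain ⟨e, rfl⟩ := exists_add_of_le hle
    have hn : ¬ (Finsupp.single i 1 + e).support ⊆ S.erase i := by
      rw [Finset.subset_erase]; simp
    have hs : (Finsupp.single i 1 + e).support ⊆ S ↔ e.support ⊆ S := by
      constructor
      · intro hh j hj
        exact hh (by simp only [Finsupp.mem_support_iff, Finsupp.add_apply] at hj ⊢; omega)
      · intro hh j hj
        by_cases hij : j = i
        · rwa [hij]
        · apply hh
          simp only [Finsupp.mem_support_iff, Finsupp.add_apply] at hj ⊢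
          rwa [Finsupp.single_eq_of_ne hij, zero_add] at hj
    rw [if_pos hle, add_tsub_cancel_left]
    simp only [hn, hs, and_false, if_false, map_add, Finsupp.degree_single, one_mul]
    have : ((1 + e.degree : ℕ) : ℤ) = m ↔ (e.degree : ℤ) = m - 1 := by push_cast; omega
    simp only [this, sub_self]

/-- The relation `H_S(t) ∏_{i ∈ T} (1 - x_i t) = H_{S \ T}(t)`, with the coefficients `c` of the
product left implicit. -/
lemma exists_homogOn_sdiff {S T : Finset ι} (hT : T ⊆ S) :
    ∃ c : ℕ → MvPowerSeries ι R, c 0 = 1 ∧ (∀ r, T.card < r → c r = 0) ∧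
      ∀ m : ℤ, ∑ r ∈ range (T.card + 1), c r * homogOn R S (m - r) = homogOn R (S \ T) m := by
  induction T using Finset.induction_on with
  | empty =>
    refine ⟨fun r => if r = 0 then 1 else 0, by simp, ?_, ?_⟩
    · intro r hr
      simp only [Finset.card_empty] at hr
      simp [hr.ne']
    · simp
  | insert i T hi ih =>
    obtain ⟨c, c0, cT, hc⟩ := ih ((Finset.subset_insert _ _).trans hT)
    -- These are the coefficients of the old polynomial multiplied by 1 - x_i t.
    refine ⟨fun r => c r - X i * (if r = 0 then 0 else c (r - 1)), by simp [c0], ?_, ?_⟩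
    · intro r hr
      rw [Finset.card_insert_of_notMem hi] at hr
      have h0 : r ≠ 0 := by omega
      simp only [h0, if_false]
      rw [cT r (by omega), cT (r - 1) (by omega)]
      simp
    · intro m
      rw [Finset.card_insert_of_notMem hi]
      have hS : S \ insert i T = (S \ T).erase i := by
        ext j; simp only [mem_sdiff, mem_insert, mem_erase]; tauto
      rw [hS, ← homogOn_erase (by simp [hi, hT (Finset.mem_insert_self _ _)]), ← hc m,
        ← hc (m - 1)]
      simp only [sub_mul, Finset.sum_sub_distrib]
      congr 1
      · rw [Finset.sum_range_succ, cT _ (Nat.lt_succ_self _), zero_mul, add_zero]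
      · rw [Finset.sum_range_succ', Finset.mul_sum]
        simp only [if_true, mul_zero, zero_mul, add_zero]
        refine Finset.sum_congr rfl fun r _ => ?_
        rw [if_neg (Nat.succ_ne_zero r), Nat.add_sub_cancel, mul_assoc]
        congr 3
        push_cast
        ring

lemma homogOn_singleton (i : ι) (a : ℕ) : homogOn R {i} (a : ℤ) = X i ^ a := by
  ext d
  rw [coeff_homogOn, coeff_X_pow]
  congr 1
  apply propext
  constructor
  · rintro ⟨h1, h2⟩
    rw [Finsupp.support_subset_singleton] at h2
    rw [h2, Finsupp.degree_single] at h1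
    rw [h2]
    norm_cast at h1
    rw [h1]
  · rintro rfl
    exact ⟨by simp, Finsupp.support_single_subset⟩

lemma homogOn_zero (S : Finset ι) : homogOn R S 0 = 1 := by
  ext d
  rw [coeff_homogOn, coeff_one]
  congr 1
  apply propext
  constructor
  · rintro ⟨h, -⟩
    exact (Finsupp.degree_eq_zero_iff d).1 (by exact_mod_cast h)
  · rintro rfl
    simp

lemma homogOn_neg (S : Finset ι) {m : ℤ} (hm : m < 0) : homogOn R S m = 0 := by
  ext d
  rw [coeff_homogOn, if_neg (by rintro ⟨h, -⟩; omega), coeff_zero]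

lemma homogOn_empty {m : ℤ} (hm : m ≠ 0) : homogOn R (∅ : Finset ι) m = 0 := by
  ext d
  rw [coeff_homogOn, coeff_zero, if_neg]
  rintro ⟨h, h2⟩
  rw [Finset.subset_empty, Finsupp.support_eq_empty] at h2
  subst h2
  simp at h
  exact hm h.symm

end Homog

section Alternants

variable {R : Type*} [CommRing R]

/-- The alternant `det (x_k ^ α_i)`. -/
noncomputable def alternant (R : Type*) [CommRing R] {M : ℕ} (α : Fin M → ℕ) :
    MvPowerSeries (Fin M) R :=
  Matrix.det (Matrix.of fun i k : Fin M => (X k : MvPowerSeries (Fin M) R) ^ α i)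

/-- The Jacobi-Trudi determinant in `M` variables for a sequence of `M` integers. -/
noncomputable def jacobiTrudi (R : Type*) [CommRing R] {M : ℕ} (α : Fin M → ℕ) :
    MvPowerSeries (Fin M) R :=
  Matrix.det (Matrix.of fun i j : Fin M => homogOn R (univ : Finset (Fin M))
    ((α i : ℤ) - (i : ℕ) + (j : ℕ)))

/-- The exponents `α + δ` with `δ = (M - 1, …, 1, 0)`. -/
def shifted {M : ℕ} (α : Fin M → ℕ) (i : Fin M) : ℕ := α i + (M - 1 - i)

lemma jacobiTrudi_zero {M : ℕ} : jacobiTrudi R (0 : Fin M → ℕ) = 1 := by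
  unfold jacobiTrudi
  rw [Matrix.det_of_isUpperTriangular]
  · apply Finset.prod_eq_one
    intro i _
    simp [homogOn_zero]
  · intro i j hij
    simp only [id] at hij
    simp only [Matrix.of_apply, Pi.zero_apply]
    apply homogOn_neg
    have : (j : ℕ) < (i : ℕ) := hij
    push_cast
    omega

/-- Removing all variables except x_k from H(t) leaves 1 / (1 - x_k t), so x_k^a is a combination of
the h_{a-r} with coefficients independent of a. Therefore the matrix (x_k^{(α+δ)_i}) is the
Jacobi-Trudi matrix times a matrix B that does not depend on α. -/
theorem alternant_mul_jacobiTrudi {M : ℕ} (α : Fin M → ℕ) :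
    alternant R (shifted (0 : Fin M → ℕ)) * jacobiTrudi R α = alternant R (shifted α) := by
  have key : ∀ k : Fin M, ∃ c : ℕ → MvPowerSeries (Fin M) R, ∀ a : ℕ,
      ∑ r ∈ range M, c r * homogOn R (univ : Finset (Fin M)) ((a : ℤ) - r) = X k ^ a := by
    intro k
    obtain ⟨c, -, -, hc⟩ := exists_homogOn_sdiff (R := R) (Finset.subset_univ ({k}ᶜ))
    refine ⟨c, fun a => ?_⟩
    have h := hc a
    have hM : ({k}ᶜ : Finset (Fin M)).card + 1 = M := by
      rw [Finset.card_compl, Finset.card_singleton, Fintype.card_fin]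
      have := k.2
      omega
    rw [hM] at h
    rw [h, ← homogOn_singleton]
    congr 1
    ext j; simp
  choose c hc using key
  -- The reversed index M - 1 - j matches the convolution index r with the entry of δ in `shifted`.
  set B : Matrix (Fin M) (Fin M) (MvPowerSeries (Fin M) R) :=
    Matrix.of fun j k => c k (M - 1 - j) with hB
  have hmul : ∀ β : Fin M → ℕ, jacobiTrudi R β * B.det = alternant R (shifted β) := by
    intro β
    unfold jacobiTrudi alternant
    rw [← Matrix.det_mul]
    congr 1
    ext1 i k
    rw [Matrix.mul_apply, Matrix.of_apply, ← hc k, ← Fin.sum_univ_eq_sum_range (fun r =>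
      c k r * homogOn R univ (((shifted β i : ℕ) : ℤ) - (r : ℕ))), ← Equiv.sum_comp Fin.revPerm]
    refine Finset.sum_congr rfl fun j _ => ?_
    rw [hB, Matrix.of_apply, Matrix.of_apply, mul_comm]
    have hj := j.2
    have hi := i.2
    have h1 : M - 1 - ((Fin.revPerm j : Fin M) : ℕ) = j := by
      simp only [Fin.revPerm_apply, Fin.val_rev]; omega
    rw [h1]
    congr 2
    simp only [Fin.revPerm_apply, Fin.val_rev, shifted]
    omega
  -- For α = 0 the Jacobi-Trudi matrix is unitriangular, which identifies det B with a_δ.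
  have h0 := hmul 0
  rw [jacobiTrudi_zero, one_mul] at h0
  rw [← h0, mul_comm, hmul]

end Alternants

end SymmetricFunction

/-! ### Schur coefficients as alternating sums of monomial coefficients. -/

namespace SymmetricFunction

open MvPowerSeries Finset

section Functional

variable {R : Type*} [CommRing R]

/-- The row lengths of the first `M` rows of a Young diagram. -/
def rows (M : ℕ) (lam : YoungDiagram) (i : Fin M) : ℕ := lam.rowLen i

lemma rowLen_eq_zero_iff (lam : YoungDiagram) (i : ℕ) : lam.rowLen i = 0 ↔ lam.colLen 0 ≤ i := by
  rw [← not_lt, ← YoungDiagram.mem_iff_lt_colLen, YoungDiagram.mem_iff_lt_rowLen]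
  omega

lemma rows_injective {M : ℕ} {lam mu : YoungDiagram} (hl : lam.colLen 0 ≤ M)
    (hm : mu.colLen 0 ≤ M) (h : rows M lam = rows M mu) : lam = mu := by
  have h' : ∀ i, lam.rowLen i = mu.rowLen i := by
    intro i
    by_cases hi : i < M
    · exact congrFun h ⟨i, hi⟩
    · rw [(rowLen_eq_zero_iff lam i).2 (by omega), (rowLen_eq_zero_iff mu i).2 (by omega)]
  ext ⟨i, j⟩
  rw [YoungDiagram.mem_cells, YoungDiagram.mem_cells, YoungDiagram.mem_iff_lt_rowLen,
    YoungDiagram.mem_iff_lt_rowLen, h' i]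

/-- A zero part makes the last row (0, …, 0, 1). Thus the determinant may be padded from the number
of rows of λ up to the number of variables. -/
lemma det_toeplitz_succ {A : Type*} [CommRing A] (h : ℤ → A) (h0 : h 0 = 1)
    (hneg : ∀ m < 0, h m = 0) (a : ℕ → ℕ) (M : ℕ) (ha : a M = 0) :
    Matrix.det (Matrix.of fun i j : Fin (M + 1) => h ((a i : ℤ) - (i : ℕ) + (j : ℕ))) =
      Matrix.det (Matrix.of fun i j : Fin M => h ((a i : ℤ) - (i : ℕ) + (j : ℕ))) := by
  rw [Matrix.det_succ_row _ (Fin.last M), Finset.sum_eq_single (Fin.last M)]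
  · simp only [Matrix.of_apply, Fin.val_last, ha]
    simp only [Nat.cast_zero, zero_sub, neg_add_cancel, h0, mul_one, Fin.succAbove_last]
    rw [← two_mul, pow_mul]
    simp only [even_two, Even.neg_pow, one_pow, one_mul]
    congr 1
  · intro j _ hj
    have : (j : ℕ) < M := Fin.val_lt_last hj
    simp only [Matrix.of_apply, Fin.val_last, ha]
    rw [hneg _ (by push_cast; omega)]
    simp
  · simp

lemma det_toeplitz_of_le {A : Type*} [CommRing A] (h : ℤ → A) (h0 : h 0 = 1)
    (hneg : ∀ m < 0, h m = 0) (a : ℕ → ℕ) {L M : ℕ} (hLM : L ≤ M) (ha : ∀ i, L ≤ i → a i = 0) :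
    Matrix.det (Matrix.of fun i j : Fin M => h ((a i : ℤ) - (i : ℕ) + (j : ℕ))) =
      Matrix.det (Matrix.of fun i j : Fin L => h ((a i : ℤ) - (i : ℕ) + (j : ℕ))) := by
  induction M, hLM using Nat.le_induction with
  | base => rfl
  | succ M hM ih => rw [det_toeplitz_succ h h0 hneg a M (ha M hM), ih]

lemma killCompl_schurFunction (M : ℕ) (mu : YoungDiagram) :
    killCompl (R := R) (Fin.valEmbedding : Fin M ↪ ℕ) (schurFunction R mu) =
      Matrix.det (Matrix.of fun i j : Fin (mu.colLen 0) =>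
        homogOn R (univ : Finset (Fin M)) ((mu.rowLen i : ℤ) - (i : ℕ) + (j : ℕ))) := by
  unfold schurFunction
  rw [AlgHom.map_det]
  congr 1
  ext1 i j
  rw [AlgHom.mapMatrix_apply, Matrix.map_apply, Matrix.of_apply, Matrix.of_apply,
    killCompl_completeHomog]

lemma killCompl_schurFunction_of_le {M : ℕ} {mu : YoungDiagram} (h : mu.colLen 0 ≤ M) :
    killCompl (R := R) (Fin.valEmbedding : Fin M ↪ ℕ) (schurFunction R mu) =
      jacobiTrudi R (rows M mu) := by
  rw [killCompl_schurFunction]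
  exact (det_toeplitz_of_le (fun m => homogOn R (univ : Finset (Fin M)) m) (homogOn_zero _)
    (fun m hm => homogOn_neg _ hm) mu.rowLen h
    (fun i hi => (rowLen_eq_zero_iff mu i).2 hi)).symm

/-- In M variables H(t) is the inverse of a polynomial of degree at most M, which gives a linear
relation between h_m, …, h_{m-M} for every m ≠ 0. All L > M rows are nonempty, so the relevant m are
positive and the same relation holds between the columns of the whole matrix. -/
lemma killCompl_schurFunction_of_lt {M : ℕ} {mu : YoungDiagram} (h : M < mu.colLen 0) :
    killCompl (R := R) (Fin.valEmbedding : Fin M ↪ ℕ) (schurFunction R mu) = 0 := by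
  rw [killCompl_schurFunction]
  obtain ⟨c, c0, cM, hc⟩ := exists_homogOn_sdiff (R := R)
    (Finset.Subset.refl (univ : Finset (Fin M)))
  rw [Finset.card_univ, Fintype.card_fin] at cM hc
  set L := mu.colLen 0 with hL
  set A : Matrix (Fin L) (Fin L) (MvPowerSeries (Fin M) R) := Matrix.of fun i j =>
    homogOn R (univ : Finset (Fin M)) ((mu.rowLen i : ℤ) - (i : ℕ) + (j : ℕ)) with hA
  set v : Fin L → MvPowerSeries (Fin M) R := fun j => c (L - 1 - j) with hv
  have hAv : A.mulVec v = 0 := by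
    funext i
    have hi := i.2
    have hpos : mu.rowLen i ≠ 0 := by
      rw [Ne, rowLen_eq_zero_iff]; omega
    have h1 := hc ((mu.rowLen i : ℤ) - (i : ℕ) + (L - 1 : ℕ))
    rw [Finset.sdiff_self, homogOn_empty (by omega)] at h1
    rw [Pi.zero_apply, ← h1]
    have hsub : range (M + 1) ⊆ range L := Finset.range_subset_range.2 h
    have hext := Finset.sum_subset hsub (f := fun r : ℕ => c r * homogOn R univ
      ((mu.rowLen i : ℤ) - (i : ℕ) + (L - 1 : ℕ) - (r : ℕ))) (fun r _ hr => by
        rw [cM r (by simpa using hr), zero_mul])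
    rw [hext]
    rw [← Fin.sum_univ_eq_sum_range (fun r => c r * homogOn R univ
      ((mu.rowLen i : ℤ) - (i : ℕ) + (L - 1 : ℕ) - (r : ℕ))), ← Equiv.sum_comp Fin.revPerm]
    change ∑ j, A i j * v j = _
    refine Finset.sum_congr rfl fun j _ => ?_
    have hj := j.2
    rw [hA, hv, Matrix.of_apply, mul_comm]
    have h2 : ((Fin.revPerm j : Fin L) : ℕ) = L - 1 - j := by
      simp only [Fin.revPerm_apply, Fin.val_rev]; omega
    rw [h2]
    congr 2
    omega
  -- The adjugate turns A v = 0 into det A · v = 0, and the last entry of v is c 0 = 1; no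
  -- cancellation in the ring is needed.
  have h2 : A.det • v = 0 := by
    have := congrArg (A.adjugate.mulVec ·) hAv
    simpa [Matrix.mulVec_mulVec, Matrix.adjugate_mul, Matrix.smul_mulVec] using this
  have h3 := congrFun h2 ⟨L - 1, by omega⟩
  simpa [hv, c0] using h3

lemma alternant_eq_sum {M : ℕ} (α : Fin M → ℕ) :
    alternant R α = ∑ σ : Equiv.Perm (Fin M), (Equiv.Perm.sign σ : ℤ) •
      monomial (Finsupp.equivFunOnFinite.symm (α ∘ σ)) (1 : R) := by
  unfold alternant
  rw [Matrix.det_apply]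
  refine Finset.sum_congr rfl fun σ _ => ?_
  rw [Units.smul_def]
  congr 1
  simp only [Matrix.of_apply, X_pow_eq]
  rw [prod_monomial, Finset.prod_const_one]
  have : ∑ i, Finsupp.single i (α (σ i)) = Finsupp.equivFunOnFinite.symm (α ∘ σ) := by
    ext i
    simp [Finsupp.finsetSum_apply, Finsupp.single_apply]
  rw [this]

lemma strictAnti_shifted {M : ℕ} (lam : YoungDiagram) : StrictAnti (shifted (rows M lam)) := by
  intro i j hij
  have h1 := lam.rowLen_anti i j (le_of_lt hij)
  have h2 : (i : ℕ) < j := hij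
  have h3 := j.2
  simp only [shifted, rows]
  omega

/-- Among the permutations of a strictly decreasing vector only the vector itself is decreasing, so
only the identity term of the determinant can contribute. -/
lemma coeff_alternant {M : ℕ} {α β : Fin M → ℕ} (hα : StrictAnti α) (hβ : StrictAnti β) :
    coeff (Finsupp.equivFunOnFinite.symm β) (alternant R α) = if α = β then 1 else 0 := by
  classical
  rw [alternant_eq_sum, map_sum]
  have key : ∀ σ : Equiv.Perm (Fin M), α ∘ σ = β → σ = 1 := by
    intro σ h
    have hmono : StrictMono σ := by
      intro i j hij
      have := hβ hij
      rw [← h] at this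
      exact hα.lt_iff_gt.1 this
    have := (hmono.range_inj strictMono_id).1 (by
      rw [σ.surjective.range_eq, Function.surjective_id.range_eq])
    ext i
    simp [this]
  rw [Finset.sum_eq_single 1]
  · simp only [coeff_monomial, Equiv.Perm.sign_one, Units.val_one, one_smul,
      Equiv.Perm.coe_one, Function.comp_id]
    congr 1
    apply propext
    rw [EmbeddingLike.apply_eq_iff_eq]
    exact eq_comm
  · intro σ _ hσ
    rw [map_zsmul, coeff_monomial, if_neg, smul_zero]
    intro h
    rw [EmbeddingLike.apply_eq_iff_eq] at h
    exact hσ (key σ h.symm)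
  · simp

/-- The coefficient of `x^{λ + δ}` in `a_δ f`, in `M` variables. -/
noncomputable def schurFunctional (R : Type*) [CommRing R] (M : ℕ) (lam : YoungDiagram) :
    MvPowerSeries ℕ R →ₗ[R] R :=
  (coeff (Finsupp.equivFunOnFinite.symm (shifted (rows M lam)))).comp
    ((LinearMap.mulLeft R (alternant R (shifted (0 : Fin M → ℕ)))).comp
      (killCompl (R := R) (Fin.valEmbedding : Fin M ↪ ℕ)).toLinearMap)

lemma schurFunctional_apply (M : ℕ) (lam : YoungDiagram) (f : MvPowerSeries ℕ R) :
    schurFunctional R M lam f = coeff (Finsupp.equivFunOnFinite.symm (shifted (rows M lam)))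
      (alternant R (shifted (0 : Fin M → ℕ)) *
        killCompl (R := R) (Fin.valEmbedding : Fin M ↪ ℕ) f) := rfl

-- Since a_δ s_μ = a_{μ+δ} for μ with at most M rows, and s_μ dies in M variables otherwise, these
-- functionals are dual to the Schur functions.
open Classical in
theorem schurFunctional_schurFunction {M : ℕ} {lam : YoungDiagram} (hl : lam.colLen 0 ≤ M)
    (mu : YoungDiagram) :
    schurFunctional R M lam (schurFunction R mu) = if lam = mu then 1 else 0 := by
  rw [schurFunctional_apply]
  by_cases hm : mu.colLen 0 ≤ M
  · rw [killCompl_schurFunction_of_le hm, alternant_mul_jacobiTrudi,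
      coeff_alternant (strictAnti_shifted mu) (strictAnti_shifted lam)]
    congr 1
    apply propext
    constructor
    · intro h
      refine rows_injective hl hm ?_
      funext i
      have := congrFun h i
      simp only [shifted] at this
      omega
    · rintro rfl; rfl
  · rw [killCompl_schurFunction_of_lt (not_le.1 hm), mul_zero, coeff_zero, if_neg]
    rintro rfl
    exact hm hl

open Classical in
/-- The alternating sum of coefficients which expresses the coefficient of a Schur function. -/
theorem schurFunctional_eq_sum (M : ℕ) (lam : YoungDiagram) (f : MvPowerSeries ℕ R) :
    schurFunctional R M lam f = ∑ σ : Equiv.Perm (Fin M), (Equiv.Perm.sign σ : ℤ) •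
      (if ∀ i : Fin M, (i : ℕ) ≤ lam.rowLen i + (σ i : ℕ) then
        coeff (Finsupp.embDomain Fin.valEmbedding (Finsupp.equivFunOnFinite.symm
          fun i : Fin M => lam.rowLen i + (σ i : ℕ) - (i : ℕ))) f else 0) := by
  rw [schurFunctional_apply, alternant_eq_sum, Finset.sum_mul, map_sum]
  refine Finset.sum_congr rfl fun σ _ => ?_
  rw [smul_mul_assoc, map_zsmul, coeff_monomial_mul]
  congr 1
  -- The exponent left for f is (λ + δ)_i - δ_{σ i} = λ_i + σ i - i, and the monomial of a_δ divides
  -- x^{λ+δ} when all of these are nonnegative.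
  have hiff : (Finsupp.equivFunOnFinite.symm (shifted (0 : Fin M → ℕ) ∘ σ) ≤
      Finsupp.equivFunOnFinite.symm (shifted (rows M lam))) ↔
      ∀ i : Fin M, (i : ℕ) ≤ lam.rowLen i + (σ i : ℕ) := by
    rw [Finsupp.le_def]
    refine forall_congr' fun i => ?_
    have := i.2
    have := (σ i).2
    simp only [Finsupp.coe_equivFunOnFinite_symm, Function.comp, shifted, rows, Pi.zero_apply]
    omega
  by_cases h : ∀ i : Fin M, (i : ℕ) ≤ lam.rowLen i + (σ i : ℕ)
  · rw [if_pos h, if_pos (hiff.2 h), one_mul, coeff_killCompl]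
    congr 3
    ext i
    have := i.2
    have := (σ i).2
    have := h i
    simp only [Finsupp.tsub_apply, Finsupp.coe_equivFunOnFinite_symm, Function.comp, shifted,
      rows, Pi.zero_apply]
    omega
  · rw [if_neg h, if_neg (fun h' => h (hiff.1 h'))]

end Functional

end SymmetricFunction

/-! ### The Schur basis, the Hall inner product and ω. -/

namespace SymmetricFunction

open MvPowerSeries Finset

section Basis

lemma card_eq_sum_rowLen (mu : YoungDiagram) :
    mu.card = ∑ i : Fin (mu.colLen 0), mu.rowLen i := by
  rw [Fin.sum_univ_eq_sum_range (fun i => mu.rowLen i), YoungDiagram.card,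
    Finset.card_eq_sum_card_fiberwise (f := Prod.fst) (t := range (mu.colLen 0))]
  · refine Finset.sum_congr rfl fun i _ => ?_
    rw [YoungDiagram.rowLen_eq_card, YoungDiagram.row]
  · rintro ⟨i, j⟩ h
    have h : (i, j) ∈ mu := h
    have h0 := mu.up_left_mem le_rfl (Nat.zero_le j) h
    simpa using YoungDiagram.mem_iff_lt_colLen.1 h0

lemma finite_card_le (N : ℕ) : {mu : YoungDiagram | mu.card ≤ N}.Finite := by
  refine Set.Finite.of_injOn (f := YoungDiagram.cells)
    (t := ↑((range N ×ˢ range N).powerset)) ?_ ?_ (Finset.finite_toSet _)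
  · intro mu hmu
    simp only [Finset.coe_powerset, Set.mem_preimage, Set.mem_powerset_iff]
    intro c hc
    obtain ⟨i, j⟩ := c
    have hc : (i, j) ∈ mu := hc
    have hN : mu.cells.card ≤ N := hmu
    have h1 : i < mu.colLen j := YoungDiagram.mem_iff_lt_colLen.1 hc
    have h2 : j < mu.rowLen i := YoungDiagram.mem_iff_lt_rowLen.1 hc
    have h3 : mu.colLen j ≤ mu.cells.card := by
      rw [YoungDiagram.colLen_eq_card]; exact Finset.card_filter_le _ _
    have h4 : mu.rowLen i ≤ mu.cells.card := by
      rw [YoungDiagram.rowLen_eq_card]; exact Finset.card_filter_le _ _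
    simp only [coe_product, coe_range, Set.mem_prod, Set.mem_Iio]
    omega
  · intro a _ b _ h
    exact YoungDiagram.ext h

variable {R : Type*} [CommRing R]

lemma degree_of_coeff_mul_ne_zero {σ : Type*} {f g : MvPowerSeries σ R} {a b : ℤ}
    (hf : ∀ d, coeff d f ≠ 0 → (d.degree : ℤ) = a) (hg : ∀ d, coeff d g ≠ 0 → (d.degree : ℤ) = b)
    (d : σ →₀ ℕ) (h : coeff d (f * g) ≠ 0) : (d.degree : ℤ) = a + b := by
  classical
  rw [coeff_mul] at h
  obtain ⟨p, hp, hne⟩ := Finset.exists_ne_zero_of_sum_ne_zero h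
  rw [Finset.HasAntidiagonal.mem_antidiagonal] at hp
  rw [← hp, map_add, Nat.cast_add, hf _ (left_ne_zero_of_mul hne), hg _ (right_ne_zero_of_mul hne)]

lemma degree_of_coeff_prod_ne_zero {ι : Type*} (s : Finset ι) (a : ι → ℤ) (d : ℕ →₀ ℕ)
    (h : coeff d (∏ i ∈ s, completeHomog R (a i)) ≠ 0) : (d.degree : ℤ) = ∑ i ∈ s, a i := by
  classical
  induction s using Finset.induction_on generalizing d with
  | empty =>
    rw [Finset.prod_empty, coeff_one] at h
    have : d = 0 := by by_contra hd; exact h (if_neg hd)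
    simp [this]
  | insert i s hi ih =>
    rw [Finset.prod_insert hi] at h
    rw [Finset.sum_insert hi]
    refine degree_of_coeff_mul_ne_zero (fun d hd => ?_) ih d h
    rw [coeff_completeHomog] at hd
    by_contra hne
    exact hd (if_neg hne)

/-- Every term of the Jacobi-Trudi determinant has degree ∑ (λ_{σ i} - σ i + i) = |λ|. -/
lemma degree_of_coeff_schurFunction_ne_zero {mu : YoungDiagram} {d : ℕ →₀ ℕ}
    (h : coeff d (schurFunction R mu) ≠ 0) : d.degree = mu.card := by
  unfold schurFunction at h
  rw [Matrix.det_apply, map_sum] at h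
  obtain ⟨σ, -, hσ⟩ := Finset.exists_ne_zero_of_sum_ne_zero h
  rw [Units.smul_def, map_zsmul] at hσ
  have h1 : coeff d (∏ i, completeHomog R ((mu.rowLen (σ i) : ℤ) - (σ i : ℕ) + (i : ℕ))) ≠ 0 := by
    intro h0
    apply hσ
    simp only [Matrix.of_apply]
    rw [h0, smul_zero]
  have h2 := degree_of_coeff_prod_ne_zero _ _ _ h1
  rw [Finset.sum_add_distrib, Equiv.sum_comp σ (fun i => (mu.rowLen i : ℤ) - ((i : ℕ) : ℤ)),
    Finset.sum_sub_distrib, sub_add_cancel] at h2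
  rw [card_eq_sum_rowLen]
  exact_mod_cast h2

lemma rename_completeHomog (σ : Equiv.Perm ℕ) (m : ℤ) :
    rename (σ.toEmbedding : ℕ → ℕ) (completeHomog R m) = completeHomog R m := by
  ext d
  have hd : d = Finsupp.embDomain σ.toEmbedding (Finsupp.embDomain σ.symm.toEmbedding d) := by
    rw [Finsupp.embDomain_eq_mapDomain, Finsupp.embDomain_eq_mapDomain, ← Finsupp.mapDomain_comp]
    simp
  conv_lhs => rw [hd]
  rw [coeff_embDomain_rename, coeff_completeHomog, coeff_completeHomog, degree_embDomain]

lemma coeff_mapDomain_schurFunction (mu : YoungDiagram) (σ : Equiv.Perm ℕ) (d : ℕ →₀ ℕ) :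
    coeff (d.mapDomain σ) (schurFunction R mu) = coeff d (schurFunction R mu) := by
  have h : rename (σ.toEmbedding : ℕ → ℕ) (schurFunction R mu) = schurFunction R mu := by
    unfold schurFunction
    rw [AlgHom.map_det]
    congr 1
    ext1 i j
    rw [AlgHom.mapMatrix_apply, Matrix.map_apply, Matrix.of_apply, rename_completeHomog]
  have := coeff_embDomain_rename σ.toEmbedding (schurFunction R mu) d
  rwa [h, Finsupp.embDomain_eq_mapDomain] at this

/-- The exponent vector of a Young diagram. -/
noncomputable def rowExponent (lam : YoungDiagram) : ℕ →₀ ℕ :=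
  Finsupp.onFinset (range (lam.colLen 0)) lam.rowLen (fun i hi => by
    rw [mem_range]; by_contra h; exact hi ((rowLen_eq_zero_iff lam i).2 (not_lt.1 h)))

lemma degree_rowExponent (lam : YoungDiagram) : (rowExponent lam).degree = lam.card := by
  rw [card_eq_sum_rowLen, Fin.sum_univ_eq_sum_range (fun i => lam.rowLen i), Finsupp.degree_apply]
  exact Finset.sum_subset Finsupp.support_onFinset_subset (fun i _ hi => by
    simpa [rowExponent] using hi)

lemma exists_youngDiagram {r : ℕ → ℕ} (hr : Antitone r) {M : ℕ} (hM : ∀ i, M ≤ i → r i = 0) :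
    ∃ lam : YoungDiagram, ∀ i, lam.rowLen i = r i := by
  let lam : YoungDiagram :=
    { cells := (range M ×ˢ range (r 0 + 1)).filter fun c => c.2 < r c.1
      isLowerSet := by
        rintro ⟨a1, a2⟩ ⟨b1, b2⟩ hab ha
        have h1 : b1 ≤ a1 := hab.1
        have h2 : b2 ≤ a2 := hab.2
        simp only [coe_filter, mem_product, mem_range, Set.mem_ofPred_eq] at ha ⊢
        have := hr h1
        omega }
  refine ⟨lam, fun i => ?_⟩
  have hmem : ∀ j, (i, j) ∈ lam ↔ j < r i := by
    intro j
    rw [← YoungDiagram.mem_cells]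
    simp only [lam, mem_filter, mem_product, mem_range]
    constructor
    · exact fun h => h.2
    · intro h
      have h1 := hr (Nat.zero_le i)
      have h2 : i < M := by
        by_contra hi
        rw [hM i (not_lt.1 hi)] at h
        omega
      omega
  apply le_antisymm
  · by_contra h
    exact lt_irrefl _ ((hmem _).1 (YoungDiagram.mem_iff_lt_rowLen.2 (not_le.1 h)))
  · by_contra h
    exact lt_irrefl _ (YoungDiagram.mem_iff_lt_rowLen.1 ((hmem _).2 (not_le.1 h)))

lemma exists_mapDomain_eq_rowExponent (d : ℕ →₀ ℕ) :
    ∃ (σ : Equiv.Perm ℕ) (lam : YoungDiagram), d.mapDomain σ = rowExponent lam := by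
  obtain ⟨M, hM⟩ : ∃ M, d.support ⊆ range M := d.support.exists_nat_subset_range
  have hM' : ∀ i, M ≤ i → d i = 0 := by
    intro i hi
    by_contra h
    have := hM (Finsupp.mem_support_iff.2 h)
    rw [mem_range] at this
    omega
  -- The order dual makes `Tuple.sort` produce a decreasing sequence.
  let g : Fin M → ℕᵒᵈ := fun i => OrderDual.toDual (d i)
  let π := Tuple.sort g
  have hπ : Monotone (g ∘ π) := Tuple.monotone_sort g
  let σ : Equiv.Perm ℕ := π.extendDomain Fin.equivSubtype
  have hσ1 : ∀ i : Fin M, σ i = π i := by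
    intro i
    exact Equiv.Perm.extendDomain_apply_image π Fin.equivSubtype i
  have hσ2 : ∀ i, M ≤ i → σ i = i := fun i hi =>
    Equiv.Perm.extendDomain_apply_not_subtype _ _ (not_lt.2 hi)
  have hr0 : ∀ i, M ≤ i → d (σ i) = 0 := fun i hi => by rw [hσ2 i hi, hM' i hi]
  have hr : Antitone fun i => d (σ i) := by
    intro i j hij
    change d (σ j) ≤ d (σ i)
    by_cases hj : j < M
    · have h1 := hσ1 ⟨i, lt_of_le_of_lt hij hj⟩
      have h2 := hσ1 ⟨j, hj⟩
      rw [h1, h2]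
      exact hπ (show (⟨i, lt_of_le_of_lt hij hj⟩ : Fin M) ≤ ⟨j, hj⟩ from hij)
    · rw [hr0 j (not_lt.1 hj)]
      exact Nat.zero_le _
  obtain ⟨lam, hlam⟩ := exists_youngDiagram hr hr0
  refine ⟨σ.symm, lam, ?_⟩
  ext i
  rw [Finsupp.mapDomain_equiv_apply, Equiv.symm_symm]
  exact (hlam i).symm

variable {F : Type*} [Field F]

/-- The symmetric functions of degree at most `N`. -/
def symmetricSubmodule (F : Type*) [Field F] (N : ℕ) : Submodule F (MvPowerSeries ℕ F) where
  carrier := {f | (∀ d : ℕ →₀ ℕ, coeff d f ≠ 0 → d.degree ≤ N) ∧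
    ∀ (σ : Equiv.Perm ℕ) (d : ℕ →₀ ℕ), coeff (d.mapDomain σ) f = coeff d f}
  zero_mem' := by simp
  add_mem' := by
    rintro f g ⟨hf1, hf2⟩ ⟨hg1, hg2⟩
    refine ⟨fun d hd => ?_, fun σ d => by rw [map_add, map_add, hf2, hg2]⟩
    by_contra h
    apply hd
    rw [map_add, not_not.1 (mt (hf1 d) h), not_not.1 (mt (hg1 d) h), add_zero]
  smul_mem' := by
    rintro a f ⟨hf1, hf2⟩
    refine ⟨fun d hd => ?_, fun σ d => by rw [coeff_smul, coeff_smul, hf2]⟩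
    rw [coeff_smul] at hd
    exact hf1 d (right_ne_zero_of_mul hd)

/-- The coefficients of a symmetric function at the exponent vectors of Young diagrams. -/
noncomputable def rowCoeffs (F : Type*) [Field F] (N : ℕ) :
    symmetricSubmodule F N →ₗ[F] ({mu : YoungDiagram | mu.card ≤ N} → F) :=
  LinearMap.pi fun mu => (coeff (rowExponent mu.1)).comp (symmetricSubmodule F N).subtype

/-- Every exponent vector can be sorted into a partition, so a symmetric function is determined by
its coefficients at partitions. This bounds the dimension from above. -/
lemma rowCoeffs_injective (N : ℕ) : Function.Injective (rowCoeffs F N) := by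
  rw [injective_iff_map_eq_zero]
  rintro ⟨f, hf⟩ h
  obtain ⟨hf1, hf2⟩ := id hf
  apply Subtype.ext
  ext d
  change coeff d f = coeff d 0
  rw [coeff_zero]
  by_contra hd
  obtain ⟨σ, lam, hσ⟩ := exists_mapDomain_eq_rowExponent d
  have h1 := hf2 σ d
  rw [hσ] at h1
  have h2 : lam.card ≤ N := by
    rw [← degree_rowExponent]
    exact hf1 _ (by rwa [h1])
  have h3 : coeff (rowExponent lam) f = 0 := congrFun h ⟨lam, h2⟩
  exact hd (by rw [← h1, h3])

lemma schurFunction_mem (N : ℕ) {mu : YoungDiagram} (h : mu.card ≤ N) :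
    schurFunction F mu ∈ symmetricSubmodule F N :=
  ⟨fun d hd => by rwa [degree_of_coeff_schurFunction_ne_zero hd],
    coeff_mapDomain_schurFunction mu⟩

lemma schurFunctional_sum (lam : YoungDiagram) {M : ℕ} (h : lam.colLen 0 ≤ M)
    (c : YoungDiagram →₀ F) :
    schurFunctional F M lam (c.sum fun mu a => a • schurFunction F mu) = c lam := by
  classical
  rw [map_finsuppSum]
  simp only [map_smul, schurFunctional_schurFunction h, smul_eq_mul, mul_ite, mul_one, mul_zero]
  rw [Finsupp.sum_ite_eq]
  simp only [Finsupp.mem_support_iff, ite_not]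
  split_ifs with h0
  · exact h0.symm
  · rfl

lemma linearIndependent_schurFunction : LinearIndependent F (schurFunction F) := by
  rw [linearIndependent_iff]
  intro c hc
  ext lam
  have := schurFunctional_sum lam le_rfl c
  rw [Finsupp.linearCombination_apply] at hc
  rw [← this, hc, map_zero, Finsupp.zero_apply]

/-- A dimension count in degree at most N: the Schur functions of partitions of size at most N are
independent, and their number is the upper bound given by `rowCoeffs_injective`; hence they span. -/
theorem exists_schur_expansion {f : MvPowerSeries ℕ F} (hf : IsSymmetricFunction f) :
    ∃ c : YoungDiagram →₀ F, f = c.sum fun mu a => a • schurFunction F mu := by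
  obtain ⟨⟨N, hN⟩, hsymm⟩ := hf
  have : Fintype {mu : YoungDiagram | mu.card ≤ N} := (finite_card_le N).fintype
  have hfin : Module.Finite F (symmetricSubmodule F N) :=
    Module.Finite.of_injective (rowCoeffs F N) (rowCoeffs_injective N)
  let v : {mu : YoungDiagram | mu.card ≤ N} → symmetricSubmodule F N :=
    fun mu => ⟨schurFunction F mu.1, schurFunction_mem N mu.2⟩
  have hv : LinearIndependent F v := by
    apply LinearIndependent.of_comp (symmetricSubmodule F N).subtype
    exact linearIndependent_schurFunction.comp _ Subtype.val_injective
  have hcard : Fintype.card {mu : YoungDiagram | mu.card ≤ N} =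
      Module.finrank F (symmetricSubmodule F N) := by
    apply le_antisymm hv.fintype_card_le_finrank
    have := LinearMap.finrank_le_finrank_of_injective (rowCoeffs_injective (F := F) N)
    rwa [Module.finrank_pi] at this
  have hspan := hv.span_eq_top_of_card_eq_finrank' hcard
  have hmem : (⟨f, hN, hsymm⟩ : symmetricSubmodule F N) ∈ Submodule.span F (Set.range v) := by
    rw [hspan]; trivial
  have hmem2 : f ∈ Submodule.span F (Set.range (schurFunction F)) := by
    have h1 := Submodule.mem_map_of_mem (f := (symmetricSubmodule F N).subtype) hmem
    rw [Submodule.map_span] at h1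
    refine Submodule.span_mono ?_ h1
    rintro _ ⟨_, ⟨mu, rfl⟩, rfl⟩
    exact ⟨mu.1, rfl⟩
  obtain ⟨c, hc⟩ := Finsupp.mem_span_range_iff_exists_finsupp.1 hmem2
  exact ⟨c, hc.symm⟩

lemma schurCoeffs_sum (c : YoungDiagram →₀ F) :
    schurCoeffs (c.sum fun mu a => a • schurFunction F mu) = c := by
  have hex : ∃ c' : YoungDiagram →₀ F, (c.sum fun mu a => a • schurFunction F mu) =
    c'.sum fun mu a => a • schurFunction F mu := ⟨c, rfl⟩
  unfold schurCoeffs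
  rw [dif_pos hex]
  ext lam
  rw [← schurFunctional_sum lam le_rfl, ← hex.choose_spec, schurFunctional_sum lam le_rfl]

lemma schurCoeffs_schurFunction (mu : YoungDiagram) :
    schurCoeffs (schurFunction F mu) = Finsupp.single mu 1 := by
  have := schurCoeffs_sum (Finsupp.single mu (1 : F))
  rwa [Finsupp.sum_single_index (by simp), one_smul] at this

lemma hallInner_schurFunction (f : MvPowerSeries ℕ F) (mu : YoungDiagram) :
    hallInner f (schurFunction F mu) = schurCoeffs f mu := by
  classical
  unfold hallInner
  rw [schurCoeffs_schurFunction]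
  simp only [Finsupp.single_apply, mul_ite, mul_one, mul_zero]
  rw [Finsupp.sum_ite_eq]
  simp only [Finsupp.mem_support_iff, ite_not]
  split_ifs with h0
  · exact h0.symm
  · rfl

theorem hallInner_schurFunction_eq {f : MvPowerSeries ℕ F} (hf : IsSymmetricFunction f)
    {lam : YoungDiagram} {M : ℕ} (h : lam.colLen 0 ≤ M) :
    hallInner f (schurFunction F lam) = schurFunctional F M lam f := by
  obtain ⟨c, rfl⟩ := exists_schur_expansion hf
  rw [hallInner_schurFunction, schurCoeffs_sum, schurFunctional_sum lam h]

/-- On Schur coefficients ω is the relabelling λ ↦ λ', which is injective. -/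
theorem hallInner_omegaInvolution (f : MvPowerSeries ℕ F) (lam : YoungDiagram) :
    hallInner (omegaInvolution f) (schurFunction F lam.transpose) =
      hallInner f (schurFunction F lam) := by
  rw [hallInner_schurFunction, hallInner_schurFunction]
  have h : omegaInvolution f = ((schurCoeffs f).mapDomain YoungDiagram.transpose).sum
      fun mu a => a • schurFunction F mu := by
    unfold omegaInvolution
    rw [Finsupp.sum_mapDomain_index (by simp) (by intros; rw [add_smul])]
  rw [h, schurCoeffs_sum, Finsupp.mapDomain_apply]
  intro a b hab
  exact YoungDiagram.transpose_eq_iff.1 hab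

lemma transpose_rectDiagram (r c : ℕ) : (rectDiagram r c).transpose = rectDiagram c r := by
  ext ⟨i, j⟩
  rw [YoungDiagram.mem_cells, YoungDiagram.mem_transpose, ← YoungDiagram.mem_cells]
  simp [rectDiagram, and_comm]

lemma mem_rectDiagram {r c i j : ℕ} : (i, j) ∈ rectDiagram r c ↔ i < r ∧ j < c := by
  rw [← YoungDiagram.mem_cells]
  simp [rectDiagram]

lemma rowLen_rectDiagram {r c i : ℕ} (hi : i < r) : (rectDiagram r c).rowLen i = c := by
  have h : ∀ j, j < (rectDiagram r c).rowLen i ↔ j < c := by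
    intro j
    rw [← YoungDiagram.mem_iff_lt_rowLen, mem_rectDiagram]
    simp [hi]
  exact le_antisymm (by by_contra hc; exact lt_irrefl _ ((h c).1 (not_le.1 hc)))
    (by by_contra hc; exact lt_irrefl _ ((h _).2 (not_le.1 hc)))

lemma colLen_rectDiagram_le (r c : ℕ) : (rectDiagram r c).colLen 0 ≤ r := by
  by_contra h
  have := mem_rectDiagram.1 (YoungDiagram.mem_iff_lt_colLen.2 (not_le.1 h))
  exact lt_irrefl _ this.1

end Basis

end SymmetricFunction

/-! ### Transfer sums -/

namespace TransferSum

open Finset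

variable {R : Type*} [CommRing R] {ι : Type*} [Fintype ι] [DecidableEq ι]

/-- The number of beads to the right of the bead `j`. -/
def rank (x : ι → ℤ) (j : ι) : ℕ := (univ.filter fun i => x j < x i).card

/-- Move the beads in `U` by `κ`. -/
def advance (κ : ℤ) (U : Finset ι) (x : ι → ℤ) (j : ι) : ℤ := if j ∈ U then x j + κ else x j

/-- The generating function of the ways to move the beads from `x` to `e` in steps which move the
prescribed numbers of beads by `κ`; a move of the bead `j` has the weight `q ^ rank x j`. -/
def transferSum (q : R) (κ : ℤ) (e : ι → ℤ) : List ℤ → (ι → ℤ) → R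
  | [], x => if x = e then 1 else 0
  | r :: ds, x => ∑ U ∈ univ.filter (fun U : Finset ι => (U.card : ℤ) = r),
      q ^ (∑ j ∈ U, rank x j) * transferSum q κ e ds (advance κ U x)

/-- The beads have different residues modulo `κ`. -/
def Generic (κ : ℤ) (x : ι → ℤ) : Prop := ∀ i j, i ≠ j → ¬ κ ∣ x i - x j

omit [Fintype ι] in
lemma Generic.advance {κ : ℤ} {x : ι → ℤ} (h : Generic κ x) (U : Finset ι) :
    Generic κ (advance κ U x) := by
  intro i j hij hd
  apply h i j hij
  unfold TransferSum.advance at hd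
  split_ifs at hd
  · simpa using hd
  · rw [add_sub_right_comm] at hd; simpa using hd
  · rw [← sub_sub] at hd; simpa using hd
  · exact hd

omit [Fintype ι] [DecidableEq ι] in
lemma Generic.injective {κ : ℤ} {x : ι → ℤ} (h : Generic κ x) : Function.Injective x := by
  intro i j hij
  by_contra hne
  exact h i j hne (by rw [hij, sub_self]; exact dvd_zero _)

/-- The number of pairs of a bead in `V` and a bead in `W` less than `κ` to the right of it. -/
def ascents (κ : ℤ) (x : ι → ℤ) (V W : Finset ι) : ℕ :=
  ∑ i ∈ V, ∑ j ∈ W, if x i < x j ∧ x j < x i + κ then 1 else 0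

/-- The generating function of the subsets of `Y` with `p` elements by ascents. -/
def subsetSum (q : R) (κ : ℤ) (x : ι → ℤ) (Y : Finset ι) (p : ℕ) : R :=
  ∑ V ∈ Y.powersetCard p, q ^ ascents κ x V (Y \ V)

-- A telescoping sum: ordered by x, the elements of B contribute 1, q, q², …, and q^n = 1 + (q -
-- 1)(1 + q + ⋯ + q^{n-1}).
omit [Fintype ι] in
lemma pow_card_eq (q : R) {x : ι → ℤ} (hx : Function.Injective x) (B : Finset ι) :
    q ^ B.card = 1 + (q - 1) * ∑ b ∈ B, q ^ (B.filter fun c => x c < x b).card := by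
  induction B using Finset.induction_on_max_value x with
  | empty => simp
  | insert a s ha hmax ih =>
    have hlt : ∀ c ∈ s, x c < x a := fun c hc =>
      lt_of_le_of_ne (hmax c hc) (fun h => ha (hx h ▸ hc))
    rw [Finset.card_insert_of_notMem ha, Finset.sum_insert ha]
    have h1 : (insert a s).filter (fun c => x c < x a) = s := by
      ext c; simp only [mem_filter, mem_insert]
      constructor
      · rintro ⟨rfl | h, h'⟩
        · exact absurd h' (lt_irrefl _)
        · exact h
      · exact fun h => ⟨Or.inr h, hlt c h⟩
    have h2 : ∀ b ∈ s, (insert a s).filter (fun c => x c < x b) = s.filter fun c => x c < x b := by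
      intro b hb
      rw [Finset.filter_insert, if_neg (not_lt.2 (hmax b hb))]
    rw [h1, Finset.sum_congr rfl fun b hb => by rw [h2 b hb], pow_succ]
    linear_combination ih

omit [Fintype ι] in
lemma ascents_insert_left (κ : ℤ) (x : ι → ℤ) {a : ι} {V : Finset ι} (ha : a ∉ V)
    (W : Finset ι) : ascents κ x (insert a V) W = ascents κ x V W +
      (W.filter fun j => x a < x j ∧ x j < x a + κ).card := by
  unfold ascents
  rw [Finset.sum_insert ha, add_comm, Finset.card_filter]

omit [Fintype ι] in
lemma ascents_insert_right (κ : ℤ) (x : ι → ℤ) {a : ι} {W : Finset ι} (ha : a ∉ W)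
    (V : Finset ι) : ascents κ x V (insert a W) = ascents κ x V W +
      (V.filter fun i => x i < x a ∧ x a < x i + κ).card := by
  unfold ascents
  simp only [Finset.sum_insert ha]
  rw [Finset.sum_add_distrib, add_comm, Finset.card_filter]

-- Split by whether the leftmost bead a lies in V. If not, it takes part in no ascent. If it does,
-- it adds the factor q^|B| with B the beads of Y \ V left of x a + κ, and `pow_card_eq` expands
-- this factor over b ∈ B. For fixed b, the ascents from V to b together with the beads of Y \ V
-- left of b count all beads of Y left of b, whatever V is; what remains is the same sum over Y
-- without b.
omit [Fintype ι] in
lemma subsetSum_insert (q : R) (κ : ℤ) {x : ι → ℤ} (hx : Function.Injective x) {a : ι}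
    {Y : Finset ι} (ha : a ∉ Y) (hmin : ∀ b ∈ Y, x a < x b) (p : ℕ) :
    subsetSum q κ x (insert a Y) (p + 1) = subsetSum q κ x Y (p + 1) + subsetSum q κ x Y p +
      (q - 1) * ∑ b ∈ Y.filter (fun b => x b < x a + κ),
        q ^ (Y.filter fun c => x c < x b).card * subsetSum q κ x (Y.erase b) p := by
  have hsub : ∀ {r : ℕ} {V : Finset ι}, V ∈ Y.powersetCard r → V ⊆ Y := fun h =>
    (Finset.mem_powersetCard.1 h).1
  have hdisj : Disjoint (Y.powersetCard (p + 1)) ((Y.powersetCard p).image (insert a)) := by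
    rw [Finset.disjoint_left]
    intro V hV hV'
    obtain ⟨V', -, rfl⟩ := Finset.mem_image.1 hV'
    exact ha (hsub hV (Finset.mem_insert_self a V'))
  conv_lhs => unfold subsetSum
  rw [Finset.powersetCard_succ_insert ha, Finset.sum_union hdisj, Finset.sum_image]
  swap
  · intro V hV V' hV' h
    have h1 : a ∉ V := fun h => ha (hsub hV h)
    have h2 : a ∉ V' := fun h => ha (hsub hV' h)
    rw [← Finset.erase_insert h1, ← Finset.erase_insert h2, h]
  rw [add_assoc]
  congr 1
  · refine Finset.sum_congr rfl fun V hV => ?_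
    have h1 : a ∉ V := fun h => ha (hsub hV h)
    rw [Finset.insert_sdiff_of_notMem _ h1, ascents_insert_right _ _ (by simp [ha])]
    rw [Finset.filter_false_of_mem, Finset.card_empty, add_zero]
    intro i hi h
    exact absurd h.1 (not_lt.2 (hmin i (hsub hV hi)).le)
  · have h1 : ∀ V ∈ Y.powersetCard p, q ^ ascents κ x (insert a V) (insert a Y \ insert a V) =
        q ^ ascents κ x V (Y \ V) + (q - 1) * ∑ b ∈ (Y \ V).filter (fun b => x b < x a + κ),
          q ^ (ascents κ x V (Y \ V) + ((Y \ V).filter fun c => x c < x b).card) := by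
      intro V hV
      have haV : a ∉ V := fun h => ha (hsub hV h)
      have hs : insert a Y \ insert a V = Y \ V := by
        ext j; simp only [mem_sdiff, mem_insert]
        constructor
        · rintro ⟨rfl | h, h'⟩
          · simp at h'
          · exact ⟨h, fun hh => h' (Or.inr hh)⟩
        · rintro ⟨h, h'⟩
          refine ⟨Or.inr h, ?_⟩
          rintro (rfl | hh)
          · exact ha h
          · exact h' hh
      rw [hs, ascents_insert_left _ _ haV, pow_add, pow_card_eq q hx]
      have hf : (Y \ V).filter (fun j => x a < x j ∧ x j < x a + κ) =
          (Y \ V).filter fun b => x b < x a + κ := by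
        refine Finset.filter_congr fun j hj => ?_
        have := hmin j (Finset.mem_sdiff.1 hj).1
        tauto
      rw [hf, mul_add, mul_one, mul_left_comm, Finset.mul_sum]
      congr 2
      refine Finset.sum_congr rfl fun b hb => ?_
      rw [pow_add]
      congr 3
      ext c
      simp only [mem_filter] at hb ⊢
      constructor
      · rintro ⟨⟨h, -⟩, h'⟩; exact ⟨h, h'⟩
      · rintro ⟨h, h'⟩; exact ⟨⟨h, h'.trans hb.2⟩, h'⟩
    rw [Finset.sum_congr rfl h1, Finset.sum_add_distrib, ← Finset.mul_sum]
    congr 2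
    simp only [Finset.sum_filter, subsetSum, Finset.mul_sum]
    have h2 : ∀ V ∈ Y.powersetCard p, (∑ b ∈ Y \ V, if x b < x a + κ then
        q ^ (ascents κ x V (Y \ V) + ((Y \ V).filter fun c => x c < x b).card) else 0) =
        ∑ b ∈ Y, if b ∉ V then (if x b < x a + κ then
        q ^ (ascents κ x V (Y \ V) + ((Y \ V).filter fun c => x c < x b).card) else 0) else 0 := by
      intro V _
      rw [← Finset.sum_filter (s := Y) (fun b => b ∉ V), ← Finset.sdiff_eq_filter]
    rw [Finset.sum_congr rfl h2, Finset.sum_comm]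
    refine Finset.sum_congr rfl fun b hb => ?_
    by_cases hba : x b < x a + κ
    · simp only [hba, if_true]
      rw [← Finset.sum_filter]
      have h3 : (Y.powersetCard p).filter (fun V => b ∉ V) = (Y.erase b).powersetCard p := by
        ext V
        simp only [mem_filter, mem_powersetCard, Finset.subset_erase]
        tauto
      rw [h3]
      refine Finset.sum_congr rfl fun V hV => ?_
      rw [Finset.mem_powersetCard, Finset.subset_erase] at hV
      obtain ⟨⟨hVY, hbV⟩, -⟩ := hV
      rw [← pow_add]
      congr 1
      have h4 : Y \ V = insert b (Y.erase b \ V) := by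
        ext j; simp only [mem_sdiff, mem_insert, mem_erase]
        by_cases hj : j = b
        · simp [hj, hb, hbV]
        · simp [hj]
      have h5 : Y.filter (fun c => x c < x b) = (V.filter fun c => x c < x b) ∪
          ((Y \ V).filter fun c => x c < x b) := by
        rw [← Finset.filter_union, Finset.union_sdiff_of_subset hVY]
      have h6 : Disjoint (V.filter fun c => x c < x b) ((Y \ V).filter fun c => x c < x b) :=
        Finset.disjoint_filter_filter Finset.disjoint_sdiff
      -- Since b is within κ of a and a is leftmost, b is within κ of every bead to its left.
      have h7 : V.filter (fun i => x i < x b ∧ x b < x i + κ) = V.filter fun c => x c < x b := by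
        refine Finset.filter_congr fun i hi => ?_
        have := hmin i (hVY hi)
        constructor
        · exact fun h => h.1
        · exact fun h => ⟨h, by linarith⟩
      rw [h5, Finset.card_union_of_disjoint h6]
      have h8 : ascents κ x V (Y \ V) = ascents κ x V (Y.erase b \ V) +
          (V.filter fun c => x c < x b).card := by
        rw [h4, ascents_insert_right _ _ (by simp), h7]
      rw [h8]
      ring
    · simp [hba]

omit [Fintype ι] in
lemma subsetSum_zero (q : R) (κ : ℤ) (x : ι → ℤ) (Y : Finset ι) : subsetSum q κ x Y 0 = 1 := by
  simp [subsetSum, ascents]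

omit [Fintype ι] in
lemma subsetSum_card (q : R) (κ : ℤ) (x : ι → ℤ) (Y : Finset ι) :
    subsetSum q κ x Y Y.card = 1 := by
  simp [subsetSum, ascents]

-- Induction with `subsetSum_insert`. With p = s + 1 and p' = t + 1, passing to complementary sizes
-- interchanges the first two terms of the recurrence, and the correction terms have complementary
-- sizes s and t.
omit [Fintype ι] in
theorem subsetSum_symm (q : R) (κ : ℤ) {x : ι → ℤ} (hx : Function.Injective x) (Y : Finset ι)
    (p p' : ℕ) (h : Y.card = p + p') : subsetSum q κ x Y p = subsetSum q κ x Y p' := by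
  induction hn : Y.card using Nat.strong_induction_on generalizing Y p p' with
  | _ n ih =>
    rcases p with _ | s
    · rw [zero_add] at h
      rw [← h, subsetSum_zero, subsetSum_card]
    rcases p' with _ | t
    · rw [add_zero] at h
      rw [← h, subsetSum_zero, subsetSum_card]
    have hne : Y.Nonempty := by rw [← Finset.card_pos]; omega
    obtain ⟨a, haY, hmin⟩ := Y.exists_min_image x hne
    have hY : insert a (Y.erase a) = Y := Finset.insert_erase haY
    have hmin' : ∀ b ∈ Y.erase a, x a < x b := by
      intro b hb
      rw [Finset.mem_erase] at hb
      exact lt_of_le_of_ne (hmin b hb.2) (fun h => hb.1 (hx h).symm)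
    have hcard : (Y.erase a).card = s + t + 1 := by
      rw [Finset.card_erase_of_mem haY]; omega
    rw [← hY, subsetSum_insert q κ hx (Finset.notMem_erase a Y) hmin',
      subsetSum_insert q κ hx (Finset.notMem_erase a Y) hmin',
      ih _ (by omega) (Y.erase a) (s + 1) t (by omega) rfl,
      ih _ (by omega) (Y.erase a) s (t + 1) (by omega) rfl, add_comm (subsetSum q κ x _ t)]
    congr 2
    refine Finset.sum_congr rfl fun b hb => ?_
    have hb' := (Finset.mem_filter.1 hb).1
    have hcard' : ((Y.erase a).erase b).card = s + t := by
      rw [Finset.card_erase_of_mem hb']; omega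
    rw [ih _ (by omega) ((Y.erase a).erase b) s t hcard' rfl]

end TransferSum

/-! ### Commutation of two consecutive steps. -/

namespace TransferSum

open Finset

variable {R : Type*} [CommRing R] {ι : Type*} [Fintype ι] [DecidableEq ι]

/-- Pairs of sets `(U, U')` correspond to triples `(T, Y, V)` with `T = U ∩ U'` and
`Y = V ∪ (Y \ V)` the symmetric difference of `U` and `U'`. -/
lemma sum_pairs_eq {A : Type*} [AddCommMonoid A] (f : Finset ι → Finset ι → A) :
    ∑ U, ∑ U', f U U' = ∑ T : Finset ι, ∑ Y ∈ Tᶜ.powerset, ∑ V ∈ Y.powerset,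
      f (T ∪ V) (T ∪ (Y \ V)) := by
  simp only [Finset.sum_sigma']
  refine Finset.sum_nbij' (fun p => ⟨p.1 ∩ p.2, (p.1 \ p.2) ∪ (p.2 \ p.1), p.1 \ p.2⟩)
    (fun t => ⟨t.1 ∪ t.2.2, t.1 ∪ (t.2.1 \ t.2.2)⟩) ?_ ?_ ?_ ?_ ?_
  · rintro ⟨U, U'⟩ -
    simp only [mem_sigma, mem_univ, mem_powerset, true_and]
    refine ⟨fun j hj => ?_, Finset.subset_union_left⟩
    simp only [mem_union, mem_sdiff, mem_compl, mem_inter] at hj ⊢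
    tauto
  · rintro ⟨T, Y, V⟩ -
    simp
  · rintro ⟨U, U'⟩ -
    have h1 : U ∩ U' ∪ U \ U' = U := by
      ext j; simp only [mem_union, mem_sdiff, mem_inter]; tauto
    have h2 : U ∩ U' ∪ ((U \ U' ∪ U' \ U) \ (U \ U')) = U' := by
      ext j; simp only [mem_union, mem_sdiff, mem_inter]; tauto
    simp only [h1, h2]
  · rintro ⟨T, Y, V⟩ h
    simp only [mem_sigma, mem_univ, mem_powerset, true_and] at h
    have hT : ∀ j, j ∈ Y → j ∉ T := fun j hj => by simpa using h.1 hj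
    have hV : ∀ j, j ∈ V → j ∈ Y := fun j hj => h.2 hj
    have h1 : (T ∪ V) ∩ (T ∪ Y \ V) = T := by
      ext j; simp only [mem_union, mem_sdiff, mem_inter]; have := hT j; tauto
    have h2 : (T ∪ V) \ (T ∪ Y \ V) = V := by
      ext j; simp only [mem_union, mem_sdiff]; have := hT j; have := hV j; tauto
    have h3 : (T ∪ Y \ V) \ (T ∪ V) = Y \ V := by
      ext j; simp only [mem_union, mem_sdiff]; have := hT j; tauto
    have h4 : V ∪ (Y \ V) = Y := Finset.union_sdiff_of_subset h.2
    simp only [h1, h2, h3, h4]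
  · rintro ⟨U, U'⟩ -
    have h1 : U ∩ U' ∪ U \ U' = U := by
      ext j; simp only [mem_union, mem_sdiff, mem_inter]; tauto
    have h2 : U ∩ U' ∪ ((U \ U' ∪ U' \ U) \ (U \ U')) = U' := by
      ext j; simp only [mem_union, mem_sdiff, mem_inter]; tauto
    simp only [h1, h2]

omit [DecidableEq ι] in
lemma rank_eq_sum (x : ι → ℤ) (j : ι) : rank x j = ∑ i, if x j < x i then 1 else 0 := by
  rw [rank, Finset.card_filter]

/-- The part of the weight of two steps which depends only on the beads moved once and twice. -/
def doubleWeight (κ : ℤ) (x : ι → ℤ) (T Y : Finset ι) : ℕ :=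
  ∑ j ∈ T, rank x j + ∑ j ∈ Y, rank x j +
    ∑ t ∈ T, (∑ i ∈ T, (if x t < x i then 1 else 0) + ∑ i ∈ Y, (if x t < x i then 1 else 0) +
      ∑ i ∈ (T ∪ Y)ᶜ, if x t + κ < x i then 1 else 0)

/-- The first step raises the rank of a bead of Y \ V by the number of beads that jump over it.
Jumps of beads of T are compensated by the smaller rank of these beads in the second step; jumps of
beads of V are the ascents, the only part that depends on V. -/
lemma rank_advance_two_steps {κ : ℤ} (hκ : 0 < κ) {x : ι → ℤ} (hx : Generic κ x)
    {T Y V : Finset ι} (hTY : Disjoint T Y) (hV : V ⊆ Y) :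
    ∑ j ∈ T ∪ V, rank x j + ∑ j ∈ T ∪ (Y \ V), rank (advance κ (T ∪ V) x) j =
      doubleWeight κ x T Y + ascents κ x V (Y \ V) := by
  have hTV : Disjoint T V := hTY.mono_right hV
  have hTW : Disjoint T (Y \ V) := hTY.mono_right Finset.sdiff_subset
  have hVW : Disjoint V (Y \ V) := Finset.disjoint_sdiff
  have hYe : Y = V ∪ (Y \ V) := (Finset.union_sdiff_of_subset hV).symm
  have huniv : ∀ f : ι → ℕ, ∑ i, f i = ∑ i ∈ T, f i + ∑ i ∈ V, f i + ∑ i ∈ Y \ V, f i +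
      ∑ i ∈ (T ∪ Y)ᶜ, f i := by
    intro f
    rw [← Finset.sum_add_sum_compl (T ∪ Y) f, Finset.sum_union hTY]
    conv_lhs => rw [hYe]
    rw [Finset.sum_union hVW, ← hYe]
    ring
  have hsplitY : ∀ f : ι → ℕ, ∑ i ∈ Y, f i = ∑ i ∈ V, f i + ∑ i ∈ Y \ V, f i := by
    intro f
    conv_lhs => rw [hYe]
    rw [Finset.sum_union hVW]
  have aT : ∀ i ∈ T, advance κ (T ∪ V) x i = x i + κ := fun i hi => if_pos (by simp [hi])
  have aV : ∀ i ∈ V, advance κ (T ∪ V) x i = x i + κ := fun i hi => if_pos (by simp [hi])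
  have aW : ∀ i ∈ Y \ V, advance κ (T ∪ V) x i = x i := fun i hi => if_neg (by
    rw [mem_sdiff] at hi
    simp only [mem_union, not_or]
    exact ⟨fun h => Finset.disjoint_left.1 hTY h hi.1, hi.2⟩)
  have aC : ∀ i ∈ (T ∪ Y)ᶜ, advance κ (T ∪ V) x i = x i := fun i hi => if_neg (by
    simp only [mem_compl, mem_union, not_or] at hi ⊢
    exact ⟨hi.1, fun h => hi.2 (hV h)⟩)
  have rT : ∀ t ∈ T, rank (advance κ (T ∪ V) x) t =
      ∑ i ∈ T, (if x t < x i then 1 else 0) + ∑ i ∈ V, (if x t < x i then 1 else 0) +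
      ∑ i ∈ Y \ V, (if x t + κ < x i then 1 else 0) +
      ∑ i ∈ (T ∪ Y)ᶜ, (if x t + κ < x i then 1 else 0) := by
    intro t ht
    rw [rank_eq_sum, huniv, aT t ht]
    congr 1
    · congr 1
      · congr 1
        · exact Finset.sum_congr rfl fun i hi => by rw [aT i hi]; simp
        · exact Finset.sum_congr rfl fun i hi => by rw [aV i hi]; simp
      · exact Finset.sum_congr rfl fun i hi => by rw [aW i hi]
    · exact Finset.sum_congr rfl fun i hi => by rw [aC i hi]
  -- After its move, bead i is to the right of j either because it was there before or because it
  -- jumped over j.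
  have hmove : ∀ i j, i ≠ j → (if x j < x i + κ then 1 else 0 : ℕ) =
      (if x j < x i then 1 else 0) + if x i < x j ∧ x j < x i + κ then 1 else 0 := by
    intro i j hij
    have hne : x i ≠ x j := fun h => hij (hx.injective h)
    split_ifs <;> omega
  have rW : ∀ j ∈ Y \ V, rank (advance κ (T ∪ V) x) j = rank x j +
      (∑ i ∈ T, (if x i < x j ∧ x j < x i + κ then 1 else 0) +
      ∑ i ∈ V, if x i < x j ∧ x j < x i + κ then 1 else 0) := by
    intro j hj
    rw [rank_eq_sum, rank_eq_sum, huniv, huniv, aW j hj]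
    have e1 : ∑ i ∈ T, (if x j < advance κ (T ∪ V) x i then 1 else 0 : ℕ) =
        ∑ i ∈ T, (if x j < x i then 1 else 0) +
        ∑ i ∈ T, if x i < x j ∧ x j < x i + κ then 1 else 0 := by
      rw [← Finset.sum_add_distrib]
      refine Finset.sum_congr rfl fun i hi => ?_
      rw [aT i hi, hmove i j]
      rintro rfl
      exact Finset.disjoint_left.1 hTW hi hj
    have e2 : ∑ i ∈ V, (if x j < advance κ (T ∪ V) x i then 1 else 0 : ℕ) =
        ∑ i ∈ V, (if x j < x i then 1 else 0) +
        ∑ i ∈ V, if x i < x j ∧ x j < x i + κ then 1 else 0 := by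
      rw [← Finset.sum_add_distrib]
      refine Finset.sum_congr rfl fun i hi => ?_
      rw [aV i hi, hmove i j]
      rintro rfl
      exact Finset.disjoint_left.1 hVW hi hj
    have e3 : ∑ i ∈ Y \ V, (if x j < advance κ (T ∪ V) x i then 1 else 0 : ℕ) =
        ∑ i ∈ Y \ V, (if x j < x i then 1 else 0) :=
      Finset.sum_congr rfl fun i hi => by rw [aW i hi]
    have e4 : ∑ i ∈ (T ∪ Y)ᶜ, (if x j < advance κ (T ∪ V) x i then 1 else 0 : ℕ) =
        ∑ i ∈ (T ∪ Y)ᶜ, (if x j < x i then 1 else 0) :=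
      Finset.sum_congr rfl fun i hi => by rw [aC i hi]
    rw [e1, e2, e3, e4]
    ring
  -- A bead to the right of t is either jumped over by t or still to the right of x t + κ;
  -- genericity excludes equality.
  have hcross : ∑ j ∈ Y \ V, ∑ t ∈ T, (if x t < x j ∧ x j < x t + κ then 1 else 0 : ℕ) +
      ∑ t ∈ T, ∑ i ∈ Y \ V, (if x t + κ < x i then 1 else 0) =
      ∑ t ∈ T, ∑ i ∈ Y \ V, (if x t < x i then 1 else 0) := by
    rw [Finset.sum_comm, ← Finset.sum_add_distrib]
    refine Finset.sum_congr rfl fun t ht => ?_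
    rw [← Finset.sum_add_distrib]
    refine Finset.sum_congr rfl fun i hi => ?_
    have hti : i ≠ t := by
      rintro rfl
      exact Finset.disjoint_left.1 hTW ht hi
    have hne : x i ≠ x t + κ := fun h => hx i t hti ⟨1, by rw [h]; ring⟩
    split_ifs <;> omega
  rw [Finset.sum_union hTV, Finset.sum_union hTW, Finset.sum_congr rfl rT,
    Finset.sum_congr rfl rW]
  unfold doubleWeight ascents
  simp only [Finset.sum_add_distrib, hsplitY]
  rw [Finset.sum_comm (s := V) (t := Y \ V)]
  linarith

omit [Fintype ι] in
lemma advance_advance (κ : ℤ) (x : ι → ℤ) {T Y V : Finset ι} (hTY : Disjoint T Y) (hV : V ⊆ Y) :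
    advance κ (T ∪ (Y \ V)) (advance κ (T ∪ V) x) = advance κ T (advance κ (T ∪ Y) x) := by
  funext j
  unfold advance
  have h1 : j ∈ T → j ∉ Y := fun h => Finset.disjoint_left.1 hTY h
  have h2 : j ∈ V → j ∈ Y := fun h => hV h
  by_cases hT : j ∈ T
  · simp [hT]
  · by_cases hj : j ∈ V
    · simp [hT, hj, h2 hj]
    · simp [hT, hj]

/-- The contribution of all pairs of steps which move the beads of `T` twice and those of `Y`
once. -/
lemma sum_pair_weights (q : R) {κ : ℤ} (hκ : 0 < κ) {x : ι → ℤ} (hx : Generic κ x)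
    {T Y : Finset ι} (hTY : Disjoint T Y) (w : (ι → ℤ) → R) (r s : ℤ) :
    ∑ V ∈ Y.powerset, (if ((T ∪ V).card : ℤ) = r ∧ ((T ∪ (Y \ V)).card : ℤ) = s then
      q ^ (∑ j ∈ T ∪ V, rank x j + ∑ j ∈ T ∪ (Y \ V), rank (advance κ (T ∪ V) x) j) *
        w (advance κ (T ∪ (Y \ V)) (advance κ (T ∪ V) x)) else 0) =
    if r + s = 2 * T.card + Y.card ∧ (T.card : ℤ) ≤ r ∧ (T.card : ℤ) ≤ s then
      q ^ doubleWeight κ x T Y * subsetSum q κ x Y (r - T.card).toNat *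
        w (advance κ T (advance κ (T ∪ Y) x)) else 0 := by
  have hcard : ∀ V ∈ Y.powerset, (((T ∪ V).card : ℤ) = r ∧ ((T ∪ (Y \ V)).card : ℤ) = s) ↔
      (r + s = 2 * T.card + Y.card ∧ (T.card : ℤ) ≤ r ∧ (T.card : ℤ) ≤ s) ∧
        V.card = (r - T.card).toNat := by
    intro V hV
    rw [mem_powerset] at hV
    rw [Finset.card_union_of_disjoint (hTY.mono_right hV),
      Finset.card_union_of_disjoint (hTY.mono_right Finset.sdiff_subset),
      Finset.card_sdiff_of_subset hV]
    have := Finset.card_le_card hV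
    push_cast [this]
    omega
  split_ifs with h
  · rw [subsetSum, Finset.mul_sum, Finset.sum_mul, Finset.powersetCard_eq_filter,
      Finset.sum_filter]
    refine Finset.sum_congr rfl fun V hV => ?_
    have hV' := mem_powerset.1 hV
    simp only [hcard V hV, h, true_and, and_self]
    rw [rank_advance_two_steps hκ hx hTY hV', advance_advance κ x hTY hV', pow_add]
  · refine Finset.sum_eq_zero fun V hV => ?_
    rw [if_neg]
    rw [hcard V hV]
    exact fun hh => h hh.1

/-- Group the pairs of steps by the set T of beads moved twice and the set Y of beads moved once.
The order of r and s then enters only through the sizes r - |T| and s - |T| of the two parts of Y,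
and `subsetSum_symm` interchanges these. -/
lemma transferSum_swap (q : R) {κ : ℤ} (hκ : 0 < κ) (e : ι → ℤ) {x : ι → ℤ} (hx : Generic κ x)
    (r s : ℤ) (ds : List ℤ) :
    transferSum q κ e (r :: s :: ds) x = transferSum q κ e (s :: r :: ds) x := by
  have key : ∀ r s : ℤ, transferSum q κ e (r :: s :: ds) x =
      ∑ T : Finset ι, ∑ Y ∈ Tᶜ.powerset,
        if r + s = 2 * T.card + Y.card ∧ (T.card : ℤ) ≤ r ∧ (T.card : ℤ) ≤ s then
        q ^ doubleWeight κ x T Y * subsetSum q κ x Y (r - T.card).toNat *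
        transferSum q κ e ds (advance κ T (advance κ (T ∪ Y) x)) else 0 := by
    intro r s
    have h1 : transferSum q κ e (r :: s :: ds) x = ∑ U, ∑ U',
        if (U.card : ℤ) = r ∧ (U'.card : ℤ) = s then
          q ^ (∑ j ∈ U, rank x j + ∑ j ∈ U', rank (advance κ U x) j) *
          transferSum q κ e ds (advance κ U' (advance κ U x)) else 0 := by
      simp only [transferSum]
      rw [Finset.sum_filter]
      refine Finset.sum_congr rfl fun U _ => ?_
      by_cases hU : (U.card : ℤ) = r
      · simp only [hU, true_and, if_true]
        rw [Finset.sum_filter, Finset.mul_sum]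
        refine Finset.sum_congr rfl fun U' _ => ?_
        split_ifs
        · ring
        · ring
      · simp [hU]
    rw [h1, sum_pairs_eq]
    refine Finset.sum_congr rfl fun T _ => Finset.sum_congr rfl fun Y hY => ?_
    have hTY : Disjoint T Y := by
      rw [mem_powerset] at hY
      exact (Finset.disjoint_of_subset_right hY disjoint_compl_right)
    exact sum_pair_weights q hκ hx hTY (transferSum q κ e ds) r s
  rw [key, key]
  refine Finset.sum_congr rfl fun T _ => Finset.sum_congr rfl fun Y _ => ?_
  by_cases h : r + s = 2 * T.card + Y.card ∧ (T.card : ℤ) ≤ r ∧ (T.card : ℤ) ≤ s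
  · rw [if_pos h, if_pos (by omega), subsetSum_symm q κ hx.injective Y (r - T.card).toNat
      (s - T.card).toNat (by omega)]
  · rw [if_neg h, if_neg (by omega)]

theorem transferSum_perm (q : R) {κ : ℤ} (hκ : 0 < κ) (e : ι → ℤ) {l l' : List ℤ}
    (h : l.Perm l') {x : ι → ℤ} (hx : Generic κ x) :
    transferSum q κ e l x = transferSum q κ e l' x := by
  induction h generalizing x with
  | nil => rfl
  | cons r _ ih =>
    simp only [transferSum]
    exact Finset.sum_congr rfl fun U _ => by rw [ih (hx.advance U)]
  | swap r s l => exact transferSum_swap q hκ e hx s r l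
  | trans _ _ ih1 ih2 => rw [ih1 hx, ih2 hx]

end TransferSum

/-! ### Evaluation of the alternating sum for a rectangle. -/

namespace TransferSum

open Finset

section Ring

variable {R : Type*} [CommRing R] {ι : Type*} [Fintype ι] [DecidableEq ι]

lemma sum_rank (x : ι → ℤ) (hx : Function.Injective x) :
    ∑ j, rank x j = (Fintype.card ι).choose 2 := by
  have h1 : ∀ j, rank x j + (univ.filter fun i => x i < x j).card + 1 = Fintype.card ι := by
    intro j
    have h2 : (univ.filter fun i => x i < x j) = (univ.filter fun i => x j < x i)ᶜ.erase j := by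
      ext i
      simp only [mem_filter, mem_univ, true_and, mem_erase, mem_compl, not_lt]
      constructor
      · exact fun h => ⟨fun h' => by rw [h'] at h; exact lt_irrefl _ h, h.le⟩
      · exact fun h => lt_of_le_of_ne h.2 (fun h' => h.1 (hx h'))
    rw [h2, Finset.card_erase_of_mem (by simp), rank,
      ← Finset.card_add_card_compl (univ.filter fun i => x j < x i)]
    have : 0 < (univ.filter fun i => x j < x i)ᶜ.card := Finset.card_pos.2 ⟨j, by simp⟩
    omega
  have h3 : ∑ j, (univ.filter fun i => x i < x j).card = ∑ j, rank x j := by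
    simp only [rank, Finset.card_filter]
    exact Finset.sum_comm
  have h4 : ∑ j, (rank x j + (univ.filter fun i => x i < x j).card + 1) =
      Fintype.card ι * Fintype.card ι := by
    rw [Finset.sum_congr rfl fun j _ => h1 j]
    simp
  rw [Finset.sum_add_distrib, Finset.sum_add_distrib, h3] at h4
  simp only [sum_const, card_univ, smul_eq_mul, mul_one] at h4
  rw [Nat.choose_two_right]
  have h5 : Fintype.card ι * (Fintype.card ι - 1) = 2 * ∑ j, rank x j := by
    rw [Nat.mul_sub, mul_one]; omega
  rw [h5, Nat.mul_div_cancel_left _ (by norm_num)]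

/-- A bead advances by at most κ in each step, so this destination is out of reach. -/
lemma transferSum_eq_zero (q : R) {κ : ℤ} (hκ : 0 < κ) (e : ι → ℤ) (j : ι) (ds : List ℤ)
    (x : ι → ℤ) (h : x j + κ * ds.length < e j) : transferSum q κ e ds x = 0 := by
  induction ds generalizing x with
  | nil =>
    rw [transferSum, if_neg]
    rintro rfl
    simp at h
  | cons r ds ih =>
    rw [transferSum]
    refine Finset.sum_eq_zero fun U _ => ?_
    rw [ih, mul_zero]
    simp only [List.length_cons, Nat.cast_add, Nat.cast_one] at h
    unfold advance
    split_ifs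
    · linarith
    · linarith

/-- The column indices of a Jacobi-Trudi matrix whose first column has been moved to `-m`. -/
def shiftedColumn (m : ℕ) {N : ℕ} (j : Fin N) : ℤ := if (j : ℕ) = 0 then -(m : ℤ) else (j : ℕ)

/-- The alternating sum of transfer sums attached to the determinant which expresses the Schur
function of a column in terms of complete homogeneous symmetric functions; `m` is the number of
the rows already used up by the first column. -/
noncomputable def alternatingSum (q : R) (κ : ℤ) (e : ι → ℤ) (N m : ℕ) (x : ι → ℤ) : R :=
  ∑ w : Equiv.Perm (Fin N), (Equiv.Perm.sign w : ℤ) • transferSum q κ e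
    (List.ofFn fun i : Fin N => (Fintype.card ι : ℤ) - (1 + (i : ℕ) - shiftedColumn m (w i))) x

lemma sum_smul_transferSum_cons (q : R) (κ : ℤ) (e : ι → ℤ) {A : Type*} [Fintype A] (s : A → ℤ)
    (r : ℤ) (ds : A → List ℤ) (x : ι → ℤ) :
    ∑ w, s w • transferSum q κ e (r :: ds w) x =
      ∑ U ∈ univ.filter (fun U : Finset ι => (U.card : ℤ) = r), q ^ (∑ j ∈ U, rank x j) *
        ∑ w, s w • transferSum q κ e (ds w) (advance κ U x) := by
  simp only [transferSum, Finset.smul_sum, Finset.mul_sum, mul_smul_comm]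
  rw [Finset.sum_comm]

/-- Expansion along the first row, whose entry is also the first step. The first column makes m + 1
beads miss the step and leaves an undisplaced matrix of size N. The second column makes all beads
move and leaves, after reindexing, a matrix with first column displaced by m + 1, with sign -1. The
further columns would move more beads than there are. -/
lemma alternatingSum_succ (q : R) (κ : ℤ) (e : ι → ℤ) (N m : ℕ) (x : ι → ℤ) :
    alternatingSum q κ e (N + 1) m x =
      (∑ U ∈ univ.filter (fun U : Finset ι => (U.card : ℤ) = Fintype.card ι - 1 - m),
        q ^ (∑ j ∈ U, rank x j) * alternatingSum q κ e N 0 (advance κ U x)) -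
      if N = 0 then 0 else
        q ^ (∑ j, rank x j) * alternatingSum q κ e N (m + 1) (advance κ univ x) := by
  unfold alternatingSum
  -- `decomposeFin` sorts the permutations by the column chosen in the first row.
  rw [← Equiv.sum_comp Equiv.Perm.decomposeFin.symm, Fintype.sum_prod_type, Fin.sum_univ_succ]
  have hhead : ∀ (p : Fin (N + 1)) (w : Equiv.Perm (Fin N)),
      (List.ofFn fun i : Fin (N + 1) => (Fintype.card ι : ℤ) -
        (1 + (i : ℕ) - shiftedColumn m (Equiv.Perm.decomposeFin.symm (p, w) i))) =
      ((Fintype.card ι : ℤ) - (1 - shiftedColumn m p)) :: List.ofFn fun i : Fin N =>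
        (Fintype.card ι : ℤ) - (1 + ((i : ℕ) + 1) - shiftedColumn m (Equiv.swap 0 p (w i).succ)) := by
    intro p w
    rw [List.ofFn_succ]
    simp only [Equiv.Perm.decomposeFin_symm_apply_zero, Equiv.Perm.decomposeFin_symm_apply_succ,
      Fin.val_zero, Fin.val_succ, Nat.cast_zero, add_zero, Nat.cast_add, Nat.cast_one]
  simp only [hhead, sum_smul_transferSum_cons, Equiv.Perm.decomposeFin.symm_sign]
  refine (congrArg₂ (· + ·) ?_ ?_).trans (sub_eq_add_neg _ _).symm
  · have h0 : (Fintype.card ι : ℤ) - (1 - shiftedColumn m (0 : Fin (N + 1))) =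
        Fintype.card ι - 1 - m := by
      simp [shiftedColumn]; ring
    rw [h0]
    refine Finset.sum_congr rfl fun U _ => ?_
    congr 1
    refine Finset.sum_congr rfl fun w _ => ?_
    simp only [if_true, one_mul, Equiv.swap_self, Equiv.refl_apply]
    congr 3
    funext i
    have : shiftedColumn 0 (w i) = ((w i : ℕ) : ℤ) := by
      unfold shiftedColumn; split_ifs with h <;> simp [h]
    rw [this]
    simp only [shiftedColumn, Fin.val_succ, Nat.succ_ne_zero, if_false]
    push_cast
    ring
  · rcases N with _ | N
    · simp
    · rw [if_neg (Nat.succ_ne_zero N), Fin.sum_univ_succ]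
      rw [Finset.sum_eq_zero (s := univ) (f := fun i : Fin N => _), add_zero]
      · have h1 : (Fintype.card ι : ℤ) - (1 - shiftedColumn m (Fin.succ 0 : Fin (N + 1 + 1))) =
            Fintype.card ι := by
          simp [shiftedColumn]
        have h2 : (univ.filter fun U : Finset ι => (U.card : ℤ) = Fintype.card ι) = {univ} := by
          ext U
          simp only [mem_filter, mem_univ, true_and, mem_singleton]
          rw [Nat.cast_inj, Finset.card_eq_iff_eq_univ]
        rw [h1, h2, Finset.sum_singleton, ← mul_neg, ← Finset.sum_neg_distrib]
        congr 1
        refine Finset.sum_congr rfl fun w _ => ?_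
        rw [if_neg (Fin.succ_ne_zero _), Units.val_mul, Units.val_neg, Units.val_one,
          neg_one_mul, neg_smul]
        congr 4
        funext i
        by_cases hw : w i = 0
        · rw [hw, Equiv.swap_apply_right]
          simp only [shiftedColumn, Fin.val_zero, if_true]
          push_cast
          ring
        · have hw' : ((w i : Fin (N + 1)) : ℕ) ≠ 0 := fun h => hw (Fin.ext h)
          rw [Equiv.swap_apply_of_ne_of_ne (Fin.succ_ne_zero _)
            (fun h => hw (Fin.succ_injective _ h))]
          simp only [shiftedColumn, Fin.val_succ, Nat.succ_ne_zero, if_false, hw']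
          push_cast
          ring
      · intro p _
        refine Finset.sum_eq_zero fun U hU => ?_
        exfalso
        rw [Finset.mem_filter] at hU
        have h3 := hU.2
        have h4 := Finset.card_le_univ U
        simp only [shiftedColumn, Fin.val_succ, Nat.succ_ne_zero, if_false] at h3
        push_cast at h3
        omega

/-- The number of beads which end to the right of `h`. -/
def endRank (u : ι → ℤ) (h : ℤ) : ℕ := (univ.filter fun i => h < u i).card

/-- The exponent of `q` in `alternatingSum`, up to a constant. -/
def energy (κ : ℤ) (x : ι → ℤ) (c : ι → ℕ) : ℕ :=
  ∑ j, ∑ s ∈ range (c j), endRank (fun i => x i - κ * c i) (x j - κ * s)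

/-- Think of c j as the number of steps that bead j still has to miss. After a step missed exactly
by C, all x i - κ c i have increased by κ, so the remaining terms of the energy are only reindexed;
the terms lost are those with s = 0 for the beads of C. -/
lemma energy_step (κ : ℤ) (x : ι → ℤ) (c : ι → ℕ) (C : Finset ι) (hC : ∀ j ∈ C, 0 < c j) :
    energy κ x c = energy κ (advance κ Cᶜ x) (fun j => if j ∈ C then c j - 1 else c j) +
      ∑ j ∈ C, endRank (fun i => x i - κ * c i) (x j) := by
  have hu : (fun i => advance κ Cᶜ x i - κ * ((if i ∈ C then c i - 1 else c i : ℕ) : ℤ)) =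
      fun i => x i - κ * c i + κ := by
    funext i
    unfold advance
    by_cases hi : i ∈ C
    · simp only [mem_compl, hi, not_true_eq_false, if_false, if_true]
      rw [Nat.cast_sub (hC i hi)]
      push_cast
      ring
    · simp only [mem_compl, hi, not_false_eq_true, if_true, if_false]
      ring
  have hshift : ∀ h : ℤ, endRank (fun i => x i - κ * c i + κ) (h + κ) =
      endRank (fun i => x i - κ * c i) h := by
    intro h
    unfold endRank
    simp
  unfold energy
  rw [hu]
  have hsum : ∑ j ∈ C, endRank (fun i => x i - κ * c i) (x j) =
      ∑ j, if j ∈ C then endRank (fun i => x i - κ * c i) (x j) else 0 := by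
    rw [← Finset.sum_filter]; simp
  rw [hsum, ← Finset.sum_add_distrib]
  refine Finset.sum_congr rfl fun j _ => ?_
  by_cases hj : j ∈ C
  · simp only [hj, if_true]
    obtain ⟨a, ha⟩ : ∃ a, c j = a + 1 := ⟨c j - 1, by have := hC j hj; omega⟩
    rw [ha, Finset.sum_range_succ', Nat.add_sub_cancel]
    congr 1
    · refine Finset.sum_congr rfl fun s _ => ?_
      have : advance κ Cᶜ x j = x j := if_neg (by simp [hj])
      rw [this, ← hshift]
      congr 1
      push_cast
      ring
    · simp
  · simp only [hj, if_false, add_zero]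
    refine Finset.sum_congr rfl fun s _ => ?_
    have : advance κ Cᶜ x j = x j + κ := if_pos (by simp [hj])
    rw [this, ← hshift]
    congr 1
    ring

end Ring

section Field

variable {F : Type*} [Field F] {ι : Type*} [Fintype ι] [DecidableEq ι]

/-- The alternating sum of the products of `ρ` over the subsets of `S` with more than `m`
elements. -/
def truncatedSum (ρ : ι → F) (S : Finset ι) (m : ℕ) : F :=
  ∑ C ∈ S.powerset.filter (fun C => m + 1 ≤ C.card), (-1) ^ (C.card + m + 1) * ∏ j ∈ C, ρ j

omit [Fintype ι] [DecidableEq ι] in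
lemma truncatedSum_eq (ρ : ι → F) (S : Finset ι) (m : ℕ) :
    truncatedSum ρ S m = ∑ C ∈ S.powersetCard (m + 1), ∏ j ∈ C, ρ j -
      truncatedSum ρ S (m + 1) := by
  rw [eq_sub_iff_add_eq, Finset.powersetCard_eq_filter]
  unfold truncatedSum
  simp only [Finset.sum_filter]
  rw [← Finset.sum_add_distrib]
  refine Finset.sum_congr rfl fun C _ => ?_
  rcases lt_trichotomy C.card (m + 1) with h | h | h
  · rw [if_neg (by omega), if_neg (by omega), if_neg (by omega), add_zero]
  · rw [if_pos h.ge, if_neg (by omega), if_pos h, add_zero, h, add_assoc, ← two_mul]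
    simp
  · rw [if_pos (by omega), if_pos (by omega), if_neg (by omega)]
    ring

omit [Fintype ι] [DecidableEq ι] in
lemma truncatedSum_eq_zero (ρ : ι → F) (S : Finset ι) {m : ℕ} (h : S.card ≤ m) :
    truncatedSum ρ S m = 0 := by
  unfold truncatedSum
  rw [Finset.filter_false_of_mem, Finset.sum_empty]
  intro C hC
  have := Finset.card_le_card (mem_powerset.1 hC)
  omega

-- For m = 0 the truncated sum is 1 - ∏ (1 - ρ j), and one factor of the product vanishes.
omit [Fintype ι] [DecidableEq ι] in
lemma truncatedSum_zero (ρ : ι → F) {S : Finset ι} {j : ι} (hj : j ∈ S) (h : ρ j = 1) :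
    truncatedSum ρ S 0 = 1 := by
  classical
  have h1 : ∏ i ∈ S, (1 + -ρ i) = 0 := Finset.prod_eq_zero hj (by rw [h]; ring)
  rw [Finset.prod_one_add] at h1
  have h2 : ∑ C ∈ S.powerset, ∏ i ∈ C, -ρ i = 1 - truncatedSum ρ S 0 := by
    unfold truncatedSum
    rw [← Finset.sum_filter_add_sum_filter_not S.powerset (fun C => 0 + 1 ≤ C.card), add_comm,
      sub_eq_add_neg, ← Finset.sum_neg_distrib]
    congr 1
    · have h3 : S.powerset.filter (fun C => ¬ 0 + 1 ≤ C.card) = {∅} := by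
        ext C
        simp only [mem_filter, mem_powerset, mem_singleton]
        constructor
        · rintro ⟨-, h⟩
          rw [← Finset.card_eq_zero]; omega
        · rintro rfl; simp
      rw [h3, Finset.sum_singleton, Finset.prod_empty]
    · refine Finset.sum_congr rfl fun C _ => ?_
      rw [Finset.prod_neg, pow_succ]
      ring
  rw [h2, sub_eq_zero] at h1
  exact h1.symm

/-- The ratio between the weights of a missed move at its time and at the end. -/
noncomputable def weightRatio (q : F) (κ : ℤ) (x : ι → ℤ) (c : ι → ℕ) (j : ι) : F :=
  q ^ ((endRank (fun i => x i - κ * c i) (x j) : ℤ) - rank x j)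

-- Take the rightmost bead with c j ≠ 0. The beads to its right have c i = 0 and are not displaced,
-- and subtracting κ c i keeps the other beads from passing it; so both ranks agree.
omit [DecidableEq ι] in
lemma exists_weightRatio_eq_one (q : F) {κ : ℤ} (hκ : 0 < κ) {x : ι → ℤ} (c : ι → ℕ)
    (hc : ∃ j, c j ≠ 0) : ∃ j, c j ≠ 0 ∧ weightRatio q κ x c j = 1 := by
  obtain ⟨j, hj, hmax⟩ := (univ.filter fun j => c j ≠ 0).exists_max_image x
    (by obtain ⟨j, hj⟩ := hc; exact ⟨j, by simpa using hj⟩)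
  rw [mem_filter] at hj
  refine ⟨j, hj.2, ?_⟩
  have h : endRank (fun i => x i - κ * c i) (x j) = rank x j := by
    unfold endRank rank
    congr 1
    refine Finset.filter_congr fun i _ => ?_
    constructor
    · intro h
      nlinarith [Int.natCast_nonneg (c i)]
    · intro h
      have hi : c i = 0 := by
        by_contra hi
        exact absurd (hmax i (by simpa using hi)) (not_le.2 h)
      simpa [hi] using h
  rw [weightRatio, h, sub_self, zpow_zero]

lemma weightRatio_advance_univ (q : F) (κ : ℤ) (x : ι → ℤ) (c : ι → ℕ) :
    weightRatio q κ (advance κ univ x) c = weightRatio q κ x c := by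
  funext j
  have h : ∀ i, advance κ univ x i = x i + κ := fun i => if_pos (mem_univ i)
  unfold weightRatio endRank rank
  simp only [h, add_sub_right_comm, add_lt_add_iff_right]

lemma energy_advance_univ (κ : ℤ) (x : ι → ℤ) (c : ι → ℕ) :
    energy κ (advance κ univ x) c = energy κ x c := by
  have := energy_step κ x c ∅ (by simp)
  simpa using this.symm

lemma pow_rank_compl (q : F) {x : ι → ℤ} (hx : Function.Injective x)
    (C : Finset ι) : q ^ (∑ j ∈ Cᶜ, rank x j) =
      q ^ (((Fintype.card ι).choose 2 : ℤ) - ∑ j ∈ C, (rank x j : ℤ)) := by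
  rw [← zpow_natCast, ← sum_rank x hx, ← Finset.sum_compl_add_sum C]
  push_cast
  rw [add_sub_cancel_right]

/-- The terms of `alternatingSum_succ` coming from the first entry of the first row. -/
lemma sum_alternatingSum_zero {q : F} (hq : q ≠ 0) {κ : ℤ} (hκ : 0 < κ) (N m : ℕ)
    (ih : ∀ (x e : ι → ℤ) (c : ι → ℕ), Generic κ x → ∑ j, c j = N →
      (∀ j, e j = x j + κ * (N - c j)) → alternatingSum q κ e N 0 x =
        q ^ ((N * (Fintype.card ι).choose 2 : ℤ) - energy κ x c))
    {x e : ι → ℤ} {c : ι → ℕ} (hx : Generic κ x) (hc : ∑ j, c j = N + 1 + m)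
    (he : ∀ j, e j = x j + κ * ((N + 1 : ℕ) - c j)) :
    (∑ U ∈ univ.filter (fun U : Finset ι => (U.card : ℤ) = Fintype.card ι - 1 - m),
        q ^ (∑ j ∈ U, rank x j) * alternatingSum q κ e N 0 (advance κ U x)) =
      q ^ (((N + 1 : ℕ) * (Fintype.card ι).choose 2 : ℤ) - energy κ x c) *
        ∑ C ∈ (univ.filter fun j => c j ≠ 0).powersetCard (m + 1),
          ∏ j ∈ C, weightRatio q κ x c j := by
  have h1 : (∑ U ∈ univ.filter (fun U : Finset ι => (U.card : ℤ) = Fintype.card ι - 1 - m),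
        q ^ (∑ j ∈ U, rank x j) * alternatingSum q κ e N 0 (advance κ U x)) =
      ∑ C ∈ univ.filter (fun C : Finset ι => C.card = m + 1),
        q ^ (∑ j ∈ Cᶜ, rank x j) * alternatingSum q κ e N 0 (advance κ Cᶜ x) := by
    refine Finset.sum_nbij' (fun U => Uᶜ) (fun U => Uᶜ) ?_ ?_ ?_ ?_ ?_
    · intro U hU
      simp only [mem_filter, mem_univ, true_and] at hU ⊢
      rw [Finset.card_compl]
      omega
    · intro U hU
      simp only [mem_filter, mem_univ, true_and] at hU ⊢
      rw [Finset.card_compl, Nat.cast_sub (Finset.card_le_univ U)]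
      push_cast [hU]
      ring
    · intro U _; exact compl_compl U
    · intro U _; exact compl_compl U
    · intro U _; simp only [compl_compl]
  rw [h1, Finset.mul_sum]
  symm
  have hsub : (univ.filter fun j => c j ≠ 0).powersetCard (m + 1) ⊆
      univ.filter (fun C : Finset ι => C.card = m + 1) := by
    intro C hC
    simpa using (mem_powersetCard.1 hC).2
  have hadv : ∀ (C : Finset ι) (j : ι), advance κ Cᶜ x j = if j ∈ C then x j else x j + κ := by
    intro C j
    unfold advance
    by_cases hj : j ∈ C <;> simp [hj]
  rw [← Finset.sum_subset hsub]
  · refine Finset.sum_congr rfl fun C hC => ?_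
    obtain ⟨hCs, hCc⟩ := mem_powersetCard.1 hC
    have hpos : ∀ j ∈ C, 0 < c j := fun j hj => Nat.pos_of_ne_zero (by simpa using hCs hj)
    have hsum : ∑ j, (if j ∈ C then c j - 1 else c j) = N := by
      have h2 : ∑ j, (if j ∈ C then c j - 1 else c j) + ∑ j, (if j ∈ C then 1 else 0) =
          ∑ j, c j := by
        rw [← Finset.sum_add_distrib]
        refine Finset.sum_congr rfl fun j _ => ?_
        split_ifs with hj
        · have := hpos j hj; omega
        · rfl
      rw [Finset.sum_boole, hc] at h2
      simp only [filter_univ_mem, hCc, Nat.cast_id] at h2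
      omega
    rw [ih (advance κ Cᶜ x) e (fun j => if j ∈ C then c j - 1 else c j) (hx.advance _) hsum,
      pow_rank_compl q hx.injective, energy_step κ x c C hpos]
    · unfold weightRatio
      have hprod : ∏ j ∈ C, q ^ ((endRank (fun i => x i - κ * c i) (x j) : ℤ) - rank x j) =
          q ^ (∑ j ∈ C, ((endRank (fun i => x i - κ * c i) (x j) : ℤ) - rank x j)) := by
        clear hC hCs hCc hpos hsum
        induction C using Finset.induction_on with
        | empty => simp
        | insert a s ha ih => rw [prod_insert ha, sum_insert ha, zpow_add₀ hq, ih]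
      rw [hprod, ← zpow_add₀ hq, ← zpow_add₀ hq]
      congr 1
      rw [Finset.sum_sub_distrib]
      push_cast
      ring
    · intro j
      rw [he j, hadv]
      split_ifs with hj
      · rw [Nat.cast_sub (hpos j hj)]
        push_cast
        ring
      · push_cast
        ring
  · intro C hC hC'
    rw [mem_powersetCard, not_and_or] at hC'
    have hCc : C.card = m + 1 := by simpa using hC
    rcases hC' with h | h
    -- A bead with c j = 0 has to move in all N + 1 steps; after missing one it is too far away.
    · obtain ⟨j, hj, hj'⟩ := Finset.not_subset.1 h
      have hj0 : c j = 0 := by simpa using hj'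
      have h3 : alternatingSum q κ e N 0 (advance κ Cᶜ x) = 0 := by
        refine Finset.sum_eq_zero fun w _ => ?_
        rw [transferSum_eq_zero q hκ e j, smul_zero]
        rw [hadv, if_pos hj, he j, hj0, List.length_ofFn]
        push_cast
        linarith
      rw [h3, mul_zero]
    · exact absurd hCc h

/-- The case `m = 0` follows from the general formula. -/
lemma alternatingSum_zero_eq {q : F} {κ : ℤ} (hκ : 0 < κ) (N : ℕ)
    (h : ∀ (m : ℕ) (x e : ι → ℤ) (c : ι → ℕ), Generic κ x → ∑ j, c j = N + m →
      (∀ j, e j = x j + κ * (N - c j)) → (N ≠ 0 ∨ m ≠ 0) → alternatingSum q κ e N m x =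
        q ^ ((N * (Fintype.card ι).choose 2 : ℤ) - energy κ x c) *
          truncatedSum (weightRatio q κ x c) (univ.filter fun j => c j ≠ 0) m)
    (x e : ι → ℤ) (c : ι → ℕ) (hx : Generic κ x) (hc : ∑ j, c j = N)
    (he : ∀ j, e j = x j + κ * (N - c j)) : alternatingSum q κ e N 0 x =
      q ^ ((N * (Fintype.card ι).choose 2 : ℤ) - energy κ x c) := by
  by_cases hN : N = 0
  · subst hN
    have hc0 : c = 0 := by
      funext j
      exact (Finset.sum_eq_zero_iff.1 hc) j (mem_univ j)
    subst hc0
    have hxe : x = e := by funext j; simp [he j]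
    simp [alternatingSum, transferSum, hxe, energy]
  · obtain ⟨j, hj, hj1⟩ := exists_weightRatio_eq_one q hκ (x := x) c (by
      by_contra hcon
      push Not at hcon
      rw [Finset.sum_eq_zero fun j _ => hcon j] at hc
      exact hN hc.symm)
    rw [h 0 x e c hx hc he (Or.inl hN), truncatedSum_zero _ (by simpa using hj) hj1, mul_one]

/-- The induction on N needs all displacements m, because the row expansion raises m. The recursion
matches that of `truncatedSum`: the first term produces the elementary symmetric polynomial of
degree m + 1 in the weight ratios, the second the truncated sum for m + 1. -/
theorem alternatingSum_eq {q : F} (hq : q ≠ 0) {κ : ℤ} (hκ : 0 < κ) (N : ℕ) :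
    ∀ (x e : ι → ℤ) (c : ι → ℕ), Generic κ x → ∑ j, c j = N →
      (∀ j, e j = x j + κ * (N - c j)) → alternatingSum q κ e N 0 x =
        q ^ ((N * (Fintype.card ι).choose 2 : ℤ) - energy κ x c) := by
  -- The case N = m = 0 is excluded: the alternating sum is then 1, but the truncated sum over the
  -- empty set is 0.
  suffices h : ∀ (m : ℕ) (x e : ι → ℤ) (c : ι → ℕ), Generic κ x → ∑ j, c j = N + m →
      (∀ j, e j = x j + κ * (N - c j)) → (N ≠ 0 ∨ m ≠ 0) → alternatingSum q κ e N m x =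
        q ^ ((N * (Fintype.card ι).choose 2 : ℤ) - energy κ x c) *
          truncatedSum (weightRatio q κ x c) (univ.filter fun j => c j ≠ 0) m by
    exact alternatingSum_zero_eq hκ N h
  induction N with
  | zero =>
    intro m x e c hx hc he hm
    have hm' : m ≠ 0 := by simpa using hm
    rw [zero_add] at hc
    rw [truncatedSum_eq_zero, mul_zero]
    · have hne : x ≠ e := by
        intro hxe
        apply hm'
        rw [← hc]
        refine Finset.sum_eq_zero fun j _ => ?_
        have := he j
        rw [hxe] at this
        have h2 : κ * (c j : ℤ) = 0 := by push_cast at this; linarith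
        rcases mul_eq_zero.1 h2 with h3 | h3
        · exact absurd h3 hκ.ne'
        · exact_mod_cast h3
      simp [alternatingSum, transferSum, hne]
    · rw [← hc, Finset.card_filter]
      refine Finset.sum_le_sum fun j _ => ?_
      split_ifs <;> omega
  | succ N ih =>
    have ih0 : ∀ (x e : ι → ℤ) (c : ι → ℕ), Generic κ x → ∑ j, c j = N →
      (∀ j, e j = x j + κ * (N - c j)) → alternatingSum q κ e N 0 x =
        q ^ ((N * (Fintype.card ι).choose 2 : ℤ) - energy κ x c) :=
      alternatingSum_zero_eq hκ N ih
    intro m x e c hx hc he _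
    rw [alternatingSum_succ, sum_alternatingSum_zero hq hκ N m ih0 hx hc he, truncatedSum_eq,
      mul_sub]
    congr 1
    split_ifs with hN
    -- A 1 × 1 matrix has no second column. Accordingly ∑ c j = m + 1 leaves at most m + 1 beads
    -- with c j ≠ 0, so the truncated sum for m + 1 is zero.
    · subst hN
      rw [truncatedSum_eq_zero, mul_zero]
      have hc' : ∑ j, c j = m + 1 := by omega
      rw [← hc', Finset.card_filter]
      refine Finset.sum_le_sum fun j _ => ?_
      split_ifs <;> omega
    · rw [ih (m + 1) (advance κ univ x) e c (hx.advance _) (by omega) ?_ (Or.inl hN),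
        weightRatio_advance_univ, energy_advance_univ, sum_rank x hx.injective, ← mul_assoc,
        ← zpow_natCast, ← zpow_add₀ hq]
      · congr 2
        push_cast
        ring
      · intro j
        rw [he j, advance, if_pos (mem_univ j)]
        push_cast
        ring

end Field

end TransferSum

/-! ### Coefficients of the generating functions of labellings -/

namespace TransferSum

open Finset

lemma transferSum_eq_zero_of_lt {R : Type*} [CommRing R] {ι : Type*} [Fintype ι] [DecidableEq ι]
    (q : R) {κ : ℤ} (hκ : 0 < κ) (e : ι → ℤ) (j : ι) (ds : List ℤ) (x : ι → ℤ) (h : e j < x j) :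
    transferSum q κ e ds x = 0 := by
  induction ds generalizing x with
  | nil =>
    rw [transferSum, if_neg]
    rintro rfl
    exact lt_irrefl _ h
  | cons r ds ih =>
    rw [transferSum]
    refine Finset.sum_eq_zero fun U _ => ?_
    rw [ih, mul_zero]
    unfold advance
    split_ifs <;> linarith

end TransferSum

namespace ColumnLabelling

open Finset TransferSum

variable {k : ℕ}

/-- The position of a box in the reading order by diagonals, then by columns. -/
def pos (K : ℕ) (a : Fin k × ℕ) : ℤ := k * boxDiag K a + (a.1 : ℕ)

lemma pos_succ (K : ℕ) (i : Fin k) (y : ℕ) : pos K (i, y + 1) = pos K (i, y) + k := by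
  simp only [pos, boxDiag]
  push_cast
  ring

lemma pos_add (K : ℕ) (i : Fin k) (y s : ℕ) : pos K (i, y + s) = pos K (i, y) + k * s := by
  simp only [pos, boxDiag]
  push_cast
  ring

lemma pos_lt_pos_iff (K : ℕ) (i : Fin k) (y z : ℕ) : pos K (i, y) < pos K (i, z) ↔ y < z := by
  have hk : 0 < (k : ℤ) := by have := i.2; omega
  simp only [pos, boxDiag]
  rw [add_lt_add_iff_right, mul_lt_mul_iff_right₀ hk, sub_lt_sub_iff_right]
  exact Nat.cast_lt

lemma mul_lt_mul_add_iff {κ d d' r r' : ℤ} (h1 : 0 ≤ r) (h2 : r < κ) (h3 : 0 ≤ r')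
    (h4 : r' < κ) : κ * d + r < κ * d' + r' ↔ d < d' ∨ (d = d' ∧ r < r') := by
  constructor
  · intro h
    rcases lt_trichotomy d d' with h5 | h5 | h5
    · exact Or.inl h5
    · subst h5; exact Or.inr ⟨rfl, by linarith⟩
    · nlinarith
  · rintro (h5 | ⟨rfl, h5⟩)
    · nlinarith
    · linarith

/-- The column is a digit between 0 and k - 1, so positions compare lexicographically by diagonal
and column. The two kinds of attacking pairs are exactly the two ways of being later by less than k.
-/
lemma attacking_iff (K : ℕ) (a b : Fin k × ℕ) :
    Attacking K a b ↔ pos K a < pos K b ∧ pos K b < pos K a + k := by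
  have ha := a.1.2
  have hb := b.1.2
  have h1 := mul_lt_mul_add_iff (κ := k) (d := boxDiag K a) (d' := boxDiag K b)
    (r := (a.1 : ℕ)) (r' := (b.1 : ℕ)) (by omega) (by omega) (by omega) (by omega)
  have h2 := mul_lt_mul_add_iff (κ := k) (d := boxDiag K b) (d' := boxDiag K a + 1)
    (r := (b.1 : ℕ)) (r' := (a.1 : ℕ)) (by omega) (by omega) (by omega) (by omega)
  have h3 : pos K a + k = k * (boxDiag K a + 1) + (a.1 : ℕ) := by unfold pos; ring
  rw [h3]
  unfold pos
  rw [h1, h2]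
  unfold Attacking
  rw [Fin.lt_def, Fin.lt_def]
  omega

/-- The residue of a position modulo k is the column. This gives the genericity of bead
configurations with one bead per column. -/
lemma not_dvd_pos_sub (K : ℕ) {a b : Fin k × ℕ} (hab : a.1 ≠ b.1) :
    ¬ (k : ℤ) ∣ pos K a - pos K b := by
  intro hd
  have h1 : (k : ℤ) ∣ ((a.1 : ℕ) : ℤ) - ((b.1 : ℕ) : ℤ) := by
    have h2 : pos K a - pos K b =
        k * (boxDiag K a - boxDiag K b) + (((a.1 : ℕ) : ℤ) - ((b.1 : ℕ) : ℤ)) := by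
      simp only [pos]; ring
    rw [h2] at hd
    exact (Int.dvd_add_right (dvd_mul_right _ _)).1 hd
  have hi := a.1.2
  have hj := b.1.2
  have h3 := Int.eq_zero_of_abs_lt_dvd h1 (by rw [abs_lt]; omega)
  exact hab (Fin.ext (by omega))

lemma generic_pos (K : ℕ) (y : Fin k → ℕ) : Generic (k : ℤ) fun i => pos K (i, y i) :=
  fun i j hij => not_dvd_pos_sub K (a := (i, y i)) (b := (j, y j)) hij

lemma pos_injective (K : ℕ) : Function.Injective (pos K : Fin k × ℕ → ℤ) := by
  rintro ⟨i, y⟩ ⟨j, z⟩ h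
  by_cases hij : i = j
  · subst hij
    have h1 := pos_lt_pos_iff K i y z
    have h2 := pos_lt_pos_iff K i z y
    rw [h] at h1 h2
    have : y = z := by simp at h1 h2; omega
    rw [this]
  · refine absurd ?_ (not_dvd_pos_sub K (a := (i, y)) (b := (j, z)) hij)
    rw [h, sub_self]
    exact dvd_zero _

/-- The boxes of column `i` in the rows from `lo i` to `hi i - 1`. -/
def columnSet (lo hi : Fin k → ℕ) : Finset (Fin k × ℕ) :=
  (univ ×ˢ range (univ.sup hi)).filter fun a => lo a.1 ≤ a.2 ∧ a.2 < hi a.1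

lemma mem_columnSet {lo hi : Fin k → ℕ} {a : Fin k × ℕ} :
    a ∈ columnSet lo hi ↔ lo a.1 ≤ a.2 ∧ a.2 < hi a.1 := by
  unfold columnSet
  rw [mem_filter, mem_product, mem_range]
  constructor
  · exact fun h => h.2
  · exact fun h => ⟨⟨mem_univ _, lt_of_lt_of_le h.2 (le_sup (f := hi) (mem_univ a.1))⟩, h⟩

open Classical in
/-- The column-strict labellings of `S` by the labels `v, …, v + L - 1` with content `d`. -/
noncomputable def labellings (S : Finset (Fin k × ℕ)) (v L : ℕ) (d : ℕ → ℕ) :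
    Finset (S → ℕ) :=
  (Fintype.piFinset fun _ : S => Ico v (v + L)).filter fun P =>
    ColumnStrict P ∧ ∀ w ∈ Ico v (v + L), (univ.filter fun a => P a = w).card = d w

lemma mem_labellings {S : Finset (Fin k × ℕ)} {v L : ℕ} {d : ℕ → ℕ} {P : S → ℕ} :
    P ∈ labellings S v L d ↔ (∀ a, v ≤ P a ∧ P a < v + L) ∧ ColumnStrict P ∧
      ∀ w, v ≤ w → w < v + L → (univ.filter fun a => P a = w).card = d w := by
  simp only [labellings, mem_filter, Fintype.mem_piFinset, mem_Ico, and_imp]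

/-- The number of pairs of a box of `S` and a later bottom position of a column. -/
def boundary (K : ℕ) (S : Finset (Fin k × ℕ)) (x : Fin k → ℤ) : ℕ :=
  ∑ a ∈ S, (univ.filter fun i => pos K a < x i).card

lemma tdinv_eq_sum {K : ℕ} {S : Finset (Fin k × ℕ)} (P : S → ℕ) :
    tdinv K P = ∑ a : S, ∑ b : S, if Attacking K a.1 b.1 ∧ P a < P b then 1 else 0 := by
  rw [tdinv, Finset.card_filter, Fintype.sum_prod_type]

/-- The row bounds after the bottom boxes of the columns in `U` have been removed. -/
def raise (U : Finset (Fin k)) (lo : Fin k → ℕ) (i : Fin k) : ℕ :=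
  if i ∈ U then lo i + 1 else lo i

lemma pos_raise (K : ℕ) (U : Finset (Fin k)) (lo : Fin k → ℕ) :
    (fun i => pos K (i, raise U lo i)) = advance k U fun i => pos K (i, lo i) := by
  funext i
  unfold raise advance
  split_ifs
  · exact pos_succ K i _
  · rfl

section Step

variable {K : ℕ} {lo hi : Fin k → ℕ} {U : Finset (Fin k)}

/-- The bottom boxes of the columns in `U`. -/
def bottoms (lo : Fin k → ℕ) (U : Finset (Fin k)) : Finset (Fin k × ℕ) :=
  U.image fun i => (i, lo i)

lemma columnSet_eq_union (hU : ∀ i ∈ U, lo i < hi i) :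
    columnSet lo hi = columnSet (raise U lo) hi ∪ bottoms lo U := by
  ext ⟨i, y⟩
  simp only [mem_union, mem_columnSet, bottoms, mem_image, Prod.mk.injEq, raise]
  constructor
  · intro h
    by_cases hi' : i ∈ U
    · rw [if_pos hi']
      by_cases hy : y = lo i
      · exact Or.inr ⟨i, hi', rfl, hy.symm⟩
      · exact Or.inl (by omega)
    · rw [if_neg hi']; exact Or.inl h
  · rintro (h | ⟨j, hj, rfl, rfl⟩)
    · split_ifs at h <;> omega
    · exact ⟨le_rfl, hU j hj⟩

lemma disjoint_bottoms : Disjoint (columnSet (raise U lo) hi) (bottoms lo U) := by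
  rw [Finset.disjoint_left]
  rintro ⟨i, y⟩ h1 h2
  simp only [mem_columnSet, bottoms, mem_image, Prod.mk.injEq, raise] at h1 h2
  obtain ⟨j, hj, rfl, rfl⟩ := h2
  rw [if_pos hj] at h1
  omega

lemma sum_bottoms {A : Type*} [AddCommMonoid A] (f : Fin k × ℕ → A) :
    ∑ a ∈ bottoms lo U, f a = ∑ i ∈ U, f (i, lo i) := by
  unfold bottoms
  rw [Finset.sum_image]
  intro i _ j _ h
  exact (Prod.mk.inj h).1

/-- The removed bottom boxes contribute precisely the ranks of their beads to the boundary. For a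
remaining box a, the bead of column i passes a on its way from x_i to x_i + k exactly when the
removed box of column i attacks a. -/
lemma boundary_step (hk : 0 < k) (hU : ∀ i ∈ U, lo i < hi i) :
    (∑ a ∈ bottoms lo U, ∑ b ∈ columnSet (raise U lo) hi, if Attacking K a b then 1 else 0) +
      boundary K (columnSet lo hi) (fun i => pos K (i, lo i)) =
    ∑ j ∈ U, rank (fun i => pos K (i, lo i)) j +
      boundary K (columnSet (raise U lo) hi) (fun i => pos K (i, raise U lo i)) := by
  unfold boundary
  rw [columnSet_eq_union hU, Finset.sum_union disjoint_bottoms, sum_bottoms, sum_bottoms]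
  change _ + (_ + ∑ j ∈ U, rank (fun i => pos K (i, lo i)) j) = _
  rw [← add_assoc, add_comm _ (∑ j ∈ U, rank (fun i => pos K (i, lo i)) j)]
  congr 1
  rw [Finset.sum_comm, ← Finset.sum_add_distrib]
  refine Finset.sum_congr rfl fun a ha => ?_
  rw [Finset.card_filter, Finset.card_filter]
  have h1 : ∑ i ∈ U, (if Attacking K (i, lo i) a then 1 else 0 : ℕ) =
      ∑ i, if i ∈ U then (if Attacking K (i, lo i) a then 1 else 0) else 0 := by
    rw [← Finset.sum_filter]; simp
  rw [h1, ← Finset.sum_add_distrib]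
  refine Finset.sum_congr rfl fun i _ => ?_
  by_cases hi' : i ∈ U
  · have hk' : (0 : ℤ) < k := by exact_mod_cast hk
    have hne : pos K (i, lo i) ≠ pos K a := by
      intro h
      obtain rfl := pos_injective K h
      rw [mem_columnSet] at ha
      simp only [raise, if_pos hi'] at ha
      omega
    simp only [hi', if_true, raise, pos_succ, attacking_iff]
    split_ifs <;> omega
  · simp [hi', raise]

end Step

end ColumnLabelling

/-! ### Peeling off the boxes with the smallest label. -/

namespace ColumnLabelling

open Finset TransferSum

variable {k : ℕ} {K : ℕ}

lemma tdinv_eq_of_forall {S : Finset (Fin k × ℕ)} {P : S → ℕ} {Q : Fin k × ℕ → ℕ}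
    (h : ∀ a : S, P a = Q a) :
    tdinv K P = ∑ a ∈ S, ∑ b ∈ S, if Attacking K a b ∧ Q a < Q b then 1 else 0 := by
  rw [tdinv_eq_sum, ← Finset.sum_coe_sort S]
  refine Finset.sum_congr rfl fun a _ => ?_
  rw [← Finset.sum_coe_sort S]
  exact Finset.sum_congr rfl fun b _ => by rw [h a, h b]

lemma exists_extension {S : Finset (Fin k × ℕ)} (P : S → ℕ) :
    ∃ Q : Fin k × ℕ → ℕ, ∀ a : S, P a = Q a :=
  ⟨fun a => if h : a ∈ S then P ⟨a, h⟩ else 0, fun a => by simp⟩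

variable {lo hi : Fin k → ℕ}

open Classical in
/-- The columns whose bottom box has the label `v`. -/
noncomputable def bottomColumns (P : columnSet lo hi → ℕ) (v : ℕ) : Finset (Fin k) :=
  univ.filter fun i => ∃ h : (i, lo i) ∈ columnSet lo hi, P ⟨(i, lo i), h⟩ = v

lemma mem_bottomColumns {P : columnSet lo hi → ℕ} {v : ℕ} {i : Fin k} :
    i ∈ bottomColumns P v ↔ ∃ h : (i, lo i) ∈ columnSet lo hi, P ⟨(i, lo i), h⟩ = v := by
  simp [bottomColumns]

lemma lt_of_mem_bottomColumns {P : columnSet lo hi → ℕ} {v : ℕ} {i : Fin k}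
    (h : i ∈ bottomColumns P v) : lo i < hi i :=
  (mem_columnSet.1 (mem_bottomColumns.1 h).1).2

/-- The smallest label occurs only at the bottom of a column, because labels strictly increase
upwards. -/
lemma eq_bottom_of_label_eq {P : columnSet lo hi → ℕ} {v : ℕ} (hcs : ColumnStrict P)
    (hv : ∀ a, v ≤ P a) {a : columnSet lo hi} (ha : P a = v) : a.1 = (a.1.1, lo a.1.1) := by
  have h1 := mem_columnSet.1 a.2
  by_contra hne
  have h2 : lo a.1.1 < a.1.2 := by
    refine lt_of_le_of_ne h1.1 fun h => hne ?_
    exact Prod.ext rfl h.symm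
  have h3 : (a.1.1, lo a.1.1) ∈ columnSet lo hi := mem_columnSet.2 ⟨le_rfl, lt_trans h2 h1.2⟩
  have h4 := hcs ⟨_, h3⟩ a rfl h2
  have h5 := hv ⟨_, h3⟩
  omega

lemma label_eq_iff_mem_bottoms {P : columnSet lo hi → ℕ} {v : ℕ} (hcs : ColumnStrict P)
    (hv : ∀ a, v ≤ P a) (a : columnSet lo hi) :
    P a = v ↔ a.1 ∈ bottoms lo (bottomColumns P v) := by
  constructor
  · intro ha
    have h := eq_bottom_of_label_eq hcs hv ha
    refine mem_image.2 ⟨a.1.1, mem_bottomColumns.2 ⟨h ▸ a.2, ?_⟩, h.symm⟩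
    rw [← ha]
    congr 1
    exact Subtype.ext h.symm
  · intro ha
    obtain ⟨i, hi', h⟩ := mem_image.1 ha
    obtain ⟨h1, h2⟩ := mem_bottomColumns.1 hi'
    rw [← h2]
    congr 1
    exact Subtype.ext h.symm

lemma card_label_eq {P : columnSet lo hi → ℕ} {v : ℕ} (hcs : ColumnStrict P)
    (hv : ∀ a, v ≤ P a) :
    (univ.filter fun a => P a = v).card = (bottomColumns P v).card := by
  have h1 : (bottoms lo (bottomColumns P v)).card = (bottomColumns P v).card :=
    Finset.card_image_of_injective _ fun i j h => (Prod.mk.inj h).1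
  rw [← h1]
  refine Finset.card_bij (fun a _ => a.1) ?_ ?_ ?_
  · intro a ha
    exact (label_eq_iff_mem_bottoms hcs hv a).1 (mem_filter.1 ha).2
  · intro a _ b _ h
    exact Subtype.ext h
  · intro a ha
    obtain ⟨i, hi', rfl⟩ := mem_image.1 ha
    obtain ⟨h3, h4⟩ := mem_bottomColumns.1 hi'
    exact ⟨⟨_, h3⟩, by simpa using h4, rfl⟩

/-- The restriction of a labelling to the boxes which are not in `bottoms lo U`. -/
def restrictLabelling {U : Finset (Fin k)} (hU : ∀ i ∈ U, lo i < hi i)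
    (P : columnSet lo hi → ℕ) (a : columnSet (raise U lo) hi) : ℕ :=
  P ⟨a.1, by rw [columnSet_eq_union hU]; exact mem_union_left _ a.2⟩

/-- The extension of a labelling by the label `v` on `bottoms lo U`. -/
def extendLabelling {U : Finset (Fin k)} (v : ℕ) (P : columnSet (raise U lo) hi → ℕ)
    (a : columnSet lo hi) : ℕ :=
  if h : a.1 ∈ columnSet (raise U lo) hi then P ⟨a.1, h⟩ else v

lemma card_label_restrict {U : Finset (Fin k)} (hU : ∀ i ∈ U, lo i < hi i)
    (P : columnSet lo hi → ℕ) {v w : ℕ} (hvw : v < w)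
    (hP : ∀ a : columnSet lo hi, a.1 ∉ columnSet (raise U lo) hi → P a = v) :
    (univ.filter fun a => P a = w).card =
      (univ.filter fun a => restrictLabelling hU P a = w).card := by
  symm
  refine Finset.card_bij
    (fun a _ => ⟨a.1, by rw [columnSet_eq_union hU]; exact mem_union_left _ a.2⟩) ?_ ?_ ?_
  · intro a ha
    exact mem_filter.2 ⟨mem_univ _, (mem_filter.1 ha).2⟩
  · intro a _ b _ h
    exact Subtype.ext (Subtype.mk.inj h)
  · intro a ha
    have ha' : P a = w := by simpa using ha
    have h : a.1 ∈ columnSet (raise U lo) hi := by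
      by_contra h
      have := hP a h
      omega
    exact ⟨⟨a.1, h⟩, mem_filter.2 ⟨mem_univ _, ha'⟩, rfl⟩

lemma restrict_extend {U : Finset (Fin k)} (hU : ∀ i ∈ U, lo i < hi i) (v : ℕ)
    (P : columnSet (raise U lo) hi → ℕ) :
    restrictLabelling hU (extendLabelling v P) = P := by
  funext a
  unfold restrictLabelling extendLabelling
  rw [dif_pos a.2]

lemma bottomColumns_extend {U : Finset (Fin k)} (hU : ∀ i ∈ U, lo i < hi i) {v : ℕ}
    {P : columnSet (raise U lo) hi → ℕ} (hP : ∀ a, v < P a) :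
    bottomColumns (extendLabelling v P) v = U := by
  ext i
  rw [mem_bottomColumns]
  constructor
  · rintro ⟨h1, h2⟩
    by_contra hi'
    have h3 : (i, lo i) ∈ columnSet (raise U lo) hi := by
      rw [mem_columnSet] at h1 ⊢
      simpa [raise, hi'] using h1
    rw [extendLabelling, dif_pos h3] at h2
    exact absurd h2 (hP ⟨_, h3⟩).ne'
  · intro hi'
    refine ⟨mem_columnSet.2 ⟨le_rfl, hU i hi'⟩, ?_⟩
    rw [extendLabelling, dif_neg]
    rw [mem_columnSet]
    simp [raise, hi']

lemma extend_mem_labellings {U : Finset (Fin k)} (hU : ∀ i ∈ U, lo i < hi i) {v L : ℕ}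
    {d : ℕ → ℕ} (hUv : U.card = d v) {P : columnSet (raise U lo) hi → ℕ}
    (hP : P ∈ labellings (columnSet (raise U lo) hi) (v + 1) L d) :
    extendLabelling v P ∈ labellings (columnSet lo hi) v (L + 1) d := by
  rw [mem_labellings] at hP ⊢
  obtain ⟨h1, h2, h3⟩ := hP
  have hv : ∀ a, v ≤ extendLabelling v P a ∧ extendLabelling v P a < v + (L + 1) := by
    intro a
    unfold extendLabelling
    split_ifs with h
    · have := h1 ⟨a.1, h⟩
      omega
    · omega
  have hcs : ColumnStrict (extendLabelling (lo := lo) v P) := by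
    intro a b hab hlt
    have ha := mem_columnSet.1 a.2
    have hb := mem_columnSet.1 b.2
    have hb' : b.1 ∈ columnSet (raise U lo) hi := by
      rw [mem_columnSet]
      refine ⟨?_, hb.2⟩
      unfold raise
      rw [hab] at ha
      split_ifs <;> omega
    unfold extendLabelling
    rw [dif_pos hb']
    split_ifs with h
    · exact h2 _ _ hab hlt
    · have := h1 ⟨b.1, hb'⟩
      omega
  refine ⟨hv, hcs, fun w hw1 hw2 => ?_⟩
  rcases eq_or_lt_of_le hw1 with rfl | hw
  · rw [card_label_eq hcs fun a => (hv a).1,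
      bottomColumns_extend hU fun a => lt_of_lt_of_le (Nat.lt_succ_self v) (h1 a).1, hUv]
  · rw [card_label_restrict hU _ hw fun a ha => by rw [extendLabelling, dif_neg ha],
      restrict_extend]
    exact h3 w hw (by omega)

section Restrict

variable {v L : ℕ} {d : ℕ → ℕ} {P : columnSet lo hi → ℕ}

lemma label_eq_of_notMem (hP : P ∈ labellings (columnSet lo hi) v L d) (a : columnSet lo hi)
    (ha : a.1 ∉ columnSet (raise (bottomColumns P v) lo) hi) : P a = v := by
  obtain ⟨h1, h2, -⟩ := mem_labellings.1 hP
  rw [label_eq_iff_mem_bottoms h2 fun a => (h1 a).1]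
  have h3 : a.1 ∈ columnSet (raise (bottomColumns P v) lo) hi ∪ bottoms lo (bottomColumns P v) := by
    rw [← columnSet_eq_union fun i hi' => lt_of_mem_bottomColumns hi']
    exact a.2
  exact (mem_union.1 h3).resolve_left ha

lemma lt_label_of_mem (hP : P ∈ labellings (columnSet lo hi) v L d) (a : columnSet lo hi)
    (ha : a.1 ∈ columnSet (raise (bottomColumns P v) lo) hi) : v < P a := by
  obtain ⟨h1, h2, -⟩ := mem_labellings.1 hP
  refine lt_of_le_of_ne (h1 a).1 fun h => ?_
  exact Finset.disjoint_left.1 disjoint_bottoms ha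
    ((label_eq_iff_mem_bottoms h2 (fun a => (h1 a).1) a).1 h.symm)

lemma restrict_mem_labellings (hP : P ∈ labellings (columnSet lo hi) v (L + 1) d)
    (hU : ∀ i ∈ bottomColumns P v, lo i < hi i) :
    restrictLabelling hU P ∈ labellings (columnSet (raise (bottomColumns P v) lo) hi)
      (v + 1) L d := by
  obtain ⟨h1, h2, h3⟩ := mem_labellings.1 hP
  refine mem_labellings.2 ⟨fun a => ?_, fun a b hab hlt => h2 _ _ hab hlt, fun w hw1 hw2 => ?_⟩
  · have h4 := lt_label_of_mem hP ⟨a.1, by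
      rw [columnSet_eq_union hU]; exact mem_union_left _ a.2⟩ a.2
    have h5 := h1 ⟨a.1, by rw [columnSet_eq_union hU]; exact mem_union_left _ a.2⟩
    unfold restrictLabelling
    omega
  · rw [← card_label_restrict hU P (Nat.lt_of_succ_le hw1) fun a ha => label_eq_of_notMem hP a ha]
    exact h3 w (by omega) (by omega)

lemma extend_restrict (hP : P ∈ labellings (columnSet lo hi) v L d)
    (hU : ∀ i ∈ bottomColumns P v, lo i < hi i) :
    extendLabelling v (restrictLabelling hU P) = P := by
  funext a
  unfold extendLabelling restrictLabelling
  split_ifs with h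
  · rfl
  · exact (label_eq_of_notMem hP a h).symm

/-- Boxes with the smallest label contribute to tdinv through all attacks on remaining boxes, and
through no attack on each other or from a remaining box. `boundary_step` converts these attacks into
ranks. -/
lemma tdinv_add_boundary (hk : 0 < k) (hP : P ∈ labellings (columnSet lo hi) v L d)
    (hU : ∀ i ∈ bottomColumns P v, lo i < hi i) :
    tdinv K P + boundary K (columnSet lo hi) (fun i => pos K (i, lo i)) =
      ∑ j ∈ bottomColumns P v, rank (fun i => pos K (i, lo i)) j +
      (tdinv K (restrictLabelling hU P) +
        boundary K (columnSet (raise (bottomColumns P v) lo) hi)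
          (fun i => pos K (i, raise (bottomColumns P v) lo i))) := by
  obtain ⟨Q, hQ⟩ := exists_extension P
  have hmem : ∀ a ∈ columnSet (raise (bottomColumns P v) lo) hi, a ∈ columnSet lo hi :=
    fun a ha => by rw [columnSet_eq_union hU]; exact mem_union_left _ ha
  rw [tdinv_eq_of_forall hQ, tdinv_eq_of_forall (P := restrictLabelling hU P) (Q := Q)
    fun a => hQ ⟨a.1, hmem a.1 a.2⟩]
  rw [add_left_comm, ← boundary_step hk hU]
  have hmem' : ∀ a ∈ bottoms lo (bottomColumns P v), a ∈ columnSet lo hi :=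
    fun a ha => by rw [columnSet_eq_union hU]; exact mem_union_right _ ha
  have hQ1 : ∀ a ∈ columnSet (raise (bottomColumns P v) lo) hi, v < Q a := by
    intro a ha
    rw [← hQ ⟨a, hmem a ha⟩]
    exact lt_label_of_mem hP _ ha
  have hQ2 : ∀ a ∈ bottoms lo (bottomColumns P v), Q a = v := by
    intro a ha
    obtain ⟨h1, h2, -⟩ := mem_labellings.1 hP
    rw [← hQ ⟨a, hmem' a ha⟩]
    exact (label_eq_iff_mem_bottoms h2 (fun a => (h1 a).1) _).2 ha
  rw [← add_assoc]
  congr 1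
  rw [columnSet_eq_union hU]
  simp only [Finset.sum_union disjoint_bottoms, Finset.sum_add_distrib]
  have e1 : ∑ a ∈ columnSet (raise (bottomColumns P v) lo) hi,
      ∑ b ∈ bottoms lo (bottomColumns P v), (if Attacking K a b ∧ Q a < Q b then 1 else 0 : ℕ) =
      0 := by
    refine Finset.sum_eq_zero fun a ha => Finset.sum_eq_zero fun b hb => if_neg ?_
    have := hQ1 a ha
    have := hQ2 b hb
    omega
  have e2 : ∑ a ∈ bottoms lo (bottomColumns P v),
      ∑ b ∈ bottoms lo (bottomColumns P v), (if Attacking K a b ∧ Q a < Q b then 1 else 0 : ℕ) =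
      0 := by
    refine Finset.sum_eq_zero fun a ha => Finset.sum_eq_zero fun b hb => if_neg ?_
    have := hQ2 a ha
    have := hQ2 b hb
    omega
  have e3 : ∑ a ∈ bottoms lo (bottomColumns P v),
      ∑ b ∈ columnSet (raise (bottomColumns P v) lo) hi,
        (if Attacking K a b ∧ Q a < Q b then 1 else 0 : ℕ) =
      ∑ a ∈ bottoms lo (bottomColumns P v),
        ∑ b ∈ columnSet (raise (bottomColumns P v) lo) hi, if Attacking K a b then 1 else 0 := by
    refine Finset.sum_congr rfl fun a ha => Finset.sum_congr rfl fun b hb => ?_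
    have := hQ2 a ha
    have := hQ1 b hb
    congr 1
    apply propext
    constructor
    · exact fun h => h.1
    · exact fun h => ⟨h, by omega⟩
  rw [e1, e2, e3]
  ring

end Restrict

variable {R : Type*} [CommRing R]

/-- A labelling is the same as a sequence of bead moves: the label v is used on the bottom boxes of
a set U of d v columns, and what remains is a labelling of the raised shape by the later labels. -/
theorem sum_labellings (q : R) (hk : 0 < k) (d : ℕ → ℕ) (hi : Fin k → ℕ) (L : ℕ) :
    ∀ (v : ℕ) (lo : Fin k → ℕ), (∀ i, lo i ≤ hi i) →
      ∑ P ∈ labellings (columnSet lo hi) v L d,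
        q ^ (tdinv K P + boundary K (columnSet lo hi) (fun i => pos K (i, lo i))) =
      transferSum q k (fun i => pos K (i, hi i)) ((List.range' v L).map fun w => (d w : ℤ))
        (fun i => pos K (i, lo i)) := by
  classical
  have hk' : (0 : ℤ) < k := by exact_mod_cast hk
  induction L with
  | zero =>
    intro v lo hlo
    simp only [List.range'_zero, List.map_nil, transferSum]
    by_cases h : lo = hi
    · subst h
      have hempty : columnSet lo lo = ∅ := by
        ext a
        rw [mem_columnSet]
        simp
      have hE : IsEmpty (columnSet lo lo) := by rw [hempty]; infer_instance
      rw [if_pos rfl]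
      have hlab : labellings (columnSet lo lo) v 0 d = {fun a => (hE.false a).elim} := by
        ext P
        rw [mem_labellings, mem_singleton]
        constructor
        · intro _
          funext a
          exact (hE.false a).elim
        · intro _
          refine ⟨fun a => (hE.false a).elim, fun a => (hE.false a).elim, fun w h1 h2 => ?_⟩
          omega
      rw [hlab, Finset.sum_singleton]
      have h1 : boundary K (columnSet lo lo) (fun i => pos K (i, lo i)) = 0 := by
        rw [boundary, hempty, Finset.sum_empty]
      rw [h1, add_zero, tdinv_eq_sum, Finset.univ_eq_empty, Finset.sum_empty, pow_zero]
    · rw [if_neg]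
      · refine Finset.sum_eq_zero fun P hP => ?_
        exfalso
        obtain ⟨i, hi'⟩ := Function.ne_iff.1 h
        have h1 := (mem_labellings.1 hP).1
          ⟨(i, lo i), mem_columnSet.2 ⟨le_rfl, lt_of_le_of_ne (hlo i) hi'⟩⟩
        omega
      · intro h'
        apply h
        funext i
        exact (Prod.mk.inj (pos_injective K (congrFun h' i))).2
  | succ L ih =>
    intro v lo hlo
    rw [List.range'_succ, List.map_cons, transferSum, Finset.sum_filter,
      ← Finset.sum_fiberwise _ (fun P => bottomColumns P v)]
    refine Finset.sum_congr rfl fun U _ => ?_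
    by_cases hU : ∀ i ∈ U, lo i < hi i
    · by_cases hUv : (U.card : ℤ) = d v
      · have hUv' : U.card = d v := by exact_mod_cast hUv
        rw [if_pos hUv, ← pos_raise, ← ih (v + 1) (raise U lo) ?_, Finset.mul_sum]
        · refine Finset.sum_bij' (fun P _ => restrictLabelling hU P)
            (fun P _ => extendLabelling v P) ?_ ?_ ?_ ?_ ?_
          · intro P hP
            rw [mem_filter] at hP
            obtain ⟨hP, rfl⟩ := hP
            exact restrict_mem_labellings hP hU
          · intro P hP
            rw [mem_filter]
            exact ⟨extend_mem_labellings hU hUv' hP, bottomColumns_extend hU fun a =>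
              lt_of_lt_of_le (Nat.lt_succ_self v) ((mem_labellings.1 hP).1 a).1⟩
          · intro P hP
            rw [mem_filter] at hP
            obtain ⟨hP, rfl⟩ := hP
            exact extend_restrict hP hU
          · intro P _
            exact restrict_extend hU v P
          · intro P hP
            rw [mem_filter] at hP
            obtain ⟨hP, rfl⟩ := hP
            rw [tdinv_add_boundary hk hP hU, pow_add]
        · intro i
          unfold raise
          split_ifs with h
          · exact hU i h
          · exact hlo i
      · rw [if_neg hUv]
        refine Finset.sum_eq_zero fun P hP => ?_
        exfalso
        rw [mem_filter] at hP
        obtain ⟨hP, rfl⟩ := hP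
        obtain ⟨h1, h2, h3⟩ := mem_labellings.1 hP
        apply hUv
        rw [← card_label_eq h2 fun a => (h1 a).1, h3 v le_rfl (by omega)]
    · push Not at hU
      obtain ⟨i, hiU, hi'⟩ := hU
      have h1 : lo i = hi i := le_antisymm (hlo i) hi'
      -- If U contains an exhausted column, its bead passes its destination and never comes back; on
      -- the other side no labelling has this U.
      rw [transferSum_eq_zero_of_lt q hk' _ i, mul_zero, ite_self]
      · refine Finset.sum_eq_zero fun P hP => ?_
        exfalso
        rw [mem_filter] at hP
        obtain ⟨-, rfl⟩ := hP
        have := lt_of_mem_bottomColumns hiU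
        omega
      · rw [advance, if_pos hiU, h1]
        linarith

end ColumnLabelling

/-! ### Symmetry of the generating function and its Hall product with a rectangle. -/

namespace TransferSum

open Finset

lemma transferSum_eq_zero_of_neg_mem {R : Type*} [CommRing R] {ι : Type*} [Fintype ι]
    [DecidableEq ι] (q : R) (κ : ℤ) (e : ι → ℤ) {r : ℤ} (hr : r < 0) {ds : List ℤ}
    (h : r ∈ ds) (x : ι → ℤ) : transferSum q κ e ds x = 0 := by
  induction ds generalizing x with
  | nil => simp at h
  | cons s ds ih =>
    rw [transferSum]
    refine Finset.sum_eq_zero fun U hU => ?_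
    rcases List.mem_cons.1 h with rfl | h
    · rw [mem_filter] at hU
      omega
    · rw [ih h, mul_zero]

end TransferSum

namespace ColumnLabelling

open Finset TransferSum SymmetricFunction

variable {k K : ℕ} {lo hi : Fin k → ℕ}

section Coeff

variable {R : Type*} [CommRing R]

lemma content_apply {S : Finset (Fin k × ℕ)} (P : S → ℕ) (w : ℕ) :
    content P w = (univ.filter fun a => P a = w).card := by
  unfold content
  rw [Finsupp.finsetSum_apply, Finset.card_filter]
  exact Finset.sum_congr rfl fun a _ => by rw [Finsupp.single_apply]

/-- The bound L may exceed the largest label used, since unused labels are steps that move no bead.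
The boundary factor does not involve d, so it can be cancelled when coefficients are compared for q
≠ 0. -/
theorem coeff_lltFunction (q : R) (hk : 0 < k) (hlo : ∀ i, lo i ≤ hi i) {d : ℕ →₀ ℕ} {L : ℕ}
    (hd : d.support ⊆ range L) :
    q ^ boundary K (columnSet lo hi) (fun i => pos K (i, lo i)) *
        MvPowerSeries.coeff d (lltFunction q K (columnSet lo hi)) =
      transferSum q k (fun i => pos K (i, hi i)) ((List.range L).map fun w => (d w : ℤ))
        (fun i => pos K (i, lo i)) := by
  rw [List.range_eq_range', ← sum_labellings q hk d hi L 0 lo hlo, MvPowerSeries.coeff_apply,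
    lltFunction, Finset.mul_sum]
  refine Finset.sum_congr ?_ fun P _ => by rw [pow_add, mul_comm]
  ext P
  simp only [mem_filter, Fintype.mem_piFinset, mem_labellings, zero_add, Nat.zero_le, true_and,
    forall_const]
  constructor
  · rintro ⟨h1, h2, h3⟩
    exact ⟨fun a => mem_range.1 (hd (h1 a)), h2, fun w _ => by rw [← content_apply, h3]⟩
  · rintro ⟨h1, h2, h3⟩
    have h4 : content P = d := by
      ext w
      by_cases hw : w < L
      · rw [content_apply, h3 w hw]
      · have h5 : d w = 0 := by
          by_contra h
          exact hw (mem_range.1 (hd (Finsupp.mem_support_iff.2 h)))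
        rw [content_apply, h5, Finset.card_eq_zero, Finset.filter_eq_empty_iff]
        rintro a - rfl
        exact hw (h1 a)
    refine ⟨fun a => ?_, h2, h4⟩
    rw [Finsupp.mem_support_iff, ← h4, content_apply]
    exact (Finset.card_pos.2 ⟨a, by simp⟩).ne'

end Coeff

lemma card_filter_mapDomain (p : ℕ → Prop) [DecidablePred p] (hp : ¬ p 0) (σ : Equiv.Perm ℕ)
    {d : ℕ →₀ ℕ} {L : ℕ} (h1 : d.support ⊆ range L) (h2 : (d.mapDomain σ).support ⊆ range L) :
    ((range L).filter fun w => p (d.mapDomain σ w)).card =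
      ((range L).filter fun w => p (d w)).card := by
  have happ : ∀ w, d.mapDomain σ (σ w) = d w := fun w => by
    rw [Finsupp.mapDomain_equiv_apply, Equiv.symm_apply_apply]
  symm
  refine Finset.card_bij (fun w _ => σ w) ?_ ?_ ?_
  · intro w hw
    rw [mem_filter] at hw ⊢
    refine ⟨h2 ?_, by rw [happ]; exact hw.2⟩
    rw [Finsupp.mem_support_iff, happ]
    intro h
    rw [h] at hw
    exact hp hw.2
  · intro a _ b _ h
    exact σ.injective h
  · intro w hw
    rw [mem_filter] at hw
    have h3 : p (d (σ.symm w)) := by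
      rw [← happ, Equiv.apply_symm_apply]; exact hw.2
    refine ⟨σ.symm w, mem_filter.2 ⟨h1 ?_, h3⟩, Equiv.apply_symm_apply _ _⟩
    rw [Finsupp.mem_support_iff]
    intro h
    rw [h] at h3
    exact hp h3

lemma map_mapDomain_perm (σ : Equiv.Perm ℕ) {d : ℕ →₀ ℕ} {L : ℕ} (h1 : d.support ⊆ range L)
    (h2 : (d.mapDomain σ).support ⊆ range L) :
    ((List.range L).map fun w => d.mapDomain σ w).Perm ((List.range L).map fun w => d w) := by
  have hcount : ∀ (f : ℕ → ℕ) (a : ℕ), ((List.range L).map f).count a =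
      ((range L).filter fun w => f w = a).card := by
    intro f a
    rw [List.count_eq_countP, List.countP_map, List.countP_eq_length_filter, Finset.card_def,
      Finset.filter_val, Finset.range_val, ← Multiset.coe_range, Multiset.filter_coe,
      Multiset.coe_card]
    congr 2
  rw [List.perm_iff_count]
  intro a
  rw [hcount, hcount]
  -- The permutation σ need not preserve the range below L, so zeros are counted as the complement
  -- of the nonzero entries.
  by_cases ha : a = 0
  · subst ha
    have h3 := card_filter_mapDomain (fun a => a ≠ 0) (by simp) σ h1 h2
    have h4 := Finset.card_filter_add_card_filter_not (s := range L) (fun w => d.mapDomain σ w = 0)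
    have h5 := Finset.card_filter_add_card_filter_not (s := range L) (fun w => d w = 0)
    simp only [ne_eq] at h3
    omega
  · exact card_filter_mapDomain (fun b => b = a) (fun h => ha h.symm) σ h1 h2

section Field

variable {F : Type*} [Field F]

theorem isSymmetricFunction_lltFunction {q : F} (hq : q ≠ 0) (hk : 0 < k)
    (hlo : ∀ i, lo i ≤ hi i) : IsSymmetricFunction (lltFunction q K (columnSet lo hi)) := by
  constructor
  · refine ⟨(columnSet lo hi).card, fun d hd => ?_⟩
    rw [MvPowerSeries.coeff_apply, lltFunction] at hd
    obtain ⟨P, hP, -⟩ := Finset.exists_ne_zero_of_sum_ne_zero hd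
    simp only [mem_filter] at hP
    rw [← hP.2.2, content, map_sum]
    simp
  · intro σ d
    obtain ⟨L, hL⟩ := (d.support ∪ (d.mapDomain σ).support).exists_nat_subset_range
    have h1 := Finset.union_subset_left hL
    have h2 := Finset.union_subset_right hL
    refine mul_left_cancel₀
      (pow_ne_zero (boundary K (columnSet lo hi) (fun i => pos K (i, lo i))) hq) ?_
    rw [coeff_lltFunction q hk hlo h1, coeff_lltFunction q hk hlo h2]
    refine transferSum_perm q (by exact_mod_cast hk) _ ?_ (generic_pos K lo)
    have := (map_mapDomain_perm σ h1 h2).map (fun n : ℕ => (n : ℤ))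
    simpa only [List.map_map, Function.comp_def] using this

/-- In N variables the exponent attached to σ is k - 1 + σ i - i = k - (1 + i - σ i), the step sizes
of `alternatingSum`. When one of them is negative, both terms vanish. -/
lemma pow_mul_hallInner {q : F} (hq : q ≠ 0) (hk : 0 < k) (hlo : ∀ i, lo i ≤ hi i) (N : ℕ) :
    q ^ boundary K (columnSet lo hi) (fun i => pos K (i, lo i)) *
      hallInner (lltFunction q K (columnSet lo hi)) (schurFunction F (rectDiagram N (k - 1))) =
    alternatingSum q k (fun i => pos K (i, hi i)) N 0 (fun i => pos K (i, lo i)) := by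
  rw [hallInner_schurFunction_eq (isSymmetricFunction_lltFunction hq hk hlo)
    (colLen_rectDiagram_le N (k - 1)), schurFunctional_eq_sum, Finset.mul_sum, alternatingSum]
  refine Finset.sum_congr rfl fun σ _ => ?_
  rw [mul_smul_comm]
  congr 1
  have hrow : ∀ i : Fin N, (rectDiagram N (k - 1)).rowLen i = k - 1 := fun i =>
    rowLen_rectDiagram i.2
  have hcol : ∀ j : Fin N, shiftedColumn 0 j = ((j : ℕ) : ℤ) := by
    intro j
    unfold shiftedColumn
    split_ifs with h <;> simp [h]
  simp only [hrow, hcol, Fintype.card_fin]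
  split_ifs with h
  · have hsupp : ∀ f : Fin N →₀ ℕ, (f.embDomain Fin.valEmbedding).support ⊆ range N := by
      intro f w hw
      rw [Finsupp.support_embDomain, mem_map] at hw
      obtain ⟨i, -, rfl⟩ := hw
      exact mem_range.2 i.2
    rw [coeff_lltFunction q hk hlo (hsupp _)]
    congr 1
    rw [← List.map_coe_finRange_eq_range, List.map_map, List.ofFn_eq_map]
    refine List.map_congr_left fun i _ => ?_
    have h1 : Finsupp.embDomain Fin.valEmbedding (Finsupp.equivFunOnFinite.symm
        fun i : Fin N => k - 1 + (σ i : ℕ) - (i : ℕ)) (i : ℕ) = k - 1 + (σ i : ℕ) - (i : ℕ) :=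
      Finsupp.embDomain_apply_self Fin.valEmbedding _ i
    have h2 := h i
    simp only [Function.comp]
    rw [h1]
    omega
  · push Not at h
    obtain ⟨i, h1⟩ := h
    rw [mul_zero]
    refine (transferSum_eq_zero_of_neg_mem q k _ (r := (k : ℤ) - (1 + (i : ℕ) - (σ i : ℕ))) ?_
      ?_ _).symm
    · omega
    · rw [List.mem_ofFn]
      exact ⟨i, rfl⟩

theorem hallInner_lltFunction {q : F} (hq : q ≠ 0) (hk : 0 < k) {N : ℕ} {b : Fin k → ℕ}
    (hb : ∀ i, b i ≤ N) (hsum : ∑ i, b i = (k - 1) * N) (hhi : ∀ i, hi i = lo i + b i) :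
    hallInner (lltFunction q K (columnSet lo hi)) (schurFunction F (rectDiagram N (k - 1))) =
      q ^ ((N * k.choose 2 : ℤ) - energy k (fun i => pos K (i, lo i)) (fun i => N - b i) -
        boundary K (columnSet lo hi) (fun i => pos K (i, lo i))) := by
  have hlo : ∀ i, lo i ≤ hi i := fun i => by rw [hhi]; omega
  have h1 := pow_mul_hallInner (F := F) (K := K) hq hk hlo N
  have hk' : (0 : ℤ) < k := by exact_mod_cast hk
  -- The bead of column i moves b i times in N steps and thus misses N - b i of them; the total
  -- number of misses is kN - (k - 1)N.
  have hc : ∑ i, (N - b i) = N := by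
    have h2 : ∑ i, (N - b i) + ∑ i, b i = k * N := by
      rw [← Finset.sum_add_distrib, Finset.sum_congr rfl fun i _ => Nat.sub_add_cancel (hb i)]
      simp
    rw [hsum] at h2
    obtain ⟨l, rfl⟩ : ∃ l, k = l + 1 := ⟨k - 1, by omega⟩
    rw [Nat.add_sub_cancel] at h2
    linarith
  rw [alternatingSum_eq hq hk' N _ _ (fun i => N - b i) (generic_pos K lo) hc ?_,
    Fintype.card_fin] at h1
  · rw [zpow_sub₀ hq, eq_div_iff (zpow_ne_zero _ hq), zpow_natCast, mul_comm, h1]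
  · intro i
    rw [hhi, pos_add, Nat.cast_sub (hb i)]
    ring

/-- A column with more than N boxes would need its bead to move more than N times in N steps;
equivalently, N labels cannot fill it strictly. -/
theorem hallInner_lltFunction_eq_zero {q : F} (hq : q ≠ 0) (hk : 0 < k) {N : ℕ} {b : Fin k → ℕ}
    (hb : ∃ i, N < b i) (hhi : ∀ i, hi i = lo i + b i) :
    hallInner (lltFunction q K (columnSet lo hi)) (schurFunction F (rectDiagram N (k - 1))) =
      0 := by
  have hlo : ∀ i, lo i ≤ hi i := fun i => by rw [hhi]; omega
  have h1 := pow_mul_hallInner (F := F) (K := K) hq hk hlo N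
  have hk' : (0 : ℤ) < k := by exact_mod_cast hk
  obtain ⟨j, hj⟩ := hb
  have h2 : alternatingSum q k (fun i => pos K (i, hi i)) N 0 (fun i => pos K (i, lo i)) = 0 := by
    refine Finset.sum_eq_zero fun w _ => ?_
    rw [transferSum_eq_zero q hk' _ j, smul_zero]
    rw [List.length_ofFn, hhi, pos_add]
    have : (N : ℤ) < b j := by exact_mod_cast hj
    nlinarith
  rw [h2] at h1
  exact (mul_eq_zero.1 h1).resolve_left (pow_ne_zero _ hq)

end Field

end ColumnLabelling

/-! ### Dyck path statistics -/

namespace RatDyckPath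

open Finset TransferSum ColumnLabelling

variable {K k : ℕ} (D : RatDyckPath K k)

/-- The height of the path at `x = r`, before the north steps there. -/
def height (r : ℕ) : ℕ := ∑ j ∈ univ.filter (fun j : Fin k => (j : ℕ) < r), D.run j

lemma bot_eq (i : Fin k) : D.bot i = D.height i := by
  unfold bot height
  congr 1
  ext j
  simp only [mem_Iio, mem_filter, mem_univ, true_and, Fin.lt_def]

lemma top_eq (i : Fin k) : D.top i = D.height (i + 1) := by
  unfold top height
  congr 1
  ext j
  simp only [mem_Iic, mem_filter, mem_univ, true_and, Fin.le_def]
  omega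

lemma height_mono : Monotone D.height := by
  intro r s hrs
  refine Finset.sum_le_sum_of_subset fun j hj => ?_
  simp only [mem_filter, mem_univ, true_and] at hj ⊢
  omega

lemma height_zero : D.height 0 = 0 := by simp [height]

lemma height_last : D.height k = K := by
  rw [height, Finset.filter_true_of_mem fun j _ => j.2, D.sum_run]

lemma top_eq_bot_add_run (i : Fin k) : D.top i = D.bot i + D.run i := by
  rw [top, bot, ← Finset.sum_Iio_add_eq_sum_Iic]

lemma top_le (i : Fin k) : D.top i ≤ K := by
  rw [top_eq]
  exact (D.height_mono i.2).trans_eq D.height_last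

lemma bot_le_top (i : Fin k) : D.bot i ≤ D.top i := by
  rw [top_eq_bot_add_run]; omega

lemma boxes_eq : D.boxes = columnSet D.bot D.top := by
  ext ⟨i, y⟩
  rw [mem_columnSet, boxes, mem_filter]
  simp only [mem_product, mem_univ, mem_range, true_and]
  have := D.top_le i
  constructor
  · exact fun h => h.2
  · exact fun h => ⟨by omega, h⟩

lemma mem_aboveBoxes {c : Fin k × ℕ} : c ∈ D.aboveBoxes ↔ D.top c.1 ≤ c.2 ∧ c.2 < K := by
  rw [aboveBoxes, mem_filter]
  simp only [mem_product, mem_univ, mem_range, true_and]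
  exact and_comm

/-- The row of the lowest big box of a column. -/
def bigBot (b : Fin k → ℕ) (i : Fin k) : ℕ := D.top i - b i

section Big

variable {b : Fin k → ℕ}

lemma bigBot_add (hb : ∀ i, b i ≤ D.run i) (i : Fin k) : D.top i = D.bigBot b i + b i := by
  have := hb i
  have := D.top_eq_bot_add_run i
  unfold bigBot
  omega

lemma bot_le_bigBot (hb : ∀ i, b i ≤ D.run i) (i : Fin k) : D.bot i ≤ D.bigBot b i := by
  have := hb i
  have := D.top_eq_bot_add_run i
  unfold bigBot
  omega

lemma bigBoxes_eq (hb : ∀ i, b i ≤ D.run i) :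
    D.bigBoxes b = columnSet (D.bigBot b) D.top := by
  ext ⟨i, y⟩
  rw [bigBoxes, mem_filter, boxes_eq, mem_columnSet, mem_columnSet]
  have h1 := D.bigBot_add hb i
  have h2 := D.bot_le_bigBot hb i
  simp only
  omega

lemma smallBoxes_eq (hb : ∀ i, b i ≤ D.run i) :
    D.smallBoxes b = columnSet D.bot (D.bigBot b) := by
  ext ⟨i, y⟩
  rw [smallBoxes, mem_sdiff, bigBoxes_eq D hb, boxes_eq, mem_columnSet, mem_columnSet,
    mem_columnSet]
  have h1 := D.bigBot_add hb i
  have h2 := D.bot_le_bigBot hb i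
  simp only
  omega

end Big

section Slope

variable {m : ℕ}

lemma boxDiag_eq (hk : 0 < k) (hK : K = k * m) (a : Fin k × ℕ) :
    boxDiag K a = (a.2 : ℤ) - m * ((a.1 : ℕ) : ℤ) := by
  rw [boxDiag, hK, Nat.mul_div_cancel_left _ hk]

/-- The excess of the height of the path over the diagonal. -/
def excess (m r : ℕ) : ℤ := (D.height r : ℤ) - m * r

lemma excess_zero : D.excess m 0 = 0 := by simp [excess, height_zero]

lemma excess_last (hK : K = k * m) : D.excess m k = 0 := by
  rw [excess, height_last, hK]
  push_cast
  ring

lemma excess_nonneg (hK : K = k * m) {r : ℕ} (hr : r ≤ k) : 0 ≤ D.excess m r := by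
  rcases r with _ | r
  · rw [excess_zero]
  · have h1 := D.above_diag ⟨r, hr⟩
    change K * (r + 1) ≤ k * D.top ⟨r, hr⟩ at h1
    rw [top_eq] at h1
    have h2 : k * (m * (r + 1)) ≤ k * D.height (r + 1) :=
      le_of_eq_of_le (by rw [hK]; ring) h1
    have h2 : m * (r + 1) ≤ D.height (r + 1) := Nat.le_of_mul_le_mul_left h2 (by omega)
    unfold excess
    have h3 : ((m * (r + 1) : ℕ) : ℤ) ≤ (D.height (r + 1) : ℕ) := by exact_mod_cast h2
    push_cast at h3 ⊢
    linarith

lemma boxDiag_bot (hk : 0 < k) (hK : K = k * m) (i : Fin k) :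
    boxDiag K (i, D.bot i) = D.excess m i := by
  rw [boxDiag_eq hk hK, excess, bot_eq]

lemma boxDiag_top (hk : 0 < k) (hK : K = k * m) (i : Fin k) :
    boxDiag K (i, D.top i) = D.excess m (i + 1) + m := by
  rw [boxDiag_eq hk hK, excess, top_eq]
  push_cast
  ring

lemma excess_le_boxDiag (hk : 0 < k) (hK : K = k * m) {a : Fin k × ℕ} (ha : D.bot a.1 ≤ a.2) :
    D.excess m a.1 ≤ boxDiag K a := by
  rw [boxDiag_eq hk hK, excess, ← bot_eq]
  have : (D.bot a.1 : ℤ) ≤ a.2 := by exact_mod_cast ha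
  linarith

end Slope

/-- The number of attacking pairs between two sets of boxes. -/
def attackCount (K : ℕ) (S T : Finset (Fin k × ℕ)) : ℕ :=
  ∑ a ∈ T, ∑ c ∈ S, if Attacking K c a then 1 else 0

lemma smallBigPairs_eq (b : Fin k → ℕ) :
    D.smallBigPairs b = attackCount K (D.smallBoxes b) (D.bigBoxes b) := by
  rw [smallBigPairs, Finset.card_filter, Finset.sum_product, attackCount, Finset.sum_comm]

/-- Labelling each box by its position is column-strict and makes every attacking pair count. -/
theorem maxtdinv_eq {m : ℕ} (hk : 0 < k) (hK : K = k * m) :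
    D.maxtdinv = attackCount K D.boxes D.boxes := by
  have hcount : (univ.filter fun p : D.boxes × D.boxes => Attacking K p.1.1 p.2.1).card =
      attackCount K D.boxes D.boxes := by
    rw [Finset.card_filter, Fintype.sum_prod_type_right, attackCount, ← Finset.sum_coe_sort D.boxes]
    refine Finset.sum_congr rfl fun a _ => ?_
    rw [← Finset.sum_coe_sort D.boxes]
  -- Boxes of a path weakly above the diagonal have nonnegative positions, so `toNat` below loses
  -- nothing.
  have hpos : ∀ a : D.boxes, 0 ≤ pos K a.1 := by
    intro a
    have h1 : a.1 ∈ columnSet D.bot D.top := by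
      rw [← boxes_eq]
      exact a.2
    rw [mem_columnSet] at h1
    have h2 := D.excess_le_boxDiag hk hK h1.1
    have h3 := D.excess_nonneg hK (le_of_lt a.1.1.2)
    unfold pos
    have : (0 : ℤ) ≤ k * boxDiag K a.1 := mul_nonneg (by omega) (by omega)
    omega
  have hgreat : IsGreatest {t | ∃ P : D.boxes → ℕ, ColumnStrict P ∧ tdinv K P = t}
      (attackCount K D.boxes D.boxes) := by
    constructor
    · refine ⟨fun a => (pos K a.1).toNat, ?_, ?_⟩
      · rintro ⟨⟨i, y⟩, ha⟩ ⟨⟨j, z⟩, hb⟩ hab hlt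
        have hab : i = j := hab
        subst hab
        have h1 := (pos_lt_pos_iff K i y z).2 hlt
        have h2 := hpos ⟨_, ha⟩
        have h3 := hpos ⟨_, hb⟩
        simp only at h2 h3 ⊢
        omega
      · rw [← hcount, tdinv]
        congr 1
        refine Finset.filter_congr fun p _ => ?_
        constructor
        · exact fun h => h.1
        · intro h
          refine ⟨h, ?_⟩
          have h1 := ((attacking_iff K _ _).1 h).1
          have h2 := hpos p.1
          have h3 := hpos p.2
          omega
    · rintro _ ⟨P, -, rfl⟩
      rw [← hcount, tdinv]
      refine Finset.card_le_card fun p hp => ?_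
      rw [mem_filter] at hp ⊢
      exact ⟨hp.1, hp.2.1⟩
  rw [maxtdinv, hgreat.csSup_eq]

section PathDinv

variable {m : ℕ}

/-- In row y the boxes above the path are those to the left of the unique north step, here in column
j. -/
lemma arm_eq {i j : Fin k} {y : ℕ} (h : (j, y) ∈ D.boxes) : D.arm (i, y) = (j : ℕ) - i - 1 := by
  rw [boxes_eq, mem_columnSet] at h
  rw [arm, ← Fin.card_Ioo i j]
  symm
  refine Finset.card_bij (fun l _ => (l, y)) ?_ ?_ ?_
  · intro l hl
    rw [mem_Ioo] at hl
    rw [mem_filter, mem_aboveBoxes]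
    have h1 : D.top l ≤ D.bot j := by
      rw [top_eq, bot_eq]
      exact D.height_mono hl.2
    have h2 := D.top_le j
    simp only at h ⊢
    exact ⟨⟨by omega, by omega⟩, trivial, hl.1⟩
  · intro a _ c _ hac
    exact (Prod.mk.inj hac).1
  · rintro ⟨l, z⟩ hl
    rw [mem_filter, mem_aboveBoxes] at hl
    obtain ⟨⟨h1, h2⟩, h3, h4⟩ := hl
    simp only at h1 h2 h3 h4 h
    subst h3
    refine ⟨l, mem_Ioo.2 ⟨h4, ?_⟩, rfl⟩
    by_contra hjl
    have h5 : D.top j ≤ D.top l := by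
      rw [top_eq, top_eq]
      exact D.height_mono (by have : (j : ℕ) ≤ l := not_lt.1 hjl
                              omega)
    omega

lemma leg_eq {i : Fin k} {y : ℕ} (h : (i, y) ∈ D.aboveBoxes) : D.leg (i, y) = y - D.top i := by
  rw [mem_aboveBoxes] at h
  rw [leg, ← Nat.card_Ico]
  symm
  refine Finset.card_bij (fun z _ => (i, z)) ?_ ?_ ?_
  · intro z hz
    rw [mem_Ico] at hz
    rw [mem_filter, mem_aboveBoxes]
    simp only at h ⊢
    exact ⟨⟨hz.1, by omega⟩, trivial, hz.2⟩
  · intro a _ c _ hac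
    exact (Prod.mk.inj hac).2
  · rintro ⟨l, z⟩ hl
    rw [mem_filter, mem_aboveBoxes] at hl
    obtain ⟨⟨h1, h2⟩, h3, h4⟩ := hl
    simp only at h1 h2 h3 h4
    subst h3
    exact ⟨z, mem_Ico.2 ⟨h1, h4⟩, rfl⟩

lemma exists_mem_boxes {y : ℕ} (hy : y < K) : ∃ j : Fin k, (j, y) ∈ D.boxes := by
  classical
  have hex : ∃ r, y < D.height r := ⟨k, by rwa [height_last]⟩
  have h1 := Nat.find_spec hex
  have h0 : Nat.find hex ≠ 0 := by
    intro h
    rw [h, height_zero] at h1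
    omega
  have hle : Nat.find hex ≤ k := Nat.find_min' hex (by rwa [height_last])
  have h2 := Nat.find_min hex (m := Nat.find hex - 1) (by omega)
  refine ⟨⟨Nat.find hex - 1, by omega⟩, ?_⟩
  rw [boxes_eq, mem_columnSet, bot_eq, top_eq]
  refine ⟨not_lt.1 h2, ?_⟩
  simp only
  rwa [Nat.sub_add_cancel (by omega)]

/-- A box above the path corresponds to the path box a in its row together with its own column i, to
the left of a. With arm = j - i - 1 and leg = y - top i, the two inequalities, divided by k, say
that the diagonal of a lies in a band fixed by the end of the run in column i. -/
theorem pathdinv_eq (hk : 0 < k) (hK : K = k * m) :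
    D.pathdinv = ∑ a ∈ D.boxes, ∑ i ∈ Iio a.1,
      if D.excess m (i + 1) ≤ boxDiag K a + 1 ∧ boxDiag K a < D.excess m (i + 1) + m
      then 1 else 0 := by
  rw [Finset.sum_sigma', ← Finset.card_filter, pathdinv]
  symm
  have hkey : ∀ {i j : Fin k} {y : ℕ}, (j, y) ∈ D.boxes → i < j →
      (i, y) ∈ D.aboveBoxes ∧ ((D.arm (i, y) * K ≤ k * (D.leg (i, y) + 1) ∧
        k * D.leg (i, y) < (D.arm (i, y) + 1) * K) ↔
      D.excess m (i + 1) ≤ boxDiag K (j, y) + 1 ∧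
        boxDiag K (j, y) < D.excess m (i + 1) + m) := by
    intro i j y h hij
    have hab : (i, y) ∈ D.aboveBoxes := by
      rw [boxes_eq, mem_columnSet] at h
      rw [mem_aboveBoxes]
      have h1 : D.top i ≤ D.bot j := by
        rw [top_eq, bot_eq]
        exact D.height_mono hij
      have h2 := D.top_le j
      simp only at h ⊢
      omega
    refine ⟨hab, ?_⟩
    rw [D.arm_eq h, D.leg_eq hab]
    have e1 : ((j : ℕ) - i - 1) * K = k * (((j : ℕ) - i - 1) * m) := by rw [hK]; ring
    have e2 : ((j : ℕ) - i - 1 + 1) * K = k * (((j : ℕ) - i - 1 + 1) * m) := by rw [hK]; ring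
    rw [e1, e2, Nat.mul_le_mul_left_iff hk, Nat.mul_lt_mul_left hk, boxDiag_eq hk hK]
    unfold excess
    rw [← top_eq]
    have h3 := (D.mem_aboveBoxes.1 hab).1
    have hij' : (i : ℕ) < j := hij
    obtain ⟨t, ht⟩ : ∃ t, (j : ℕ) = i + 1 + t := ⟨j - i - 1, by omega⟩
    obtain ⟨l, hl⟩ : ∃ l, y = D.top i + l := ⟨y - D.top i, by simp only at h3; omega⟩
    have e3 : (j : ℕ) - i - 1 = t := by omega
    have e4 : y - D.top i = l := by omega
    rw [e3, e4]
    simp only [ht]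
    have hl' : (y : ℤ) = D.top i + l := by exact_mod_cast hl
    rw [hl']
    zify
    constructor
    · rintro ⟨h5, h6⟩
      constructor <;> nlinarith
    · rintro ⟨h5, h6⟩
      constructor <;> nlinarith
  refine Finset.card_bij (fun p _ => (p.2, p.1.2)) ?_ ?_ ?_
  · rintro ⟨⟨j, y⟩, i⟩ h
    rw [mem_filter, mem_sigma, mem_Iio] at h
    obtain ⟨⟨h1, h2⟩, h3⟩ := h
    have h4 := hkey h1 h2
    exact mem_filter.2 ⟨h4.1, h4.2.2 h3⟩
  · rintro ⟨⟨j, y⟩, i⟩ h ⟨⟨j', y'⟩, i'⟩ h' heq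
    obtain ⟨rfl, rfl⟩ := Prod.mk.inj heq
    rw [mem_filter, mem_sigma, mem_Iio, boxes_eq, mem_columnSet, bot_eq, top_eq] at h h'
    have hjj : j = j' := by
      rcases lt_trichotomy j j' with hlt | heq | hlt
      · have := D.height_mono (show (j : ℕ) + 1 ≤ j' from hlt)
        simp only at h h'
        omega
      · exact heq
      · have := D.height_mono (show (j' : ℕ) + 1 ≤ j from hlt)
        simp only at h h'
        omega
    rw [hjj]
  · rintro ⟨i, y⟩ h
    rw [mem_filter] at h
    obtain ⟨h1, h2⟩ := h
    have h3 := D.mem_aboveBoxes.1 h1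
    obtain ⟨j, hj⟩ := D.exists_mem_boxes h3.2
    have hij : i < j := by
      by_contra hij
      have h4 := hj
      rw [boxes_eq, mem_columnSet] at h4
      have h5 : D.top j ≤ D.top i := by
        rw [top_eq, top_eq]
        exact D.height_mono (by have : (j : ℕ) ≤ i := not_lt.1 hij
                                omega)
      simp only at h3 h4
      omega
    exact ⟨⟨(j, y), i⟩, mem_filter.2 ⟨mem_sigma.2 ⟨hj, mem_Iio.2 hij⟩, (hkey hj hij).2.1 h2⟩, rfl⟩

end PathDinv

end RatDyckPath

/-! ### The exponent -/

namespace ColumnLabelling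

open Finset

variable {k K : ℕ}

lemma sum_columnSet {A : Type*} [AddCommMonoid A] (lo hi : Fin k → ℕ) (f : Fin k × ℕ → A) :
    ∑ a ∈ columnSet lo hi, f a = ∑ i, ∑ y ∈ Ico (lo i) (hi i), f (i, y) := by
  rw [Finset.sum_sigma']
  refine Finset.sum_bij' (fun a _ => ⟨a.1, a.2⟩) (fun p _ => (p.1, p.2)) ?_ ?_ ?_ ?_ ?_
  · intro a ha
    simpa [mem_columnSet] using ha
  · rintro ⟨i, y⟩ h
    simpa [mem_columnSet] using h
  · exact fun _ _ => rfl
  · exact fun _ _ => rfl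
  · exact fun _ _ => rfl

lemma sum_Ico_sub_succ {A : Type*} [AddCommGroup A] (f : ℕ → A) {lo hi : ℕ} (h : lo ≤ hi) :
    ∑ y ∈ Ico lo hi, (f y - f (y + 1)) = f lo - f hi := by
  induction hi, h using Nat.le_induction with
  | base => simp
  | succ n hn ih => rw [Finset.sum_Ico_succ_top hn, ih]; abel

lemma pos_add_ne (K : ℕ) {a c : Fin k × ℕ} (h : c.1 ≠ a.1) (t : ℤ) :
    pos K c + k * t ≠ pos K a := by
  intro he
  refine not_dvd_pos_sub K h ⟨-t, ?_⟩
  linarith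

lemma not_attacking_of_eq (K : ℕ) {a c : Fin k × ℕ} (h : c.1 = a.1) : ¬ Attacking K c a := by
  rintro (⟨-, h'⟩ | ⟨-, h'⟩)
  · exact absurd h' (by rw [h]; exact lt_irrefl _)
  · exact absurd h' (by rw [h]; exact lt_irrefl _)

/-- The positions in column i increase in steps of k, and (i, y) attacks a exactly when pos a lies
between two consecutive ones. The sum therefore telescopes. -/
lemma sum_attacking_right (K : ℕ) {a : Fin k × ℕ} {i : Fin k} (hia : i ≠ a.1) {lo hi : ℕ}
    (h : lo ≤ hi) :
    (∑ y ∈ Ico lo hi, if Attacking K (i, y) a then 1 else 0 : ℤ) =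
      (if pos K (i, lo) < pos K a then 1 else 0) - if pos K (i, hi) < pos K a then 1 else 0 := by
  rw [← sum_Ico_sub_succ (fun y => (if pos K (i, y) < pos K a then 1 else 0 : ℤ)) h]
  refine Finset.sum_congr rfl fun y _ => ?_
  have h1 := pos_add_ne K (c := (i, y)) hia 1
  simp only [attacking_iff, pos_succ]
  split_ifs <;> omega

lemma sum_attacking_left (K : ℕ) {a : Fin k × ℕ} {i : Fin k} (hia : i ≠ a.1) {lo hi : ℕ}
    (h : lo ≤ hi) :
    (∑ y ∈ Ico lo hi, if Attacking K a (i, y) then 1 else 0 : ℤ) =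
      (if pos K (i, lo) < pos K a + k then 1 else 0) -
        if pos K (i, hi) < pos K a + k then 1 else 0 := by
  rw [← sum_Ico_sub_succ (fun y => (if pos K (i, y) < pos K a + k then 1 else 0 : ℤ)) h]
  refine Finset.sum_congr rfl fun y _ => ?_
  have h1 := pos_add_ne K (c := (i, y)) hia 0
  simp only [attacking_iff, pos_succ]
  split_ifs <;> omega

lemma sum_sum_eq_sum_Iio {A : Type*} [AddCommMonoid A] (M : Fin k → Fin k → A)
    (h : ∀ i, M i i = 0) :
    ∑ j, ∑ i, M i j = ∑ j, ∑ i ∈ Iio j, (M i j + M j i) := by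
  have hsplit : ∀ j, ∑ i, M i j = ∑ i ∈ Iio j, M i j + ∑ i ∈ Ioi j, M i j := by
    intro j
    rw [← Finset.sum_union]
    · symm
      refine Finset.sum_subset (subset_univ _) fun i _ hi => ?_
      rw [mem_union, mem_Iio, mem_Ioi, not_or, not_lt, not_lt] at hi
      rw [le_antisymm hi.2 hi.1, h]
    · rw [Finset.disjoint_left]
      intro i h1 h2
      exact lt_asymm (mem_Iio.1 h1) (mem_Ioi.1 h2)
  have hswap : ∑ j, ∑ i ∈ Ioi j, M i j = ∑ j, ∑ i ∈ Iio j, M j i :=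
    Finset.sum_comm' fun i j => by simp
  simp_rw [hsplit, Finset.sum_add_distrib, hswap]

lemma sum_Iio_val {A : Type*} [AddCommMonoid A] (f : ℕ → A) (j : Fin k) :
    ∑ i ∈ Iio j, f i = ∑ r ∈ range j, f r := by
  rw [← Nat.Iio_eq_range, ← Fin.map_valEmbedding_Iio, Finset.sum_map]
  rfl

lemma sum_Ioi_val {A : Type*} [AddCommMonoid A] (f : ℕ → A) (j : Fin k) :
    ∑ i ∈ Ioi j, f i = ∑ r ∈ Ico ((j : ℕ) + 1) k, f r := by
  refine Finset.sum_bij (fun i _ => (i : ℕ)) ?_ ?_ ?_ ?_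
  · intro i hi
    exact mem_Ico.2 ⟨mem_Ioi.1 hi, i.2⟩
  · exact fun _ _ _ _ h => Fin.ext h
  · intro r hr
    rw [mem_Ico] at hr
    exact ⟨⟨r, hr.2⟩, mem_Ioi.2 hr.1, rfl⟩
  · exact fun _ _ => rfl

end ColumnLabelling

/-! ### Starts and ends of vertical runs; energy and boundary. -/

namespace RatDyckPath

open Finset TransferSum ColumnLabelling

variable {K k : ℕ} (D : RatDyckPath K k) {N : ℕ}

/-- The position of the lowest box on the path at `x = r`. -/
def startPos (N r : ℕ) : ℤ := k * D.excess (N + 1) r + r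

/-- The position of the box `N` rows below the top of the vertical run of a column. -/
def endPos (N : ℕ) (i : Fin k) : ℤ := pos K (i, D.top i) - k * N

lemma pos_top (i : Fin k) : pos K (i, D.top i) = D.endPos N i + k * N := by
  unfold endPos
  ring

lemma pos_bot (hk : 0 < k) (hK : K = k * (N + 1)) (i : Fin k) :
    pos K (i, D.bot i) = D.startPos N i := by
  rw [pos, D.boxDiag_bot hk hK, startPos]

lemma endPos_eq (hk : 0 < k) (hK : K = k * (N + 1)) (i : Fin k) :
    D.endPos N i = k * (D.excess (N + 1) (i + 1) + 1) + (i : ℕ) := by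
  rw [endPos, pos, D.boxDiag_top hk hK]
  push_cast
  ring

/-- A run starts at the height at which the preceding one ends, one column further right. This
changes the position by 1 - k(N + 1), of which kN is already subtracted in `endPos`. -/
lemma startPos_succ (hk : 0 < k) (hK : K = k * (N + 1)) (i : Fin k) :
    D.startPos N (i + 1) = D.endPos N i - k + 1 := by
  rw [startPos, D.endPos_eq hk hK]
  push_cast
  ring

lemma startPos_zero : D.startPos N 0 = 0 := by simp [startPos, excess_zero]

lemma startPos_last (hK : K = k * (N + 1)) : D.startPos N k = k := by
  rw [startPos, D.excess_last hK]
  ring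

lemma le_endPos (hk : 0 < k) (hK : K = k * (N + 1)) (i : Fin k) : k ≤ D.endPos N i := by
  rw [D.endPos_eq hk hK]
  have h := D.excess_nonneg hK (r := i + 1) i.2
  nlinarith

lemma startPos_nonneg (hK : K = k * (N + 1)) {r : ℕ} (hr : r ≤ k) : 0 ≤ D.startPos N r := by
  have h := D.excess_nonneg hK hr
  unfold startPos
  positivity

lemma startPos_le_pos (hk : 0 < k) (hK : K = k * (N + 1)) {a : Fin k × ℕ}
    (ha : D.bot a.1 ≤ a.2) : D.startPos N a.1 ≤ pos K a := by
  have h := D.excess_le_boxDiag hk hK ha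
  unfold startPos pos
  have : (k : ℤ) * D.excess (N + 1) a.1 ≤ k * boxDiag K a :=
    mul_le_mul_of_nonneg_left h (by positivity)
  linarith

lemma endPos_add_ne (a : Fin k × ℕ) {i : Fin k} (h : i ≠ a.1) (t : ℤ) :
    D.endPos N i + k * t ≠ pos K a := by
  have := pos_add_ne K (c := (i, D.top i)) (a := a) h (t - N)
  unfold endPos
  intro he
  apply this
  linarith

lemma endPos_add_ne_endPos {i j : Fin k} (h : i ≠ j) (t : ℤ) :
    D.endPos N i + k * t ≠ D.endPos N j := by
  have := D.endPos_add_ne (N := N) (j, D.top j) h (t + N)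
  rw [D.pos_top (N := N) j] at this
  intro he
  apply this
  linarith

lemma startPos_ne (hk : 0 < k) (hK : K = k * (N + 1)) (a : Fin k × ℕ) {i : Fin k} (h : i ≠ a.1)
    (t : ℤ) : D.startPos N i + k * t ≠ pos K a := by
  rw [← D.pos_bot hk hK]
  exact pos_add_ne K h t

lemma cast_attackCount (S T : Finset (Fin k × ℕ)) :
    (attackCount K S T : ℤ) = ∑ a ∈ T, ∑ c ∈ S, if Attacking K c a then 1 else 0 := by
  unfold attackCount
  push_cast
  rfl

section BigBoxes

variable {b : Fin k → ℕ}

lemma pos_bigBot (hb : ∀ i, b i ≤ D.run i) (i : Fin k) :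
    pos K (i, D.bigBot b i) = D.endPos N i + k * ((N : ℤ) - b i) := by
  have h := pos_add K i (D.bigBot b i) (b i)
  rw [← D.bigBot_add hb, D.pos_top (N := N)] at h
  linarith

/-- Telescoping the attacks from the small boxes of column i replaces the lowest big box by the
start of the run in the comparison with a. The remaining count of starts beyond a no longer depends
on b, and shifting the column index by one turns starts into ends. -/
lemma card_sub_sum_attacking (hk : 0 < k) (hK : K = k * (N + 1)) (hb : ∀ i, b i ≤ D.run i)
    (hbN : ∀ i, b i ≤ N) {a : Fin k × ℕ} (ha : a ∈ D.bigBoxes b) :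
    ((univ.filter fun i => pos K a < pos K (i, D.bigBot b i)).card : ℤ) -
        ∑ c ∈ D.smallBoxes b, (if Attacking K c a then 1 else 0) =
      ∑ i, if pos K a + k < D.endPos N i then 1 else 0 := by
  have hkz : (0 : ℤ) < k := by exact_mod_cast hk
  rw [D.bigBoxes_eq hb, mem_columnSet] at ha
  have hle := D.bot_le_bigBot hb
  have hbig : pos K (a.1, D.bigBot b a.1) ≤ pos K a := by
    have := (pos_lt_pos_iff K a.1 a.2 (D.bigBot b a.1)).not
    rw [not_lt, not_lt] at this
    exact this.2 ha.1
  have hend : D.endPos N a.1 ≤ pos K a := by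
    have h1 := D.pos_bigBot (N := N) hb a.1
    have h2 : (0 : ℤ) ≤ k * ((N : ℤ) - b a.1) := by
      have : (b a.1 : ℤ) ≤ N := by exact_mod_cast hbN a.1
      exact mul_nonneg hkz.le (by linarith)
    linarith
  have hstart := D.startPos_le_pos hk hK (a := a) ((hle a.1).trans ha.1)
  have hkend := D.le_endPos hk hK a.1
  have hterm : ∀ i : Fin k, ((if pos K a < pos K (i, D.bigBot b i) then 1 else 0 : ℤ) -
      ∑ y ∈ Ico (D.bot i) (D.bigBot b i), if Attacking K (i, y) a then 1 else 0) =
      if pos K a < D.startPos N i then 1 else 0 := by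
    intro i
    by_cases hi : i = a.1
    · rw [Finset.sum_eq_zero fun y _ => if_neg (not_attacking_of_eq K hi), hi,
        if_neg (not_lt.2 hbig), if_neg (not_lt.2 hstart), sub_zero]
    · rw [sum_attacking_right K hi (hle i), D.pos_bot hk hK]
      have h1 := pos_add_ne K (c := (i, D.bigBot b i)) hi 0
      have h2 := D.startPos_ne hk hK a hi 0
      have h3 : D.startPos N i ≤ pos K (i, D.bigBot b i) :=
        D.startPos_le_pos hk hK (a := (i, D.bigBot b i)) (hle i)
      split_ifs <;> omega
  rw [D.smallBoxes_eq hb, sum_columnSet, Finset.card_filter]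
  push_cast
  rw [← Finset.sum_sub_distrib, Finset.sum_congr rfl fun i _ => hterm i,
    Fin.sum_univ_eq_sum_range (fun r => if pos K a < D.startPos N r then (1 : ℤ) else 0)]
  -- The terms at r = 0 and r = k are both zero: the starts there are 0 and k, and admissibility
  -- gives pos a ≥ endPos ≥ k.
  have hshift : ∑ r ∈ range k, (if pos K a < D.startPos N r then (1 : ℤ) else 0) =
      ∑ r ∈ range k, if pos K a < D.startPos N (r + 1) then 1 else 0 := by
    have h1 := Finset.sum_range_succ (fun r => if pos K a < D.startPos N r then (1 : ℤ) else 0) k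
    have h2 := Finset.sum_range_succ' (fun r => if pos K a < D.startPos N r then (1 : ℤ) else 0) k
    rw [D.startPos_last hK, if_neg (by omega)] at h1
    rw [D.startPos_zero, if_neg (by omega)] at h2
    linarith
  rw [hshift, ← Fin.sum_univ_eq_sum_range
    (fun r => if pos K a < D.startPos N (r + 1) then (1 : ℤ) else 0)]
  refine Finset.sum_congr rfl fun i _ => ?_
  rw [D.startPos_succ hk hK]
  by_cases hi : i = a.1
  · subst hi
    rw [if_neg (by omega), if_neg (by omega)]
  · have := D.endPos_add_ne (N := N) a hi (-1)
    split_ifs <;> omega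

/-- The number of triples `(i, j, r)` with `1 ≤ r ≤ N` such that the end position of column `i`
is above the box `r` rows above the end position of column `j`. -/
def endCount (N : ℕ) : ℤ :=
  ∑ j, ∑ i, ∑ r ∈ range N, if D.endPos N j + k * (r + 1) < D.endPos N i then 1 else 0

/-- Count the rows of column j upwards from its end position. The big boxes occupy the rows r with N
- b j ≤ r < N, and the terms of the energy are the same comparisons for the rows r < N - b j below
them. Together they fill the N rows whatever b is. -/
theorem energy_add_boundary_sub (hk : 0 < k) (hK : K = k * (N + 1)) (hb : ∀ i, b i ≤ D.run i)
    (hbN : ∀ i, b i ≤ N) :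
    (energy k (fun i => pos K (i, D.bigBot b i)) (fun i => N - b i) : ℤ) +
      boundary K (D.bigBoxes b) (fun i => pos K (i, D.bigBot b i)) - D.smallBigPairs b =
    D.endCount N := by
  have hcast : ∀ i, ((N - b i : ℕ) : ℤ) = (N : ℤ) - b i := fun i => Nat.cast_sub (hbN i)
  have hbd : (boundary K (D.bigBoxes b) (fun i => pos K (i, D.bigBot b i)) : ℤ) -
      D.smallBigPairs b = ∑ j, ∑ r ∈ Ico (N - b j) N, ∑ i,
        if D.endPos N j + k * ((r : ℤ) + 1) < D.endPos N i then 1 else 0 := by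
    rw [smallBigPairs_eq, cast_attackCount, boundary]
    push_cast
    rw [← Finset.sum_sub_distrib,
      Finset.sum_congr rfl fun a ha => D.card_sub_sum_attacking hk hK hb hbN ha,
      D.bigBoxes_eq hb, sum_columnSet]
    refine Finset.sum_congr rfl fun j _ => ?_
    rw [Finset.sum_Ico_eq_sum_range, Finset.sum_Ico_eq_sum_range, Nat.sub_sub_self (hbN j),
      D.bigBot_add hb j, Nat.add_sub_cancel_left]
    refine Finset.sum_congr rfl fun r _ => Finset.sum_congr rfl fun i _ => ?_
    rw [pos_add, D.pos_bigBot (N := N) hb]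
    push_cast
    rw [hcast]
    congr 2
    ring
  have hen : (energy k (fun i => pos K (i, D.bigBot b i)) (fun i => N - b i) : ℤ) =
      ∑ j, ∑ r ∈ range (N - b j), ∑ i,
        if D.endPos N j + k * ((r : ℤ) + 1) < D.endPos N i then 1 else 0 := by
    unfold energy endRank
    push_cast
    refine Finset.sum_congr rfl fun j _ => ?_
    -- The energy descends from the lowest big box, so its index s corresponds to the row r = N - b
    -- j - 1 - s.
    rw [← Finset.sum_range_reflect]
    refine Finset.sum_congr rfl fun r hr => ?_
    rw [Finset.card_filter]
    push_cast
    refine Finset.sum_congr rfl fun i _ => ?_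
    rw [mem_range] at hr
    have h1 : ((N - b j - 1 - r : ℕ) : ℤ) = (N : ℤ) - b j - 1 - r := by
      have := hbN j
      omega
    rw [D.pos_bigBot (N := N) hb, D.pos_bigBot (N := N) hb, hcast, h1]
    congr 2
    · ring
    · ring
  rw [add_sub_assoc, hbd, hen, ← Finset.sum_add_distrib, endCount]
  refine Finset.sum_congr rfl fun j _ => ?_
  rw [Finset.sum_range_add_sum_Ico _ (Nat.sub_le _ _), Finset.sum_comm]

end BigBoxes

end RatDyckPath

/-! ### The difference of maxtdinv and pathdinv, and the exponent. -/

namespace RatDyckPath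

open Finset TransferSum ColumnLabelling

variable {K k : ℕ} (D : RatDyckPath K k) {N : ℕ}

/-- Shifting the column index replaces starts by the preceding ends. The two extreme terms, the
start of column 0 and that of the column of a, satisfy the inequality and cancel. -/
lemma sum_Iio_startPos (hk : 0 < k) (hK : K = k * (N + 1)) {a : Fin k × ℕ}
    (ha : D.bot a.1 ≤ a.2) {t : ℤ} (ht : 0 ≤ t) :
    (∑ i ∈ Iio a.1, if D.startPos N i < pos K a + k * t then 1 else 0 : ℤ) =
      ∑ i ∈ Iio a.1, if D.endPos N i < pos K a + k * (t + 1) then 1 else 0 := by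
  have hkt : 0 ≤ k * t := by positivity
  have hle := D.startPos_le_pos hk hK ha
  have hnn := D.startPos_nonneg hK (r := a.1) (le_of_lt a.1.2)
  have hstart : ∀ i ∈ Iio a.1, (if D.startPos N i < pos K a + k * t then (1 : ℤ) else 0) =
      if D.startPos N i ≤ pos K a + k * t then 1 else 0 := by
    intro i hi
    have := D.startPos_ne hk hK a (ne_of_lt (mem_Iio.1 hi)) (-t)
    split_ifs <;> first | rfl | (exfalso; linarith) |
      (exfalso; exact this (by linarith))
  have hend : ∀ i ∈ Iio a.1, (if D.endPos N i < pos K a + k * (t + 1) then (1 : ℤ) else 0) =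
      if D.startPos N (i + 1) ≤ pos K a + k * t then 1 else 0 := by
    intro i _
    rw [D.startPos_succ hk hK, mul_add, mul_one]
    refine if_congr ?_ rfl rfl
    omega
  rw [Finset.sum_congr rfl hstart, Finset.sum_congr rfl hend,
    sum_Iio_val (fun r => if D.startPos N r ≤ pos K a + k * t then (1 : ℤ) else 0),
    sum_Iio_val (fun r => if D.startPos N (r + 1) ≤ pos K a + k * t then (1 : ℤ) else 0)]
  have h1 := Finset.sum_range_succ
    (fun r => if D.startPos N r ≤ pos K a + k * t then (1 : ℤ) else 0) a.1
  have h2 := Finset.sum_range_succ'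
    (fun r => if D.startPos N r ≤ pos K a + k * t then (1 : ℤ) else 0) a.1
  rw [if_pos (by linarith)] at h1
  rw [D.startPos_zero, if_pos (by linarith)] at h2
  linarith

/-- For columns i < j, the attacks in both directions are collected at the box a of column j. Each
direction telescopes along column i. -/
lemma cast_maxtdinv (hk : 0 < k) (hK : K = k * (N + 1)) :
    (D.maxtdinv : ℤ) = ∑ a ∈ D.boxes, ∑ i ∈ Iio a.1,
      (((if D.startPos N i < pos K a then 1 else 0) -
          if D.endPos N i + k * N < pos K a then 1 else 0) +
        ((if D.startPos N i < pos K a + k then 1 else 0) -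
          if D.endPos N i + k * N < pos K a + k then 1 else 0)) := by
  rw [D.maxtdinv_eq hk hK, cast_attackCount, boxes_eq, sum_columnSet, sum_columnSet]
  have h1 : ∀ j, (∑ y ∈ Ico (D.bot j) (D.top j), ∑ c ∈ columnSet D.bot D.top,
      if Attacking K c (j, y) then 1 else 0 : ℤ) =
      ∑ i, ∑ y ∈ Ico (D.bot j) (D.top j), ∑ z ∈ Ico (D.bot i) (D.top i),
        if Attacking K (i, z) (j, y) then 1 else 0 := by
    intro j
    rw [Finset.sum_comm (s := univ)]
    exact Finset.sum_congr rfl fun y _ =>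
      sum_columnSet _ _ fun c => if Attacking K c (j, y) then (1 : ℤ) else 0
  rw [Finset.sum_congr rfl fun j _ => h1 j, sum_sum_eq_sum_Iio
    (fun i j => ∑ y ∈ Ico (D.bot j) (D.top j), ∑ z ∈ Ico (D.bot i) (D.top i),
      if Attacking K (i, z) (j, y) then (1 : ℤ) else 0)]
  · refine Finset.sum_congr rfl fun j _ => ?_
    rw [Finset.sum_comm' (t' := Iio j) (s' := fun _ => Ico (D.bot j) (D.top j))
      (fun y i => Iff.rfl)]
    refine Finset.sum_congr rfl fun i hi => ?_
    rw [Finset.sum_comm (s := Ico (D.bot i) (D.top i)), ← Finset.sum_add_distrib]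
    refine Finset.sum_congr rfl fun y _ => ?_
    have hne : i ≠ (j, y).1 := ne_of_lt (mem_Iio.1 hi)
    rw [sum_attacking_right K hne (D.bot_le_top i), sum_attacking_left K hne (D.bot_le_top i),
      D.pos_bot hk hK, D.pos_top (N := N)]
  · intro i
    exact Finset.sum_eq_zero fun y _ => Finset.sum_eq_zero fun z _ =>
      if_neg (not_attacking_of_eq K (a := (i, y)) (c := (i, z)) rfl)

/-- Because i is to the left of a, comparing positions amounts to a weak comparison of diagonals,
which rewrites the band as two position inequalities. -/
lemma cast_pathdinv (hk : 0 < k) (hK : K = k * (N + 1)) :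
    (D.pathdinv : ℤ) = ∑ a ∈ D.boxes, ∑ i ∈ Iio a.1,
      ((if D.endPos N i < pos K a + k * 2 then 1 else 0) -
        if D.endPos N i + k * N < pos K a then 1 else 0) := by
  rw [D.pathdinv_eq hk hK]
  push_cast
  refine Finset.sum_congr rfl fun a _ => Finset.sum_congr rfl fun i hi => ?_
  have hlt : (i : ℕ) < (a.1 : ℕ) := Fin.lt_def.1 (mem_Iio.1 hi)
  have hak := a.1.2
  have h1 := mul_lt_mul_add_iff (κ := k) (d := D.excess (N + 1) (i + 1) + 1)
    (d' := boxDiag K a + 2) (r := (i : ℕ)) (r' := (a.1 : ℕ)) (by omega) (by omega)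
    (by omega) (by omega)
  have h2 := mul_lt_mul_add_iff (κ := k) (d := D.excess (N + 1) (i + 1) + 1 + N)
    (d' := boxDiag K a) (r := (i : ℕ)) (r' := (a.1 : ℕ)) (by omega) (by omega)
    (by omega) (by omega)
  have e1 : D.endPos N i < pos K a + k * 2 ↔
      D.excess (N + 1) (i + 1) ≤ boxDiag K a + 1 := by
    rw [D.endPos_eq hk hK, pos, add_right_comm, ← mul_add, h1]
    omega
  have e2 : D.endPos N i + k * N < pos K a ↔
      D.excess (N + 1) (i + 1) + (N + 1) ≤ boxDiag K a := by
    rw [D.endPos_eq hk hK, pos, add_right_comm, ← mul_add, h2]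
    omega
  simp only [e1, e2]
  split_ifs <;> omega

/-- With starts replaced by ends, two of the four indicators in `cast_maxtdinv` cancel both
indicators of `cast_pathdinv`. -/
lemma maxtdinv_sub_pathdinv (hk : 0 < k) (hK : K = k * (N + 1)) :
    (D.maxtdinv : ℤ) - D.pathdinv = ∑ a ∈ D.boxes, ∑ i ∈ Iio a.1,
      ((if D.endPos N i < pos K a + k then 1 else 0) -
        if D.endPos N i + k * N < pos K a + k then 1 else 0) := by
  rw [D.cast_maxtdinv hk hK, D.cast_pathdinv hk hK, ← Finset.sum_sub_distrib]
  refine Finset.sum_congr rfl fun a ha => ?_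
  rw [boxes_eq, mem_columnSet] at ha
  have h0 := D.sum_Iio_startPos hk hK ha.1 le_rfl
  have h1 := D.sum_Iio_startPos hk hK ha.1 zero_le_one
  simp only [mul_zero, add_zero, zero_add, mul_one, one_add_one_eq_two] at h0 h1
  simp only [Finset.sum_add_distrib, Finset.sum_sub_distrib]
  rw [h0, h1]
  ring

/-- Moving the end of column i by k is equivalent to moving y by one. So each difference is a
telescoping sum over r, and after exchanging the sums it telescopes over y. -/
lemma sum_Ico_endPos (hk : 0 < k) (hK : K = k * (N + 1)) (i j : Fin k) :
    (∑ y ∈ Ico (D.bot j) (D.top j), ((if D.endPos N i < pos K (j, y) + k then 1 else 0) -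
        if D.endPos N i + k * N < pos K (j, y) + k then 1 else 0) : ℤ) =
      ∑ r ∈ range N, ((if D.endPos N i + k * r < D.endPos N j + k * N then 1 else 0) -
        if D.endPos N i + k * r < D.startPos N j then 1 else 0) := by
  have h1 : ∀ y, ((if D.endPos N i < pos K (j, y) + k then 1 else 0) -
      if D.endPos N i + k * N < pos K (j, y) + k then 1 else 0 : ℤ) =
      ∑ r ∈ range N, ((if D.endPos N i + k * r < pos K (j, y + 1) then 1 else 0) -
        if D.endPos N i + k * r < pos K (j, y) then 1 else 0) := by
    intro y
    have h := Finset.sum_range_sub'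
      (fun r : ℕ => if D.endPos N i + k * r < pos K (j, y) + k then (1 : ℤ) else 0) N
    simp only [Nat.cast_zero, mul_zero, add_zero] at h
    rw [← h]
    refine Finset.sum_congr rfl fun r _ => ?_
    rw [pos_succ]
    congr 1
    refine if_congr ?_ rfl rfl
    push_cast
    rw [mul_add, mul_one, ← add_assoc, add_lt_add_iff_right]
  rw [Finset.sum_congr rfl fun y _ => h1 y, Finset.sum_comm]
  refine Finset.sum_congr rfl fun r _ => ?_
  have h := sum_Ico_sub_succ
    (fun y => -(if D.endPos N i + k * r < pos K (j, y) then (1 : ℤ) else 0)) (D.bot_le_top j)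
  simp only [neg_sub_neg] at h
  rw [h, D.pos_top (N := N), D.pos_bot hk hK]

/-- The index shift from starts to ends, now to the right of column i; here both extreme terms are
zero, since the starts at i + 1 and at k do not exceed the end of column i. -/
lemma sum_Ioi_startPos (hk : 0 < k) (hK : K = k * (N + 1)) (i : Fin k) (r : ℕ) :
    (∑ j ∈ Ioi i, if D.endPos N i + k * r < D.startPos N j then 1 else 0 : ℤ) =
      ∑ j ∈ Ioi i, if D.endPos N i + k * (r + 1) < D.endPos N j then 1 else 0 := by
  have hkr : 0 ≤ (k : ℤ) * r := by positivity
  have hend : ∀ j ∈ Ioi i, (if D.endPos N i + k * (r + 1) < D.endPos N j then (1 : ℤ) else 0) =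
      if D.endPos N i + k * r < D.startPos N (j + 1) then 1 else 0 := by
    intro j hj
    have hne := D.endPos_add_ne_endPos (N := N) (ne_of_lt (mem_Ioi.1 hj)) (r + 1)
    rw [D.startPos_succ hk hK]
    rw [mul_add, mul_one] at hne ⊢
    refine if_congr ?_ rfl rfl
    omega
  rw [Finset.sum_congr rfl hend,
    sum_Ioi_val (fun s => if D.endPos N i + k * r < D.startPos N s then (1 : ℤ) else 0),
    sum_Ioi_val (fun s => if D.endPos N i + k * r < D.startPos N (s + 1) then (1 : ℤ) else 0)]
  have h := sum_Ico_sub_succ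
    (fun s => if D.endPos N i + k * r < D.startPos N s then (1 : ℤ) else 0)
    (show (i : ℕ) + 1 ≤ k from i.2)
  have h1 := D.le_endPos hk hK i
  rw [D.startPos_last hK, D.startPos_succ hk hK, if_neg (by omega), if_neg (by omega),
    Finset.sum_sub_distrib] at h
  linarith

/-- For i < j, reflecting r ↦ N - 1 - r shows that the first sum of `sum_Ico_endPos` is N minus the
contribution of one order of the pair to `endCount`. After `sum_Ioi_startPos` the second sum gives
the other order, and the constants N add up over all pairs of columns. -/
theorem maxtdinv_sub_pathdinv_eq (hk : 0 < k) (hK : K = k * (N + 1)) :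
    (D.maxtdinv : ℤ) - D.pathdinv = N * k.choose 2 - D.endCount N := by
  have hfirst : ∀ i j : Fin k, i ≠ j →
      (∑ r ∈ range N, if D.endPos N i + k * r < D.endPos N j + k * N then 1 else 0 : ℤ) =
      N - ∑ r ∈ range N, if D.endPos N j + k * (r + 1) < D.endPos N i then 1 else 0 := by
    intro i j hij
    rw [← Finset.sum_range_reflect, eq_sub_iff_add_eq, ← Finset.sum_add_distrib]
    have h1 : ∀ r ∈ range N,
        ((if D.endPos N i + k * ((N - 1 - r : ℕ) : ℤ) < D.endPos N j + k * N then 1 else 0) +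
          if D.endPos N j + k * ((r : ℤ) + 1) < D.endPos N i then 1 else 0 : ℤ) = 1 := by
      intro r hr
      rw [mem_range] at hr
      have hc : ((N - 1 - r : ℕ) : ℤ) = N - (r + 1) := by omega
      have hne := D.endPos_add_ne_endPos (N := N) hij.symm (r + 1)
      rw [hc, mul_sub]
      split_ifs <;> omega
    rw [Finset.sum_congr rfl h1]
    simp
  have hswap : ∀ F : Fin k → Fin k → ℤ, ∑ j, ∑ i ∈ Iio j, F i j = ∑ i, ∑ j ∈ Ioi i, F i j :=
    fun F => Finset.sum_comm' fun i j => by simp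
  have hcol : (D.maxtdinv : ℤ) - D.pathdinv = ∑ j, ∑ i ∈ Iio j,
      ((N : ℤ) - (∑ r ∈ range N, if D.endPos N j + k * (r + 1) < D.endPos N i then 1 else 0) -
        ∑ r ∈ range N, if D.endPos N i + k * r < D.startPos N j then 1 else 0) := by
    rw [D.maxtdinv_sub_pathdinv hk hK, boxes_eq, sum_columnSet]
    refine Finset.sum_congr rfl fun j _ => ?_
    rw [Finset.sum_comm' (t' := Iio j) (s' := fun _ => Ico (D.bot j) (D.top j))
      (fun y i => Iff.rfl)]
    refine Finset.sum_congr rfl fun i hi => ?_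
    rw [D.sum_Ico_endPos hk hK, Finset.sum_sub_distrib, hfirst i j (ne_of_lt (mem_Iio.1 hi))]
  have hlast : (∑ j, ∑ i ∈ Iio j, ∑ r ∈ range N,
      if D.endPos N i + k * r < D.startPos N j then 1 else 0 : ℤ) =
      ∑ j, ∑ i ∈ Iio j, ∑ r ∈ range N,
        if D.endPos N i + k * (r + 1) < D.endPos N j then 1 else 0 := by
    rw [hswap, hswap]
    refine Finset.sum_congr rfl fun i _ => ?_
    rw [Finset.sum_comm, Finset.sum_comm (s := Ioi i)]
    exact Finset.sum_congr rfl fun r _ => D.sum_Ioi_startPos hk hK i r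
  have hend : D.endCount N = ∑ j, ∑ i ∈ Iio j,
      ((∑ r ∈ range N, if D.endPos N j + k * (r + 1) < D.endPos N i then 1 else 0) +
        ∑ r ∈ range N, if D.endPos N i + k * (r + 1) < D.endPos N j then 1 else 0) := by
    rw [endCount, sum_sum_eq_sum_Iio
      (fun i j => ∑ r ∈ range N, if D.endPos N j + k * (r + 1) < D.endPos N i then (1 : ℤ) else 0)]
    intro i
    refine Finset.sum_eq_zero fun r _ => if_neg ?_
    have : (0 : ℤ) ≤ k * (r + 1) := by positivity
    omega
  have hcard : ∑ j : Fin k, ∑ _i ∈ Iio j, (N : ℤ) = N * k.choose 2 := by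
    simp only [Finset.sum_const, Fin.card_Iio, nsmul_eq_mul]
    rw [← Finset.sum_mul, Fin.sum_univ_eq_sum_range (fun j => (j : ℤ)), mul_comm,
      Nat.choose_two_right, ← Finset.sum_range_id]
    push_cast
    rfl
  rw [hcol, hend]
  simp only [Finset.sum_sub_distrib, Finset.sum_add_distrib]
  rw [hlast, hcard]
  ring

theorem cExponent_eq {b : Fin k → ℕ} (hk : 0 < k) (hK : K = k * (N + 1))
    (hb : ∀ i, b i ≤ D.run i) (hbN : ∀ i, b i ≤ N) :
    D.cExponent b = (N * k.choose 2 : ℤ) -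
      energy k (fun i => pos K (i, D.bigBot b i)) (fun i => N - b i) -
      boundary K (D.bigBoxes b) (fun i => pos K (i, D.bigBot b i)) := by
  have h1 := D.energy_add_boundary_sub hk hK hb hbN
  have h2 := D.maxtdinv_sub_pathdinv_eq hk hK
  unfold cExponent
  linarith

end RatDyckPath

open ColumnLabelling in
theorem theorem4 (K k n : ℕ) (hk : 1 ≤ k) (hkn : k ≤ n) (hK : K = k * (n - k + 1))
    (D : RatDyckPath K k) (b : Fin k → ℕ) (hb : ∀ i, b i ≤ D.run i)
    (hsum : ∑ i, b i = (k - 1) * (n - k)) :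
    IsSymmetricFunction (D.fBig (RatFunc.X : RatFunc ℚ) b) ∧
    ((∀ i, b i ≤ n - k) →
      hallInner (omegaInvolution (D.fBig (RatFunc.X : RatFunc ℚ) b))
          (schurFunction (RatFunc ℚ) (rectDiagram (k - 1) (n - k))) =
        hallInner (D.fBig (RatFunc.X : RatFunc ℚ) b)
          (schurFunction (RatFunc ℚ) (rectDiagram (n - k) (k - 1))) ∧
      hallInner (D.fBig (RatFunc.X : RatFunc ℚ) b)
          (schurFunction (RatFunc ℚ) (rectDiagram (n - k) (k - 1))) =
        (RatFunc.X : RatFunc ℚ) ^ D.cExponent b) ∧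
    ((¬ ∀ i, b i ≤ n - k) →
      hallInner (D.fBig (RatFunc.X : RatFunc ℚ) b)
          (schurFunction (RatFunc ℚ) (rectDiagram (n - k) (k - 1))) = 0) := by
  have hq : (RatFunc.X : RatFunc ℚ) ≠ 0 := RatFunc.X_ne_zero
  have hlohi : ∀ i, D.top i = D.bigBot b i + b i := D.bigBot_add hb
  rw [RatDyckPath.fBig, D.bigBoxes_eq hb]
  refine ⟨isSymmetricFunction_lltFunction hq hk fun i => ?_, fun hbN => ⟨?_, ?_⟩, fun hbN => ?_⟩
  · rw [hlohi]
    exact Nat.le_add_right _ _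
  · rw [← SymmetricFunction.transpose_rectDiagram (n - k) (k - 1),
      SymmetricFunction.hallInner_omegaInvolution]
  · rw [hallInner_lltFunction hq hk hbN hsum hlohi, D.cExponent_eq hk hK hb hbN,
      D.bigBoxes_eq hb]
  · push Not at hbN
    exact hallInner_lltFunction_eq_zero hq hk hbN hlohi
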